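/- Let $(M,g)$ be a compact connected smooth Riemannian manifold without boundary, of dimension $n\ge 1$, with Levi-Civita connection $\nabla$, and let $\pi:(E,\tilde g)\to M$ be a smooth Riemannian vector bundle of rank $m\ge 2$ with a smooth metric connection $\tilde\nabla$. Let $E_*$ be $E$ with the zero section removed and $\Sigma=\{\xi\in E:\|\xi\|=1\}$ the unit sphere bundle. The connection $\tilde\nabla$ splits $TE=HE\oplus VE\cong \pi^*TM\oplus\pi^*E$ into horizontal and vertical parts. Let $G=\pi^*g\oplus\pi^*\tilde g$ be the corresponding (Sasaki) metric on $E$ and $D=\pi^*\nabla\oplus\pi^*\tilde\nabla$ the corresponding (Sasaki) connection on $TE$, which is $G$-metric but in general has torsion. For $u\in C^\infty(\Sigma)$, identified with its radially constant extension to $E_*$, the radial graph of $u$ is the hypersurface $\mathcal Y=\{e^{u(\xi)}\xi:\xi\in\Sigma\}\subset E_*$. Its vertical Gaussian curvature at $\eta\in\mathcal Y\cap E_x$ is the Gaussian curvature at $\eta$ of $\mathcal Y\cap E_x$ as a hypersurface of the Euclidean space $(E_x,\tilde g_x)$, with the outward unit normal and the sign for which spheres have positive curvature. The vertical Gaussian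 curvature of $\mathcal Y$ is given by $K$ if it equals $K(\eta)$ at each $\eta\in\mathcal Y$. The graph $\mathcal Y$ is called convex if its second fundamental form $II(X,Y)=-G(D_XY,N)$, where $N$ is the outward $G$-unit normal of $\mathcal Y$, is positive semi-definite at each point, i.e. $II(X,X)\ge 0$ for all $X$ tangent to $\mathcal Y$. Let $K\in C^\infty(E_*)$ be strictly positive and constant on each fibre of $E_*\to M$. Then: 1. $u=-\dfrac{\log K}{m-1}$ is a smooth radially constant function on $E_*$, and the vertical Gaussian curvature of its radial graph is given by $K$. 2. If $K$ is constant on $E_*$, the radial graph of $u=-\dfrac{\log K}{m-1}$ is convex. 3. If $K$ is not constant on $E_*$, then no radial graph of a function $u\in C^\infty(\Sigma)$ whose vertical Gaussian curvature is given by $K$ is convex. -/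

import Mathlib

open Bundle Set Filter
open scoped Manifold ContDiff Topology

/-! ### Connections: connector and Levi-Civita condition -/

section Connection

variable
  {EB : Type*} [NormedAddCommGroup EB] [NormedSpace ℝ EB]
  {H : Type*} [TopologicalSpace H] {I : ModelWithCorners ℝ EB H}
  {M : Type*} [TopologicalSpace M] [ChartedSpace H M]
  {F : Type*} [NormedAddCommGroup F] [NormedSpace ℝ F]
  {V : M → Type*} [TopologicalSpace (TotalSpace F V)]
  [∀ x, AddCommGroup (V x)] [∀ x, Module ℝ (V x)] [∀ x, TopologicalSpace (V x)]
  [∀ x, IsTopologicalAddGroup (V x)] [∀ x, ContinuousSMul ℝ (V x)]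
  [FiberBundle F V]

/-- The connector `T_ξ V → V_x` (`x = π ξ`) of a connection `∇` on a vector bundle `V → M`. In the
fibre coordinates `y^α` given by a local frame `s_α` it is
`A ↦ (dy^β(A) + y^α Γ^β_{iα} dx^i(A)) s_β`: the first summand below is `dy^β(A) s_β`; the second is
`∇_{π_* A}` of the section `y^α(ξ) s_α` with constant coefficients through `ξ`.
Its kernel is the horizontal space `H_ξ V`, and it is the identification
`V_x ≅ T_ξ (V_x)` on vertical vectors. -/
noncomputable def connector (cov : CovariantDerivative I F V) (ξ : TotalSpace F V)
    (A : TangentSpace (I.prod 𝓘(ℝ, F)) ξ) : V ξ.proj :=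
  (trivializationAt F V ξ.proj).symm ξ.proj
      (mfderiv (I.prod 𝓘(ℝ, F)) 𝓘(ℝ, F)
        (fun η : TotalSpace F V ↦ ((trivializationAt F V ξ.proj) η).2) ξ A)
    + cov (fun y ↦ (trivializationAt F V ξ.proj).symm y ((trivializationAt F V ξ.proj) ξ).2) ξ.proj
        (mfderiv (I.prod 𝓘(ℝ, F)) I (fun η : TotalSpace F V ↦ η.proj) ξ A)

/-- Covariant derivative `∇_t s (t)` of a section `s : ℝ → V` along the curve `π ∘ s` in `M`, for
the connection induced by `∇` on the pulled back bundle. -/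
noncomputable def covDerivAlong (cov : CovariantDerivative I F V) (s : ℝ → TotalSpace F V) (t : ℝ) :
    V (s t).proj :=
  connector cov (s t) (mfderiv 𝓘(ℝ, ℝ) (I.prod 𝓘(ℝ, F)) s t (1 : ℝ))

end Connection

/-- `cov` is the Levi-Civita connection of the Riemannian manifold `M`: smooth, metric and torsion
free. -/
structure IsLeviCivita
    {EB : Type*} [NormedAddCommGroup EB] [NormedSpace ℝ EB] [FiniteDimensional ℝ EB]
    [CompleteSpace EB]
    {H : Type*} [TopologicalSpace H] {I : ModelWithCorners ℝ EB H}
    {M : Type*} [TopologicalSpace M] [ChartedSpace H M] [IsManifold I ∞ M]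
    [RiemannianBundle (fun x : M ↦ TangentSpace I x)]
    [IsContMDiffRiemannianBundle I ∞ EB (fun x : M ↦ TangentSpace I x)]
    (cov : CovariantDerivative I EB (fun x : M ↦ TangentSpace I x)) : Prop where
  smooth : CovariantDerivative.ContMDiffCovariantDerivative cov ∞
  metric : ∀ (x : M) (A : TangentSpace I x) (X Y : ∀ y : M, TangentSpace I y),
    MDifferentiableAt I (I.prod 𝓘(ℝ, EB)) (fun y ↦ (⟨y, X y⟩ : TangentBundle I M)) x →
    MDifferentiableAt I (I.prod 𝓘(ℝ, EB)) (fun y ↦ (⟨y, Y y⟩ : TangentBundle I M)) x →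
    mfderiv I 𝓘(ℝ, ℝ) (fun y ↦ inner ℝ (X y) (Y y)) x A =
      inner ℝ (cov X x A) (Y x) + inner ℝ (X x) (cov Y x A)
  torsion_free : cov.torsion = 0

/-! ### Gaussian curvature of hypersurfaces of a Euclidean space -/

section Euclidean

variable {W : Type*} [NormedAddCommGroup W] [InnerProductSpace ℝ W]

/-- Tangent vectors at `q` to a subset `S` of a Euclidean space: velocities at `q` of smooth curves
contained in `S`. -/
def tangentVectors (S : Set W) (q : W) : Set W :=
  {v | ∃ c : ℝ → W, ContDiffAt ℝ ∞ c 0 ∧ (∀ᶠ t in 𝓝 0, c t ∈ S) ∧ c 0 = q ∧ deriv c 0 = v}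

/-- `κ` is the Gaussian curvature at `p ∈ S` of the hypersurface `S` of the Euclidean space `W`,
i.e. the determinant of the Weingarten map `v ↦ d_p N (v)` of `T_p S = N(p)^⊥`, where `N` is (a
smooth extension of) the unit normal field of `S` near `p` that points away from the origin at
`p`. With this convention a sphere of radius `r` centred at the origin has curvature
`r ^ (1 - dim W)`. -/
def HasGaussianCurvatureAt (S : Set W) (p : W) (κ : ℝ) : Prop :=
  ∃ N : W → W, ContDiffAt ℝ ∞ N p ∧
    (∀ᶠ q in 𝓝 p, q ∈ S → ‖N q‖ = 1 ∧ ∀ v ∈ tangentVectors S q, inner ℝ (N q) v = 0) ∧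
    0 < inner ℝ (N p) p ∧
    LinearMap.det (((ℝ ∙ N p)ᗮ.orthogonalProjectionOnto ∘L fderiv ℝ N p ∘L (ℝ ∙ N p)ᗮ.subtypeL :
      (ℝ ∙ N p)ᗮ →L[ℝ] (ℝ ∙ N p)ᗮ) : (ℝ ∙ N p)ᗮ →ₗ[ℝ] (ℝ ∙ N p)ᗮ) = κ

end Euclidean

/-! ### Radial graphs in a Riemannian vector bundle -/

section RadialGraph

variable
  {EB : Type*} [NormedAddCommGroup EB] [NormedSpace ℝ EB]
  {H : Type*} [TopologicalSpace H] (I : ModelWithCorners ℝ EB H)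
  {M : Type*} [TopologicalSpace M] [ChartedSpace H M]
  (F : Type*) [NormedAddCommGroup F] [NormedSpace ℝ F]
  (V : M → Type*) [TopologicalSpace (TotalSpace F V)]
  [∀ x, NormedAddCommGroup (V x)] [∀ x, InnerProductSpace ℝ (V x)]
  [FiberBundle F V]

/-- `E_*`: the total space with the zero section removed. -/
def puncturedBundle : Set (TotalSpace F V) := {η | η.2 ≠ 0}

/-- `Σ`: the unit sphere bundle. -/
def unitSphereBundle : Set (TotalSpace F V) := {ξ | ‖ξ.2‖ = 1}

variable {F V}

/-- `u` is (the radially constant extension to `E_*` of) a smooth function on `Σ`. The value of `u`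
on the zero section is irrelevant. -/
structure IsRadiallyConstantSmooth (u : TotalSpace F V → ℝ) : Prop where
  smooth : ContMDiffOn (I.prod 𝓘(ℝ, F)) 𝓘(ℝ, ℝ) ∞ u (puncturedBundle F V)
  radial : ∀ (x : M) (v : V x) (t : ℝ), v ≠ 0 → 0 < t →
    u ⟨x, t • v⟩ = u ⟨x, v⟩

/-- The radial graph `{e^{u(ξ)} ξ : ξ ∈ Σ}`. -/
def radialGraph (u : TotalSpace F V → ℝ) : Set (TotalSpace F V) :=
  (fun ξ : TotalSpace F V ↦ (⟨ξ.proj, Real.exp (u ξ) • ξ.2⟩ : TotalSpace F V)) ''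
    unitSphereBundle F V

/-- The vertical Gaussian curvature of `Y ⊆ E` is given by `K`: at each `η ∈ Y ∩ E_x`, the Gaussian
curvature at `η` of the hypersurface `Y ∩ E_x` of the Euclidean space `E_x` is `K η`. -/
def HasVerticalGaussianCurvature (Y : Set (TotalSpace F V)) (K : TotalSpace F V → ℝ) : Prop :=
  ∀ η ∈ Y, HasGaussianCurvatureAt {w : V η.proj | (⟨η.proj, w⟩ : TotalSpace F V) ∈ Y} η.2 (K η)

/-- `c` is a smooth curve, defined near `0`, that lies in `Y`. -/
structure IsCurveIn (Y : Set (TotalSpace F V)) (c : ℝ → TotalSpace F V) : Prop where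
  smooth : ContMDiffAt 𝓘(ℝ, ℝ) (I.prod 𝓘(ℝ, F)) ∞ c 0
  mem : ∀ᶠ t in 𝓝 0, c t ∈ Y

/-- The velocity of a curve in `E`. -/
noncomputable def velocity (c : ℝ → TotalSpace F V) (t : ℝ) :
    TangentSpace (I.prod 𝓘(ℝ, F)) (c t) :=
  mfderiv 𝓘(ℝ, ℝ) (I.prod 𝓘(ℝ, F)) c t (1 : ℝ)

/-- `A ∈ T_p E` is tangent to `Y` at `p`: it is the velocity of a smooth curve in `Y`. -/
def IsTangentVector (Y : Set (TotalSpace F V)) (p : TotalSpace F V)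
    (A : TangentSpace (I.prod 𝓘(ℝ, F)) p) : Prop :=
  ∃ c : ℝ → TotalSpace F V, IsCurveIn I Y c ∧
    (⟨c 0, velocity I c 0⟩ : TangentBundle (I.prod 𝓘(ℝ, F)) (TotalSpace F V)) = ⟨p, A⟩

variable {I}

/-- The horizontal component `π_* A` of `A ∈ T_ξ E = H_ξ E ⊕ V_ξ E ≅ T_x M ⊕ E_x`. The vertical
component is `connector D A`. -/
noncomputable def horPart (ξ : TotalSpace F V) (A : TangentSpace (I.prod 𝓘(ℝ, F)) ξ) :
    TangentSpace I ξ.proj :=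
  mfderiv (I.prod 𝓘(ℝ, F)) I (fun η : TotalSpace F V ↦ η.proj) ξ A

variable [IsManifold I ∞ M] [RiemannianBundle (fun x : M ↦ TangentSpace I x)]

/-- The Sasaki metric `G` on `E`: horizontal and vertical spaces are orthogonal, and carry the
metrics of `T_x M` and of `E_x`. -/
noncomputable def sasakiMetric (D : CovariantDerivative I F V) (ξ : TotalSpace F V)
    (A B : TangentSpace (I.prod 𝓘(ℝ, F)) ξ) : ℝ :=
  inner ℝ (horPart ξ A) (horPart ξ B) + inner ℝ (connector D ξ A) (connector D ξ B)

/-- `N ∈ T_p E` is the unit normal to `Y` at `p`, for the metric `G`, that points outward, i.e. has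
positive scalar product with the radial vertical vector `p`. -/
structure IsOutwardUnitNormal (D : CovariantDerivative I F V) (Y : Set (TotalSpace F V))
    (p : TotalSpace F V) (N : TangentSpace (I.prod 𝓘(ℝ, F)) p) : Prop where
  unit : sasakiMetric D p N N = 1
  normal : ∀ A, IsTangentVector I Y p A → sasakiMetric D p N A = 0
  outward : 0 < inner ℝ (connector D p N) p.2

/-- Horizontal component of the covariant derivative `D_t Z (t)` of a vector field `Z : ℝ → TE` along
a curve in `E`, where `D` is the Sasaki connection. In terms of
`TE = HE ⊕ VE ≅ π^*TM ⊕ π^*E` the Sasaki connection (`D_{e_i} e_j = Γ^k_{ij} e_k`,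
`D_{e_i} e_α = Γ^β_{iα} e_β`, `D_{e_α} e_j = D_{e_α} e_β = 0` for horizontal lifts `e_i` and vertical
lifts `e_α` of local frames of `TM` and `E`) is the direct sum of the pull-backs of the
Levi-Civita connection `LC` of `M` and of the connection of `E`. -/
noncomputable def sasakiCovHor (LC : CovariantDerivative I EB (fun x : M ↦ TangentSpace I x))
    (Z : ℝ → TangentBundle (I.prod 𝓘(ℝ, F)) (TotalSpace F V)) (t : ℝ) :
    TangentSpace I (Z t).proj.proj :=
  covDerivAlong LC (fun s ↦ (⟨(Z s).proj.proj, horPart (Z s).proj (Z s).2⟩ : TangentBundle I M)) t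

/-- Vertical component of the covariant derivative `D_t Z (t)` of a vector field along a curve in
`E`, for the Sasaki connection. -/
noncomputable def sasakiCovVer (D : CovariantDerivative I F V)
    (Z : ℝ → TangentBundle (I.prod 𝓘(ℝ, F)) (TotalSpace F V)) (t : ℝ) : V (Z t).proj.proj :=
  covDerivAlong D
    (fun s ↦ (⟨(Z s).proj.proj, connector D (Z s).proj (Z s).2⟩ : TotalSpace F V)) t

/-- The value `II(ċ(0), Z(0)) = - G(D_t Z (0), N)` of the second fundamental form, with respect to
the normal `N` and the Sasaki connection, for a tangent vector field `Z` along a curve `c` that lies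
in a hypersurface. -/
noncomputable def secondFundamentalForm
    (LC : CovariantDerivative I EB (fun x : M ↦ TangentSpace I x)) (D : CovariantDerivative I F V)
    (Z : ℝ → TangentBundle (I.prod 𝓘(ℝ, F)) (TotalSpace F V))
    (N : TangentSpace (I.prod 𝓘(ℝ, F)) (Z 0).proj) : ℝ :=
  -(inner ℝ (sasakiCovHor LC Z 0) (horPart (Z 0).proj N) +
    inner ℝ (sasakiCovVer D Z 0) (connector D (Z 0).proj N))

/-- The hypersurface `Y` of `E` is convex: its second fundamental form is positive semi-definite at
each point, i.e. `II(ċ(0), ċ(0)) ≥ 0` for all smooth curves `c` in `Y`. -/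
def IsConvexHypersurface
    (LC : CovariantDerivative I EB (fun x : M ↦ TangentSpace I x)) (D : CovariantDerivative I F V)
    (Y : Set (TotalSpace F V)) : Prop :=
  ∀ c : ℝ → TotalSpace F V, IsCurveIn I Y c →
    ∀ N : TangentSpace (I.prod 𝓘(ℝ, F)) (c 0), IsOutwardUnitNormal D Y (c 0) N →
      0 ≤ secondFundamentalForm LC D (fun s ↦ ⟨c s, velocity I c s⟩) N

end RadialGraph

/-
If `K` is constant on the fibres, the fibres of the radial graph of `u = -log K / (m - 1)` are round
spheres of radius `r = e^u`, whose Gaussian curvature is `r^{-(m-1)} = K`. If `K` is constant, the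
graph is a sphere bundle of constant radius; its normal is vertical and radial, and differentiating
`⟨ċ_ver, c⟩ = 0` along a curve `c` in it gives `II(ċ, ċ) = |ċ_ver|² / r ≥ 0`.

Suppose conversely that the radial graph of `u` is convex, and let `r = e^u`. Translate `v ∈ E_x`
parallelly along a curve in `M` that has no acceleration at `t = 0`: by convexity `r'' ≤ 0` at
`t = 0`. The horizontal derivative of `r` per unit length plus `δ r`, `δ > 0`, attains its minimum,
because `M` is compact and `r` is radially constant. At the minimum `r'' + δ r' = 0` after
normalizing the speed, so `r' ≥ 0` there, and the minimum is not negative. As `δ` is arbitrary, all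
horizontal derivatives of `r` are nonnegative; reversing directions, they vanish. So `r` is
invariant under parallel transport, which therefore maps the fibres of the graph isometrically onto
each other, and preserves `K`. As `K` is constant on fibres, it is locally constant, hence constant.
-/

section Calculus

variable
  {EN : Type*} [NormedAddCommGroup EN] [NormedSpace ℝ EN]
  {HN : Type*} [TopologicalSpace HN] {J : ModelWithCorners ℝ EN HN}
  {N : Type*} [TopologicalSpace N] [ChartedSpace HN N]
  {F : Type*} [NormedAddCommGroup F] [NormedSpace ℝ F]
  {G : Type*} [NormedAddCommGroup G] [NormedSpace ℝ G]

theorem mvfderiv_congr_of_eventuallyEq {f g : N → F} {x : N} (h : f =ᶠ[𝓝 x] g) :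
    mvfderiv J f x = mvfderiv J g x := by
  ext A
  exact DFunLike.congr_fun h.mfderiv_eq A

theorem mvfderiv_clm_apply {g : N → F →L[ℝ] G} {f : N → F} {x : N}
    (hg : MDifferentiableAt J 𝓘(ℝ, F →L[ℝ] G) g x) (hf : MDifferentiableAt J 𝓘(ℝ, F) f x)
    (A : TangentSpace J x) :
    mvfderiv J (fun y ↦ g y (f y)) x A = mvfderiv J g x A (f x) + g x (mvfderiv J f x A) := by
  have happly := (isBoundedBilinearMap_apply (𝕜 := ℝ) (E := F) (F := G)).hasFDerivAt (g x, f x)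
  have hpair : HasMFDerivAt J 𝓘(ℝ, (F →L[ℝ] G) × F) (fun y ↦ (g y, f y)) x
      ((mvfderiv J g x).prod (mvfderiv J f x)) :=
    ⟨hg.continuousAt.prodMk hf.continuousAt, hg.hasMFDerivAt.2.prodMk hf.hasMFDerivAt.2⟩
  have hcomp : mfderiv J 𝓘(ℝ, G) (fun y ↦ g y (f y)) x = _ :=
    (happly.hasMFDerivAt.comp x hpair).mfderiv
  rw [mvfderiv, hcomp, add_comm]
  rfl

theorem mvfderiv_clm_apply_const {g : N → F →L[ℝ] G} {x : N}
    (hg : MDifferentiableAt J 𝓘(ℝ, F →L[ℝ] G) g x) (v : F) (A : TangentSpace J x) :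
    mvfderiv J (fun y ↦ g y v) x A = mvfderiv J g x A v := by
  rw [mvfderiv_clm_apply hg mdifferentiableAt_const, mvfderiv_const]
  simp

theorem hasDerivAt_linearMap_apply [FiniteDimensional ℝ F] {L : ℝ → F →ₗ[ℝ] G} {L' : F → G}
    {f : ℝ → F} {f' : F} {t : ℝ} (hL : ∀ v, HasDerivAt (fun s ↦ L s v) (L' v) t)
    (hf : HasDerivAt f f' t) :
    HasDerivAt (fun s ↦ L s (f s)) (L t f' + L' (f t)) t := by
  set b := Module.finBasis ℝ F
  have hexpand (s : ℝ) (v : F) : L s v = ∑ i, b.coord i v • L s (b i) := by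
    conv_lhs => rw [← b.sum_repr v]
    simp only [map_sum, map_smul, Module.Basis.coord_apply]
  have hcoord (i) : HasDerivAt (fun s ↦ b.coord i (f s)) (b.coord i f') t :=
    (b.coord i).toContinuousLinearMap.hasFDerivAt.comp_hasDerivAt t hf
  have hL' (v : F) : L' v = ∑ i, b.coord i v • L' (b i) :=
    (hL v).unique <| (HasDerivAt.fun_sum fun i _ ↦ (hL (b i)).const_smul _).congr_of_eventuallyEq
      (.of_forall fun s ↦ hexpand s v)
  refine ((HasDerivAt.fun_sum fun i _ ↦ (hcoord i).fun_smul (hL (b i))).congr_of_eventuallyEq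
    (.of_forall fun s ↦ hexpand s (f s))).congr_deriv ?_
  rw [Finset.sum_add_distrib, ← hL', ← hexpand, add_comm]

end Calculus

section CurveVelocity

variable
  {EB : Type*} [NormedAddCommGroup EB] [NormedSpace ℝ EB]
  {H : Type*} [TopologicalSpace H] {I : ModelWithCorners ℝ EB H}
  {M : Type*} [TopologicalSpace M] [ChartedSpace H M]

variable (I) in
/-- The velocity `γ'(t)` of a curve `γ` in a manifold. -/
noncomputable def curveVelocity (γ : ℝ → M) (t : ℝ) : TangentSpace I (γ t) :=
  mfderiv 𝓘(ℝ, ℝ) I γ t (1 : ℝ)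

theorem hasDerivAt_comp_curve {F : Type*} [NormedAddCommGroup F] [NormedSpace ℝ F]
    {γ : ℝ → M} {t : ℝ} {g : M → F}
    (hg : MDifferentiableAt I 𝓘(ℝ, F) g (γ t)) (hγ : MDifferentiableAt 𝓘(ℝ, ℝ) I γ t) :
    HasDerivAt (fun s ↦ g (γ s)) (mvfderiv I g (γ t) (curveVelocity I γ t)) t := by
  have h : HasFDerivAt (fun s ↦ g (γ s))
      ((mvfderiv I g (γ t)).comp (mfderiv 𝓘(ℝ, ℝ) I γ t) : ℝ →L[ℝ] F) t :=
    (hg.hasMFDerivAt.comp t hγ.hasMFDerivAt).hasFDerivAt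
  exact h.hasDerivAt

theorem contMDiffOn_curveVelocity {m n : ℕ∞ω} (hmn : m + 1 ≤ n) [IsManifold I 1 M]
    [IsManifold I n M] {γ : ℝ → M} {J : Set ℝ} (hJ : IsOpen J)
    (hγ : ContMDiffOn 𝓘(ℝ, ℝ) I n γ J) :
    ContMDiffOn 𝓘(ℝ, ℝ) (I.prod 𝓘(ℝ, EB)) m
      (fun t ↦ (⟨γ t, curveVelocity I γ t⟩ : TangentBundle I M)) J := by
  have htangent := hγ.contMDiffOn_tangentMapWithin (m := m) hmn hJ.uniqueMDiffOn
  have hone : ContMDiff 𝓘(ℝ, ℝ) (𝓘(ℝ, ℝ).prod 𝓘(ℝ, ℝ)) m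
      (fun t : ℝ ↦ (⟨t, (1 : ℝ)⟩ : TangentBundle 𝓘(ℝ, ℝ) ℝ)) :=
    contMDiff_vectorSpace_iff_contDiff.2 contDiff_const
  refine (htangent.comp hone.contMDiffOn fun t ht ↦ ht).congr fun t ht ↦ ?_
  simp only [Function.comp, tangentMapWithin, curveVelocity]
  rw [mfderivWithin_of_isOpen hJ ht]

end CurveVelocity

section Trivialization

variable
  {EB : Type*} [NormedAddCommGroup EB] [NormedSpace ℝ EB]
  {H : Type*} [TopologicalSpace H] {I : ModelWithCorners ℝ EB H}
  {M : Type*} [TopologicalSpace M] [ChartedSpace H M]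
  {F : Type*} [NormedAddCommGroup F] [NormedSpace ℝ F]
  {V : M → Type*} [TopologicalSpace (TotalSpace F V)]
  [∀ x, AddCommGroup (V x)] [∀ x, Module ℝ (V x)] [∀ x, TopologicalSpace (V x)]
  [FiberBundle F V] [VectorBundle ℝ F V] [ContMDiffVectorBundle 1 F V I]
  (e : Trivialization F (TotalSpace.proj : TotalSpace F V → M)) [MemTrivializationAtlas e]

theorem mdifferentiableAt_trivialization_symm {f : M → F} {x : M}
    (hx : x ∈ e.baseSet) (hf : MDifferentiableAt I 𝓘(ℝ, F) f x) :
    MDifferentiableAt I (I.prod 𝓘(ℝ, F))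
      (fun y ↦ (⟨y, e.symm y (f y)⟩ : TotalSpace F V)) x := by
  rw [e.mdifferentiableAt_section_iff I (fun y ↦ e.symm y (f y)) hx]
  refine hf.congr_of_eventuallyEq ?_
  filter_upwards [e.open_baseSet.mem_nhds hx] with y hy
  simp [e.apply_mk_symm hy]

theorem mdifferentiableAt_trivialization_snd {ξ : TotalSpace F V} (hξ : ξ.proj ∈ e.baseSet) :
    MDifferentiableAt (I.prod 𝓘(ℝ, F)) 𝓘(ℝ, F) (fun η : TotalSpace F V ↦ (e η).2) ξ :=
  ((e.mdifferentiableAt_totalSpace_iff I (fun η ↦ η) (e.mem_source.2 hξ)).1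
    mdifferentiableAt_id).2

variable {e} in
theorem differentiableAt_trivialization_snd_comp {S : ℝ → TotalSpace F V} {t : ℝ}
    (ht : (S t).proj ∈ e.baseSet) (hS : MDifferentiableAt 𝓘(ℝ, ℝ) (I.prod 𝓘(ℝ, F)) S t) :
    DifferentiableAt ℝ (fun s ↦ (e (S s)).2) t :=
  ((e.mdifferentiableAt_totalSpace_iff I S (e.mem_source.2 ht)).1 hS).2.differentiableAt

theorem mvfderiv_trivialization_snd_eq
    (e' : Trivialization F (TotalSpace.proj : TotalSpace F V → M)) [MemTrivializationAtlas e']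
    {ξ : TotalSpace F V} (hξ : ξ.proj ∈ e.baseSet) (hξ' : ξ.proj ∈ e'.baseSet)
    (A : TangentSpace (I.prod 𝓘(ℝ, F)) ξ) :
    mvfderiv (I.prod 𝓘(ℝ, F)) (fun η : TotalSpace F V ↦ (e' η).2) ξ A =
      mvfderiv I (fun y ↦ (e.coordChangeL ℝ e' y : F →L[ℝ] F)) ξ.proj
          (mfderiv (I.prod 𝓘(ℝ, F)) I (fun η : TotalSpace F V ↦ η.proj) ξ A) (e ξ).2 +
        e.coordChangeL ℝ e' ξ.proj
          (mvfderiv (I.prod 𝓘(ℝ, F)) (fun η : TotalSpace F V ↦ (e η).2) ξ A) := by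
  set G : M → F →L[ℝ] F := fun y ↦ (e.coordChangeL ℝ e' y : F →L[ℝ] F)
  have hG : MDifferentiableAt I 𝓘(ℝ, F →L[ℝ] F) G ξ.proj := mdifferentiableAt_coordChangeL hξ hξ'
  have hproj : MDifferentiableAt (I.prod 𝓘(ℝ, F)) I (fun η : TotalSpace F V ↦ η.proj) ξ :=
    mdifferentiableAt_proj ..
  have hchange : (fun η : TotalSpace F V ↦ (e' η).2) =ᶠ[𝓝 ξ] fun η ↦ G η.proj (e η).2 := by
    filter_upwards [hproj.continuousAt.preimage_mem_nhds
      ((e.open_baseSet.inter e'.open_baseSet).mem_nhds ⟨hξ, hξ'⟩)] with η hη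
    simp only [G, e.coordChangeL_apply e' hη, ContinuousLinearEquiv.coe_coe]
    rw [e.symm_proj_apply η hη.1]
  have hGproj : mvfderiv (I.prod 𝓘(ℝ, F)) (fun η : TotalSpace F V ↦ G η.proj) ξ A =
      mvfderiv I G ξ.proj (mfderiv (I.prod 𝓘(ℝ, F)) I (fun η : TotalSpace F V ↦ η.proj) ξ A) :=
    mfderiv_comp_apply (f := fun η : TotalSpace F V ↦ η.proj) ξ hG hproj A
  rw [mvfderiv_congr_of_eventuallyEq hchange, ← hGproj]
  exact mvfderiv_clm_apply (hG.comp ξ hproj) (mdifferentiableAt_trivialization_snd e hξ) A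

variable (I) in
/-- The covariant derivative for which the sections that are constant in the trivialization `e` are
parallel. It is a connection over `e.baseSet` only. -/
noncomputable def flatCovDeriv (σ : ∀ x, V x) (x : M) : TangentSpace I x →L[ℝ] V x :=
  e.symmL ℝ x ∘L mvfderiv I (fun y ↦ (e (⟨y, σ y⟩ : TotalSpace F V)).2) x

variable [∀ x, IsTopologicalAddGroup (V x)] [∀ x, ContinuousSMul ℝ (V x)]

theorem isCovariantDerivativeOn_flatCovDeriv :
    IsCovariantDerivativeOn F (flatCovDeriv I e : (∀ x, V x) → _) e.baseSet where
  add {σ σ' x} hσ hσ' hx := by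
    have hadd : (fun y ↦ (e (⟨y, (σ + σ') y⟩ : TotalSpace F V)).2) =ᶠ[𝓝 x]
        fun y ↦ (e (⟨y, σ y⟩ : TotalSpace F V)).2 + (e (⟨y, σ' y⟩ : TotalSpace F V)).2 := by
      filter_upwards [e.open_baseSet.mem_nhds hx] with y hy using (e.linear ℝ hy).map_add _ _
    rw [flatCovDeriv, mvfderiv_congr_of_eventuallyEq hadd,
      mvfderiv_fun_add ((e.mdifferentiableAt_section_iff I σ hx).1 hσ)
        ((e.mdifferentiableAt_section_iff I σ' hx).1 hσ'), ContinuousLinearMap.comp_add]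
    rfl
  leibniz {σ f x} hσ hf hx := by
    have hsmul : (fun y ↦ (e (⟨y, (f • σ) y⟩ : TotalSpace F V)).2) =ᶠ[𝓝 x]
        fun y ↦ f y • (e (⟨y, σ y⟩ : TotalSpace F V)).2 := by
      filter_upwards [e.open_baseSet.mem_nhds hx] with y hy using (e.linear ℝ hy).map_smul _ _
    rw [flatCovDeriv, mvfderiv_congr_of_eventuallyEq hsmul,
      mvfderiv_fun_smul hf ((e.mdifferentiableAt_section_iff I σ hx).1 hσ)]
    ext h
    have hσx : e.symm x (e (⟨x, σ x⟩ : TotalSpace F V)).2 = σ x := e.symm_apply_apply_mk hx _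
    rw [← e.symmL_apply (R := ℝ) hx] at hσx
    simp [flatCovDeriv, hσx]

end Trivialization

section ConnectionForm

variable
  {EB : Type*} [NormedAddCommGroup EB] [NormedSpace ℝ EB]
  {H : Type*} [TopologicalSpace H] {I : ModelWithCorners ℝ EB H}
  {M : Type*} [TopologicalSpace M] [ChartedSpace H M]
  {F : Type*} [NormedAddCommGroup F] [NormedSpace ℝ F] [FiniteDimensional ℝ F]
  {V : M → Type*} [TopologicalSpace (TotalSpace F V)]
  [∀ x, AddCommGroup (V x)] [∀ x, Module ℝ (V x)] [∀ x, TopologicalSpace (V x)]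
  [∀ x, IsTopologicalAddGroup (V x)] [∀ x, ContinuousSMul ℝ (V x)]
  [FiberBundle F V] [VectorBundle ℝ F V] [ContMDiffVectorBundle 1 F V I]
  (e : Trivialization F (TotalSpace.proj : TotalSpace F V → M)) [MemTrivializationAtlas e]
  (cov : CovariantDerivative I F V)

/-- The connection form `Γ(h) ∈ End F`, `h ∈ T_x M`, of a connection in a trivialization: the
difference with the flat connection of the trivialization. Its value is irrelevant when `x` is not
in the domain of the trivialization. -/
noncomputable def connForm (x : M) (h : TangentSpace I x) : F →L[ℝ] F :=
  LinearMap.toContinuousLinearMap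
    { toFun v := e.continuousLinearMapAt ℝ x
        (cov.isCovariantDerivativeOn.difference (isCovariantDerivativeOn_flatCovDeriv e) x
          (e.symmL ℝ x v) h)
      map_add' := by simp
      map_smul' := by simp }

variable {e}

theorem covariantDerivative_eq {x : M} (hx : x ∈ e.baseSet) {σ : ∀ x, V x}
    (hσ : MDifferentiableAt I (I.prod 𝓘(ℝ, F)) (fun y ↦ (⟨y, σ y⟩ : TotalSpace F V)) x)
    (h : TangentSpace I x) :
    cov σ x h = e.symm x (mvfderiv I (fun y ↦ (e (⟨y, σ y⟩ : TotalSpace F V)).2) x h +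
      connForm e cov x h (e (⟨x, σ x⟩ : TotalSpace F V)).2) := by
  have hform : e.symmL ℝ x (connForm e cov x h (e (⟨x, σ x⟩ : TotalSpace F V)).2) =
      cov σ x h - flatCovDeriv I e σ x h := by
    have hσx : e.symm x (e (⟨x, σ x⟩ : TotalSpace F V)).2 = σ x := e.symm_apply_apply_mk hx _
    refine (e.symmL_continuousLinearMapAt hx _).trans ?_
    rw [e.symmL_apply hx, hσx, IsCovariantDerivativeOn.difference_apply _ _ hx hσ]
    rfl
  rw [← e.symmL_apply (R := ℝ) hx, map_add, hform]
  exact (add_sub_cancel _ _).symm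

theorem covariantDerivative_symm {x : M} (hx : x ∈ e.baseSet) (v : F) (h : TangentSpace I x) :
    cov (fun y ↦ e.symm y v) x h = e.symm x (connForm e cov x h v) := by
  have hconst : (fun y ↦ (e (⟨y, e.symm y v⟩ : TotalSpace F V)).2) =ᶠ[𝓝 x] fun _ ↦ v := by
    filter_upwards [e.open_baseSet.mem_nhds hx] with y hy using by rw [e.apply_mk_symm hy]
  rw [covariantDerivative_eq cov hx
    (mdifferentiableAt_trivialization_symm e hx mdifferentiableAt_const),
    mvfderiv_congr_of_eventuallyEq hconst, mvfderiv_const, e.apply_mk_symm hx]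
  simp

theorem connector_eq {ξ : TotalSpace F V} (hξ : ξ.proj ∈ e.baseSet)
    (A : TangentSpace (I.prod 𝓘(ℝ, F)) ξ) :
    connector cov ξ A =
      e.symm ξ.proj (mvfderiv (I.prod 𝓘(ℝ, F)) (fun η : TotalSpace F V ↦ (e η).2) ξ A +
        connForm e cov ξ.proj
          (mfderiv (I.prod 𝓘(ℝ, F)) I (fun η : TotalSpace F V ↦ η.proj) ξ A) (e ξ).2) := by
  set e' := trivializationAt F V ξ.proj
  have hξ' : ξ.proj ∈ e'.baseSet := mem_baseSet_trivializationAt F V ξ.proj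
  set v := (e ξ).2
  set h := mfderiv (I.prod 𝓘(ℝ, F)) I (fun η : TotalSpace F V ↦ η.proj) ξ A
  have hframe : (fun y ↦ (e' (⟨y, e.symm y v⟩ : TotalSpace F V)).2) =ᶠ[𝓝 ξ.proj]
      fun y ↦ (e.coordChangeL ℝ e' y : F →L[ℝ] F) v := by
    filter_upwards [(e.open_baseSet.inter e'.open_baseSet).mem_nhds ⟨hξ, hξ'⟩] with y hy
    exact (e.coordChangeL_apply e' hy v).symm
  have hsymm (w : F) : e'.symm ξ.proj (e.coordChangeL ℝ e' ξ.proj w) = e.symm ξ.proj w := by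
    rw [e.coordChangeL_apply e' ⟨hξ, hξ'⟩]
    exact e'.symm_apply_apply_mk hξ' _
  have hcov : e.symm ξ.proj (connForm e cov ξ.proj h v) = _ :=
    (covariantDerivative_symm cov hξ v h).symm.trans <| covariantDerivative_eq cov hξ'
      (mdifferentiableAt_trivialization_symm e hξ mdifferentiableAt_const) h
  have hframe_ξ : (e' (⟨ξ.proj, e.symm ξ.proj v⟩ : TotalSpace F V)).2 = (e' ξ).2 := by
    rw [e.symm_proj_apply ξ hξ]
  rw [mvfderiv_congr_of_eventuallyEq hframe, hframe_ξ,
    mvfderiv_clm_apply_const (mdifferentiableAt_coordChangeL hξ hξ')] at hcov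
  have hconnector : connector cov ξ A = e'.symm ξ.proj
      (mvfderiv (I.prod 𝓘(ℝ, F)) (fun η : TotalSpace F V ↦ (e' η).2) ξ A +
        connForm e' cov ξ.proj h (e' ξ).2) := by
    rw [← e'.symmL_apply (R := ℝ) hξ', map_add, e'.symmL_apply hξ', e'.symmL_apply hξ',
      ← covariantDerivative_symm cov hξ']
    rfl
  rw [hconnector, mvfderiv_trivialization_snd_eq e e' hξ hξ', add_right_comm,
    ← e'.symmL_apply (R := ℝ) hξ', map_add, e'.symmL_apply hξ', e'.symmL_apply hξ', ← hcov, hsymm,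
    ← e.symmL_apply (R := ℝ) hξ, ← e.symmL_apply (R := ℝ) hξ, ← map_add, add_comm,
    e.symmL_apply hξ]

theorem covDerivAlong_eq {S : ℝ → TotalSpace F V} {t : ℝ} (ht : (S t).proj ∈ e.baseSet)
    (hS : MDifferentiableAt 𝓘(ℝ, ℝ) (I.prod 𝓘(ℝ, F)) S t) :
    covDerivAlong cov S t = e.symm (S t).proj (deriv (fun s ↦ (e (S s)).2) t +
      connForm e cov (S t).proj (curveVelocity I (fun s ↦ (S s).proj) t) (e (S t)).2) := by
  have hvelocity : curveVelocity I (fun s ↦ (S s).proj) t =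
      mfderiv (I.prod 𝓘(ℝ, F)) I (fun η : TotalSpace F V ↦ η.proj) (S t)
        (mfderiv 𝓘(ℝ, ℝ) (I.prod 𝓘(ℝ, F)) S t (1 : ℝ)) :=
    mfderiv_comp_apply (f := S) t (mdifferentiableAt_proj ..) hS _
  rw [covDerivAlong, connector_eq cov ht, hvelocity,
    (hasDerivAt_comp_curve (mdifferentiableAt_trivialization_snd e ht) hS).deriv]
  rfl

theorem covDerivAlong_congr {γ : ℝ → M} {σ τ : ∀ s, V (γ s)} {t : ℝ}
    (hσ : MDifferentiableAt 𝓘(ℝ, ℝ) (I.prod 𝓘(ℝ, F)) (fun s ↦ (⟨γ s, σ s⟩ : TotalSpace F V)) t)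
    (h : ∀ᶠ s in 𝓝 t, σ s = τ s) :
    covDerivAlong cov (fun s ↦ (⟨γ s, σ s⟩ : TotalSpace F V)) t =
      covDerivAlong cov (fun s ↦ (⟨γ s, τ s⟩ : TotalSpace F V)) t := by
  set e := trivializationAt F V (γ t)
  have ht : γ t ∈ e.baseSet := mem_baseSet_trivializationAt F V (γ t)
  have hcurve : (fun s ↦ (⟨γ s, σ s⟩ : TotalSpace F V)) =ᶠ[𝓝 t] fun s ↦ ⟨γ s, τ s⟩ := by
    filter_upwards [h] with s hs using by rw [hs]
  have hcoord : (fun s ↦ (e (⟨γ s, σ s⟩ : TotalSpace F V)).2) =ᶠ[𝓝 t]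
      fun s ↦ (e (⟨γ s, τ s⟩ : TotalSpace F V)).2 := hcurve.fun_comp fun η ↦ (e η).2
  rw [covDerivAlong_eq cov ht hσ,
    covDerivAlong_eq cov ht (hσ.congr_of_eventuallyEq hcurve.symm), hcoord.deriv_eq]
  simp only [h.self_of_nhds]

theorem covDerivAlong_smul {γ : ℝ → M} {σ : ∀ s, V (γ s)} {f : ℝ → ℝ} {t : ℝ}
    (hσ : MDifferentiableAt 𝓘(ℝ, ℝ) (I.prod 𝓘(ℝ, F)) (fun s ↦ (⟨γ s, σ s⟩ : TotalSpace F V)) t)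
    (hf : DifferentiableAt ℝ f t) :
    covDerivAlong cov (fun s ↦ (⟨γ s, f s • σ s⟩ : TotalSpace F V)) t =
      deriv f t • σ t + f t • covDerivAlong cov (fun s ↦ (⟨γ s, σ s⟩ : TotalSpace F V)) t := by
  set e := trivializationAt F V (γ t)
  have ht : γ t ∈ e.baseSet := mem_baseSet_trivializationAt F V (γ t)
  obtain ⟨hγ, hσe⟩ := (e.mdifferentiableAt_totalSpace_iff I _ (e.mem_source.2 ht)).1 hσ
  have hlin (s) (hs : γ s ∈ e.baseSet) :
      (e (⟨γ s, f s • σ s⟩ : TotalSpace F V)).2 = f s • (e (⟨γ s, σ s⟩ : TotalSpace F V)).2 :=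
    (e.linear ℝ hs).map_smul _ _
  have hcoord : (fun s ↦ (e (⟨γ s, f s • σ s⟩ : TotalSpace F V)).2) =ᶠ[𝓝 t]
      fun s ↦ f s • (e (⟨γ s, σ s⟩ : TotalSpace F V)).2 := by
    filter_upwards [hγ.continuousAt.preimage_mem_nhds (e.open_baseSet.mem_nhds ht)] with s hs
      using hlin s hs
  have hfσ : MDifferentiableAt 𝓘(ℝ, ℝ) (I.prod 𝓘(ℝ, F))
      (fun s ↦ (⟨γ s, f s • σ s⟩ : TotalSpace F V)) t :=
    (e.mdifferentiableAt_totalSpace_iff I _ (e.mem_source.2 ht)).2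
      ⟨hγ, (hf.smul hσe.differentiableAt).mdifferentiableAt.congr_of_eventuallyEq hcoord⟩
  have hσt : e.symm (γ t) (e (⟨γ t, σ t⟩ : TotalSpace F V)).2 = σ t := e.symm_apply_apply_mk ht _
  rw [covDerivAlong_eq cov ht hfσ, covDerivAlong_eq cov ht hσ, hcoord.deriv_eq,
    deriv_fun_smul hf hσe.differentiableAt]
  simp only [hlin t ht, map_smul, ← e.symmL_apply (R := ℝ) ht, map_add] at hσt ⊢
  rw [hσt, smul_add]
  abel

end ConnectionForm

section Metric

variable
  {EB : Type*} [NormedAddCommGroup EB] [NormedSpace ℝ EB]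
  {H : Type*} [TopologicalSpace H] {I : ModelWithCorners ℝ EB H}
  {M : Type*} [TopologicalSpace M] [ChartedSpace H M]
  {F : Type*} [NormedAddCommGroup F] [NormedSpace ℝ F] [FiniteDimensional ℝ F]
  {V : M → Type*} [TopologicalSpace (TotalSpace F V)]
  [∀ x, NormedAddCommGroup (V x)] [∀ x, InnerProductSpace ℝ (V x)]
  [FiberBundle F V] [VectorBundle ℝ F V] [ContMDiffVectorBundle 1 F V I]
  [IsContMDiffRiemannianBundle I 1 F V]
  {cov : CovariantDerivative I F V}

theorem hasDerivAt_inner_trivialization_symm (hcov : cov.IsMetricCompatible)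
    {e : Trivialization F (TotalSpace.proj : TotalSpace F V → M)} [MemTrivializationAtlas e]
    {γ : ℝ → M} {t : ℝ} (ht : γ t ∈ e.baseSet) (hγ : MDifferentiableAt 𝓘(ℝ, ℝ) I γ t) (v w : F) :
    HasDerivAt (fun s ↦ inner ℝ (e.symmL ℝ (γ s) v) (e.symmL ℝ (γ s) w))
      (inner ℝ (e.symmL ℝ (γ t) (connForm e cov (γ t) (curveVelocity I γ t) v))
          (e.symmL ℝ (γ t) w) +
        inner ℝ (e.symmL ℝ (γ t) v)
          (e.symmL ℝ (γ t) (connForm e cov (γ t) (curveVelocity I γ t) w))) t := by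
  classical
  have hsection (u : F) : MDifferentiableAt I (I.prod 𝓘(ℝ, F))
      (fun y ↦ (⟨y, e.symm y u⟩ : TotalSpace F V)) (γ t) :=
    mdifferentiableAt_trivialization_symm e ht mdifferentiableAt_const
  have hleibniz := hcov.mvfderiv_inner_eq (Function.update 0 (γ t) (curveVelocity I γ t))
    (hsection v) (hsection w)
  simp only [Function.update_self, covariantDerivative_symm cov ht] at hleibniz
  simp only [e.symmL_apply (R := ℝ) ht]
  rw [← hleibniz]
  refine (hasDerivAt_comp_curve ((hsection v).inner_bundle (hsection w)) hγ).congr_of_eventuallyEq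
    ?_
  filter_upwards [hγ.continuousAt.preimage_mem_nhds (e.open_baseSet.mem_nhds ht)] with s hs
  simp only [e.symmL_apply (R := ℝ) hs]

theorem hasDerivAt_inner_along (hcov : cov.IsMetricCompatible) {γ : ℝ → M}
    {σ τ : ∀ s, V (γ s)} {t : ℝ}
    (hσ : MDifferentiableAt 𝓘(ℝ, ℝ) (I.prod 𝓘(ℝ, F)) (fun s ↦ (⟨γ s, σ s⟩ : TotalSpace F V)) t)
    (hτ : MDifferentiableAt 𝓘(ℝ, ℝ) (I.prod 𝓘(ℝ, F)) (fun s ↦ (⟨γ s, τ s⟩ : TotalSpace F V)) t) :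
    HasDerivAt (fun s ↦ inner ℝ (σ s) (τ s))
      (inner ℝ (covDerivAlong cov (fun s ↦ (⟨γ s, σ s⟩ : TotalSpace F V)) t) (τ t) +
        inner ℝ (σ t) (covDerivAlong cov (fun s ↦ (⟨γ s, τ s⟩ : TotalSpace F V)) t)) t := by
  set e := trivializationAt F V (γ t)
  have ht : γ t ∈ e.baseSet := mem_baseSet_trivializationAt F V (γ t)
  have hγ := ((e.mdifferentiableAt_totalSpace_iff I _ (e.mem_source.2 ht)).1 hσ).1
  have hframe := hasDerivAt_inner_trivialization_symm hcov ht hγ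
  set a := fun s ↦ (e (⟨γ s, σ s⟩ : TotalSpace F V)).2
  set c := fun s ↦ (e (⟨γ s, τ s⟩ : TotalSpace F V)).2
  have ha : HasDerivAt a (deriv a t) t :=
    (differentiableAt_trivialization_snd_comp (e := e) ht hσ).hasDerivAt
  have hc : HasDerivAt c (deriv c t) t :=
    (differentiableAt_trivialization_snd_comp (e := e) ht hτ).hasDerivAt
  have hsymm {s} (hs : γ s ∈ e.baseSet) (v : V (γ s)) :
      e.symmL ℝ (γ s) (e (⟨γ s, v⟩ : TotalSpace F V)).2 = v := by
    rw [e.symmL_apply hs, e.symm_apply_apply_mk hs]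
  let B (s : ℝ) : F →ₗ[ℝ] F →ₗ[ℝ] ℝ :=
    (innerₗ (V (γ s))).compl₁₂ (e.symmL ℝ (γ s) : F →ₗ[ℝ] V (γ s)) (e.symmL ℝ (γ s))
  have hB := hasDerivAt_linearMap_apply (L := fun s ↦ B s (a s))
    (fun w ↦ hasDerivAt_linearMap_apply (L := fun s ↦ (B s).flip w) (fun v ↦ hframe v w) ha) hc
  refine (hB.congr_of_eventuallyEq ?_).congr_deriv ?_
  · filter_upwards [hγ.continuousAt.preimage_mem_nhds (e.open_baseSet.mem_nhds ht)] with s hs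
    exact (congr_arg₂ (inner ℝ) (hsymm hs _) (hsymm hs _)).symm
  · rw [covDerivAlong_eq cov ht hσ, covDerivAlong_eq cov ht hτ, ← e.symmL_apply (R := ℝ) ht,
      ← e.symmL_apply (R := ℝ) ht, map_add, map_add, inner_add_left, inner_add_right]
    simp only [B, a, c, LinearMap.flip_apply, LinearMap.compl₁₂_apply, innerₗ_apply_apply,
      ContinuousLinearMap.coe_coe, hsymm ht]
    ring

end Metric

section LinearODE

variable {E : Type*} [NormedAddCommGroup E] [NormedSpace ℝ E] [CompleteSpace E]

theorem exists_hasDerivAt_of_contDiffAt {f : ℝ → E → E} {t₀ : ℝ} {x₀ : E}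
    (hf : ContDiffAt ℝ 1 (Function.uncurry f) (t₀, x₀)) :
    ∃ δ > 0, ∃ α : ℝ → E, α t₀ = x₀ ∧
      ∀ t ∈ Ioo (t₀ - δ) (t₀ + δ), HasDerivAt α (f t (α t)) t := by
  let g (p : ℝ × E) : ℝ × E := (1, f p.1 p.2)
  have hg : ContDiffAt ℝ 1 g (t₀, x₀) := contDiffAt_const.prodMk hf
  obtain ⟨β, hβ₀, δ, hδ, hβ⟩ :=
    hg.exists_forall_mem_closedBall_exists_eq_forall_mem_Ioo_hasDerivAt₀ t₀
  have htime (t) (ht : t ∈ Ioo (t₀ - δ) (t₀ + δ)) : (β t).1 = t := by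
    have hderiv (s) (hs : s ∈ Ioo (t₀ - δ) (t₀ + δ)) : HasDerivAt (fun s ↦ (β s).1 - s) 0 s := by
      simpa [g] using ((hasFDerivAt_fst (p := β s)).comp_hasDerivAt s (hβ s hs)).fun_sub
        (hasDerivAt_id' s)
    have hconst := isOpen_Ioo.is_const_of_deriv_eq_zero isPreconnected_Ioo
      (fun s hs ↦ (hderiv s hs).differentiableAt.differentiableWithinAt)
      (fun s hs ↦ (hderiv s hs).deriv) ht (show t₀ ∈ Ioo (t₀ - δ) (t₀ + δ) by simp [hδ])
    simpa [hβ₀, sub_eq_zero] using hconst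
  refine ⟨δ, hδ, fun t ↦ (β t).2, by simp [hβ₀], fun t ht ↦ ?_⟩
  have hsnd := (hasFDerivAt_snd (p := β t)).comp_hasDerivAt t (hβ t ht)
  rwa [show g (β t) = (1, f t (β t).2) by simp only [g, htime t ht]] at hsnd

theorem exists_contDiffOn_hasDerivAt {f : ℝ → E → E} {J : Set ℝ} {t₀ : ℝ} (hJ : IsOpen J)
    (ht₀ : t₀ ∈ J) (hf : ContDiffOn ℝ ∞ (Function.uncurry f) (J ×ˢ univ)) (x₀ : E) :
    ∃ ε > 0, Ioo (t₀ - ε) (t₀ + ε) ⊆ J ∧ ∃ α : ℝ → E, α t₀ = x₀ ∧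
      ContDiffOn ℝ ∞ α (Ioo (t₀ - ε) (t₀ + ε)) ∧
      ∀ t ∈ Ioo (t₀ - ε) (t₀ + ε), HasDerivAt α (f t (α t)) t := by
  obtain ⟨δ, hδ, α, hα₀, hα⟩ := exists_hasDerivAt_of_contDiffAt (x₀ := x₀)
    ((hf.contDiffAt ((hJ.prod isOpen_univ).mem_nhds ⟨ht₀, mem_univ x₀⟩)).of_le (by norm_cast))
  obtain ⟨ε, hε, hsub⟩ := Metric.nhds_basis_closedBall.mem_iff.1
    (inter_mem (hJ.mem_nhds ht₀) (Ioo_mem_nhds (sub_lt_self t₀ hδ) (lt_add_of_pos_right t₀ hδ)))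
  rw [Real.closedBall_eq_Icc] at hsub
  have hIcc : Ioo (t₀ - ε) (t₀ + ε) ⊆ Icc (t₀ - ε) (t₀ + ε) := Ioo_subset_Icc_self
  refine ⟨ε, hε, fun t ht ↦ (hsub (hIcc ht)).1, α, hα₀, ?_, fun t ht ↦ hα t (hsub (hIcc ht)).2⟩
  exact (ODE.contDiffOn_enat_Icc_of_hasDerivWithinAt (n := ⊤) (f := f) (u := univ)
    (hf.mono (prod_mono_left fun t ht ↦ (hsub ht).1))
    (fun t ht ↦ (hα t (hsub ht).2).hasDerivWithinAt) (mapsTo_univ _ _)).mono hIcc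

end LinearODE

section ParallelTransport

variable
  {EB : Type*} [NormedAddCommGroup EB] [NormedSpace ℝ EB]
  {H : Type*} [TopologicalSpace H] {I : ModelWithCorners ℝ EB H}
  {M : Type*} [TopologicalSpace M] [ChartedSpace H M]
  {F : Type*} [NormedAddCommGroup F] [NormedSpace ℝ F]
  {V : M → Type*} [TopologicalSpace (TotalSpace F V)]
  [∀ x, AddCommGroup (V x)] [∀ x, Module ℝ (V x)] [∀ x, TopologicalSpace (V x)]
  [∀ x, IsTopologicalAddGroup (V x)] [∀ x, ContinuousSMul ℝ (V x)]
  [FiberBundle F V]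

/-- `P t : V_{γ(0)} → V_{γ(t)}` is parallel transport along the curve `γ` for `|t| < ε`. The value
of `P t` for other `t` is irrelevant. -/
structure IsParallelTransport (cov : CovariantDerivative I F V) (γ : ℝ → M) (ε : ℝ)
    (P : ∀ t, V (γ 0) →ₗ[ℝ] V (γ t)) : Prop where
  pos : 0 < ε
  apply_zero : ∀ v, P 0 v = v
  contMDiffOn : ∀ v, ContMDiffOn 𝓘(ℝ, ℝ) (I.prod 𝓘(ℝ, F)) ∞
    (fun t ↦ (⟨γ t, P t v⟩ : TotalSpace F V)) (Ioo (-ε) ε)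
  covDerivAlong_eq_zero : ∀ v, ∀ t ∈ Ioo (-ε) ε,
    covDerivAlong cov (fun s ↦ (⟨γ s, P s v⟩ : TotalSpace F V)) t = 0

variable [FiniteDimensional ℝ EB] [IsManifold I ∞ M] [T2Space M]
  [VectorBundle ℝ F V] [ContMDiffVectorBundle ∞ F V I]
  (e : Trivialization F (TotalSpace.proj : TotalSpace F V → M)) [MemTrivializationAtlas e]
  {cov : CovariantDerivative I F V}

theorem contMDiffAt_covariantDerivative_symm (hcov : cov.ContMDiffCovariantDerivative ∞) {x : M}
    (hx : x ∈ e.baseSet) (v : F) :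
    ContMDiffAt I (I.prod 𝓘(ℝ, EB →L[ℝ] F)) ∞
      (fun y ↦ TotalSpace.mk' (EB →L[ℝ] F) (E := fun y : M ↦ TangentSpace I y →L[ℝ] V y) y
        (cov (fun z ↦ e.symm z v) y)) x := by
  obtain ⟨ψ, -, hψ⟩ := (SmoothBumpFunction.nhds_basis_tsupport (I := I) x).mem_iff.1
    (e.open_baseSet.mem_nhds hx)
  have hframe : ContMDiffOn I (I.prod 𝓘(ℝ, F)) ∞ (fun y ↦ (⟨y, e.symm y v⟩ : TotalSpace F V))
      e.baseSet := by
    rw [e.contMDiffOn_section_baseSet_iff]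
    exact contMDiffOn_const (c := v) |>.congr fun y hy ↦ by rw [e.apply_mk_symm hy]
  have hbump : ContMDiff I (I.prod 𝓘(ℝ, F)) ∞
      (fun y ↦ (⟨y, ((ψ : M → ℝ) • fun y ↦ e.symm y v) y⟩ : TotalSpace F V)) :=
    ContMDiffOn.smul_section_of_tsupport ψ.contMDiff.contMDiffOn e.open_baseSet hψ hframe
  refine ((hcov.contMDiff.contMDiff hbump.contMDiffOn).contMDiffAt
    univ_mem).congr_of_eventuallyEq ?_
  filter_upwards [ψ.eventuallyEq_one.eventuallyEq_nhds, e.open_baseSet.mem_nhds hx] with y hy hy'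
  congr 1
  refine cov.isCovariantDerivativeOnUniv.congr_of_eventuallyEq
    (mdifferentiableAt_trivialization_symm e hy' mdifferentiableAt_const)
    ((hbump y).mdifferentiableAt (by simp)) univ_mem ?_
  filter_upwards [hy] with z hz
  simp [hz]

variable [FiniteDimensional ℝ F]

theorem contDiffOn_connForm {n : ℕ∞} (hcov : cov.ContMDiffCovariantDerivative ∞)
    {N : Type*} [NormedAddCommGroup N] [NormedSpace ℝ N] {b : N → M}
    {X : ∀ p, TangentSpace I (b p)} {s : Set N} (hs : IsOpen s) (hb : ∀ p ∈ s, b p ∈ e.baseSet)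
    (hX : ContMDiffOn 𝓘(ℝ, N) (I.prod 𝓘(ℝ, EB)) n (fun p ↦ (⟨b p, X p⟩ : TangentBundle I M)) s) :
    ContDiffOn ℝ n (fun p ↦ connForm e cov (b p) (X p)) s := by
  rw [contDiffOn_clm_apply]
  intro v
  rw [← contMDiffOn_iff_contDiffOn]
  intro p hp
  have hXp := hX.contMDiffAt (hs.mem_nhds hp)
  have hbp : ContMDiffAt 𝓘(ℝ, N) I n b p := (contMDiffAt_totalSpace.1 hXp).1
  have hcov_frame : ContMDiffAt 𝓘(ℝ, N) (I.prod 𝓘(ℝ, F)) n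
      (fun q ↦ (⟨b q, cov (fun z ↦ e.symm z v) (b q) (X q)⟩ : TotalSpace F V)) p :=
    ContMDiffAt.clm_bundle_apply (b := b) (v := X) (ϕ := fun q ↦ cov (fun z ↦ e.symm z v) (b q))
      (ContMDiffAt.comp p ((contMDiffAt_covariantDerivative_symm e hcov (hb p hp) v).of_le
        (by norm_cast; exact le_top)) hbp) hXp
  refine (((e.contMDiffAt_iff (e.mem_source.2 (hb p hp))).1 hcov_frame).2.congr_of_eventuallyEq
    ?_).contMDiffWithinAt
  filter_upwards [hs.mem_nhds hp] with q hq
  rw [covariantDerivative_symm cov (hb q hq), e.apply_mk_symm (hb q hq)]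

theorem mdifferentiableAt_covDerivAlong (hcov : cov.ContMDiffCovariantDerivative ∞)
    {S : ℝ → TotalSpace F V} {t : ℝ} (hS : ContMDiffAt 𝓘(ℝ, ℝ) (I.prod 𝓘(ℝ, F)) 2 S t) :
    MDifferentiableAt 𝓘(ℝ, ℝ) (I.prod 𝓘(ℝ, F))
      (fun s ↦ (⟨(S s).proj, covDerivAlong cov S s⟩ : TotalSpace F V)) t := by
  set e := trivializationAt F V (S t).proj
  have he : (S t).proj ∈ e.baseSet := mem_baseSet_trivializationAt F V (S t).proj
  set γ : ℝ → M := fun s ↦ (S s).proj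
  obtain ⟨J₁, hJ₁, hSJ₁⟩ := (contMDiffAt_iff_contMDiffOn_nhds (by simp)).1 hS
  obtain ⟨J₀, hJ₀₁, hJ₀, htJ₀⟩ := mem_nhds_iff.1 hJ₁
  have hSJ₀ := hSJ₁.mono hJ₀₁
  have hγ : ContMDiffOn 𝓘(ℝ, ℝ) I 2 γ J₀ := fun s hs ↦
    (contMDiffAt_totalSpace.1 (hSJ₀.contMDiffAt (hJ₀.mem_nhds hs))).1.contMDiffWithinAt
  set J := J₀ ∩ γ ⁻¹' e.baseSet
  have hJ : IsOpen J := hγ.continuousOn.isOpen_inter_preimage hJ₀ e.open_baseSet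
  have htJ : J ∈ 𝓝 t := hJ.mem_nhds ⟨htJ₀, he⟩
  have hform : ContDiffOn ℝ 1 (fun s ↦ connForm e cov (γ s) (curveVelocity I γ s)) J :=
    contDiffOn_connForm (n := 1) e hcov hJ (fun s hs ↦ hs.2)
      ((contMDiffOn_curveVelocity (by norm_num) hJ₀ hγ).mono inter_subset_left)
  have hcoord : ContDiffOn ℝ 2 (fun s ↦ (e (S s)).2) J := contMDiffOn_iff_contDiffOn.1
    ((e.contMDiffOn_iff fun s hs ↦ e.mem_source.2 hs.2).1 (hSJ₀.mono inter_subset_left)).2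
  have hsum := (hcoord.deriv_of_isOpen (m := 1) hJ (by norm_num)).add
    (hform.clm_apply (hcoord.of_le (by norm_num)))
  refine (e.mdifferentiableAt_totalSpace_iff I
    (fun s ↦ (⟨γ s, covDerivAlong cov S s⟩ : TotalSpace F V)) (e.mem_source.2 he)).2
    ⟨(hγ.contMDiffAt (hJ₀.mem_nhds htJ₀)).mdifferentiableAt (by simp),
      ((hsum.contDiffAt htJ).differentiableAt (by simp)).mdifferentiableAt.congr_of_eventuallyEq ?_⟩
  filter_upwards [htJ] with s hs
  rw [covDerivAlong_eq cov hs.2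
    ((hSJ₀.contMDiffAt (hJ₀.mem_nhds hs.1)).mdifferentiableAt (by simp)), e.apply_mk_symm hs.2]

theorem exists_hasDerivAt_transport (hcov : cov.ContMDiffCovariantDerivative ∞) {γ : ℝ → M}
    {J : Set ℝ} (hJ : IsOpen J) (h0 : (0 : ℝ) ∈ J) (hγ : ContMDiffOn 𝓘(ℝ, ℝ) I ∞ γ J)
    (hγe : γ 0 ∈ e.baseSet) :
    ∃ ε > 0, Ioo (-ε) ε ⊆ J ∩ γ ⁻¹' e.baseSet ∧ ∃ Φ : ℝ → F →L[ℝ] F,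
      Φ 0 = ContinuousLinearMap.id ℝ F ∧ ContDiffOn ℝ ∞ Φ (Ioo (-ε) ε) ∧
      ∀ t ∈ Ioo (-ε) ε,
        HasDerivAt Φ (-(connForm e cov (γ t) (curveVelocity I γ t) ∘L Φ t)) t := by
  have hopen : IsOpen (J ∩ γ ⁻¹' e.baseSet) :=
    hγ.continuousOn.isOpen_inter_preimage hJ e.open_baseSet
  have hform := contDiffOn_connForm (n := ⊤) e hcov hopen (fun t ht ↦ ht.2)
    ((contMDiffOn_curveVelocity (m := ∞) (n := ∞) (by simp) hJ hγ).mono inter_subset_left)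
  have hfield : ContDiffOn ℝ ∞ (Function.uncurry fun (t : ℝ) (Φ : F →L[ℝ] F) ↦
      -(connForm e cov (γ t) (curveVelocity I γ t) ∘L Φ)) ((J ∩ γ ⁻¹' e.baseSet) ×ˢ univ) :=
    ((hform.comp contDiffOn_fst fun p hp ↦ hp.1).clm_comp contDiffOn_snd).neg
  simpa only [zero_sub, zero_add] using
    exists_contDiffOn_hasDerivAt hopen ⟨h0, hγe⟩ hfield (ContinuousLinearMap.id ℝ F)

theorem exists_isParallelTransport (hcov : cov.ContMDiffCovariantDerivative ∞) {γ : ℝ → M}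
    {J : Set ℝ} (hJ : IsOpen J) (h0 : (0 : ℝ) ∈ J) (hγ : ContMDiffOn 𝓘(ℝ, ℝ) I ∞ γ J) :
    ∃ ε P, IsParallelTransport cov γ ε P := by
  set e := trivializationAt F V (γ 0)
  have he : γ 0 ∈ e.baseSet := mem_baseSet_trivializationAt F V (γ 0)
  obtain ⟨ε, hε, hsub, Φ, hΦ0, hΦ, hΦ'⟩ := exists_hasDerivAt_transport e hcov hJ h0 hγ he
  let P (t : ℝ) : V (γ 0) →L[ℝ] V (γ t) :=
    e.symmL ℝ (γ t) ∘L Φ t ∘L e.continuousLinearMapAt ℝ (γ 0)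
  have hcoord (v) (t) (ht : t ∈ Ioo (-ε) ε) :
      (e (⟨γ t, P t v⟩ : TotalSpace F V)).2 = Φ t (e.continuousLinearMapAt ℝ (γ 0) v) := by
    simp only [P, ContinuousLinearMap.comp_apply, e.symmL_apply (hsub ht).2,
      e.apply_mk_symm (hsub ht).2]
  have hsmooth (v) : ContMDiffOn 𝓘(ℝ, ℝ) (I.prod 𝓘(ℝ, F)) ∞
      (fun t ↦ (⟨γ t, P t v⟩ : TotalSpace F V)) (Ioo (-ε) ε) := by
    have hmaps : MapsTo (fun t ↦ (⟨γ t, P t v⟩ : TotalSpace F V)) (Ioo (-ε) ε) e.source :=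
      fun t ht ↦ e.mem_source.2 (hsub ht).2
    exact (e.contMDiffOn_iff hmaps).2 ⟨hγ.mono fun t ht ↦ (hsub ht).1,
      (hΦ.clm_apply contDiffOn_const).contMDiffOn.congr (hcoord v)⟩
  refine ⟨ε, fun t ↦ P t, hε, fun v ↦ ?_, hsmooth, fun v t ht ↦ ?_⟩
  · simpa [P, hΦ0] using e.symmL_continuousLinearMapAt (R := ℝ) he v
  · have hnear : Ioo (-ε) ε ∈ 𝓝 t := isOpen_Ioo.mem_nhds ht
    have hderiv : HasDerivAt (fun s ↦ (e (⟨γ s, P s v⟩ : TotalSpace F V)).2) _ t :=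
      ((hΦ' t ht).clm_apply (hasDerivAt_const t _)).congr_of_eventuallyEq <| by
        filter_upwards [hnear] using hcoord v
    refine (covDerivAlong_eq (e := e) (S := fun s ↦ ⟨γ s, P s v⟩) cov (hsub ht).2
      (((hsmooth v).contMDiffAt hnear).mdifferentiableAt (by simp))).trans ?_
    rw [ContinuousLinearMap.coe_coe, hderiv.deriv, hcoord v t ht, map_zero, add_zero,
      ← e.symmL_apply (R := ℝ) (hsub ht).2, ← map_zero (e.symmL ℝ (γ t))]
    exact congrArg _ (neg_add_cancel _)

end ParallelTransport

section MetricTransport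

variable
  {EB : Type*} [NormedAddCommGroup EB] [NormedSpace ℝ EB]
  {H : Type*} [TopologicalSpace H] {I : ModelWithCorners ℝ EB H}
  {M : Type*} [TopologicalSpace M] [ChartedSpace H M]
  {F : Type*} [NormedAddCommGroup F] [NormedSpace ℝ F]
  {V : M → Type*} [TopologicalSpace (TotalSpace F V)]
  [∀ x, NormedAddCommGroup (V x)] [∀ x, InnerProductSpace ℝ (V x)] [FiberBundle F V]
  {cov : CovariantDerivative I F V} {γ : ℝ → M} {ε : ℝ} {P : ∀ t, V (γ 0) →ₗ[ℝ] V (γ t)}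

namespace IsParallelTransport

variable (hP : IsParallelTransport cov γ ε P)
include hP

theorem zero_mem : (0 : ℝ) ∈ Ioo (-ε) ε := by
  simp [hP.pos]

theorem mdifferentiableAt (v : V (γ 0)) {t : ℝ} (ht : t ∈ Ioo (-ε) ε) :
    MDifferentiableAt 𝓘(ℝ, ℝ) (I.prod 𝓘(ℝ, F)) (fun s ↦ (⟨γ s, P s v⟩ : TotalSpace F V)) t :=
  ((hP.contMDiffOn v).contMDiffAt (isOpen_Ioo.mem_nhds ht)).mdifferentiableAt (by simp)

theorem contMDiffOn_curve : ContMDiffOn 𝓘(ℝ, ℝ) I ∞ γ (Ioo (-ε) ε) := fun _ ht ↦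
  (contMDiffAt_totalSpace.1
    ((hP.contMDiffOn 0).contMDiffAt (isOpen_Ioo.mem_nhds ht))).1.contMDiffWithinAt

theorem mdifferentiableAt_curveVelocity [IsManifold I ∞ M] {t : ℝ} (ht : t ∈ Ioo (-ε) ε) :
    MDifferentiableAt 𝓘(ℝ, ℝ) (I.prod 𝓘(ℝ, EB))
      (fun s ↦ (⟨γ s, curveVelocity I γ s⟩ : TangentBundle I M)) t :=
  ((contMDiffOn_curveVelocity (m := ∞) (n := ∞) (by simp) isOpen_Ioo
    hP.contMDiffOn_curve).contMDiffAt (isOpen_Ioo.mem_nhds ht)).mdifferentiableAt (by simp)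

variable [FiniteDimensional ℝ F] [VectorBundle ℝ F V] [ContMDiffVectorBundle 1 F V I]
  [IsContMDiffRiemannianBundle I 1 F V] (hcov : cov.IsMetricCompatible)
include hcov

theorem norm_map (v : V (γ 0)) {t : ℝ} (ht : t ∈ Ioo (-ε) ε) : ‖P t v‖ = ‖v‖ := by
  have hderiv (s) (hs : s ∈ Ioo (-ε) ε) : HasDerivAt (fun t ↦ inner ℝ (P t v) (P t v)) 0 s := by
    have hleibniz := hasDerivAt_inner_along hcov (hP.mdifferentiableAt v hs)
      (hP.mdifferentiableAt v hs)
    simpa only [hP.covDerivAlong_eq_zero v s hs, inner_zero_left, inner_zero_right, add_zero]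
      using hleibniz
  have hconst := isOpen_Ioo.is_const_of_deriv_eq_zero isPreconnected_Ioo
    (fun s hs ↦ (hderiv s hs).differentiableAt.differentiableWithinAt)
    (fun s hs ↦ (hderiv s hs).deriv) ht hP.zero_mem
  rw [hP.apply_zero, real_inner_self_eq_norm_sq, real_inner_self_eq_norm_sq] at hconst
  exact (sq_eq_sq₀ (norm_nonneg _) (norm_nonneg _)).1 hconst

theorem map_ne_zero {v : V (γ 0)} (hv : v ≠ 0) {t : ℝ} (ht : t ∈ Ioo (-ε) ε) : P t v ≠ 0 :=
  norm_ne_zero_iff.1 (hP.norm_map hcov v ht ▸ norm_ne_zero_iff.2 hv)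

end IsParallelTransport

end MetricTransport

section Euclidean

variable {W W' : Type*} [NormedAddCommGroup W] [InnerProductSpace ℝ W]
  [NormedAddCommGroup W'] [InnerProductSpace ℝ W'] {S : Set W} {p : W}

theorem fderiv_mem_tangentVectors {T : Set W'} {f : W → W'} (hf : ContDiffAt ℝ ∞ f p)
    (hST : MapsTo f S T) {v : W} (hv : v ∈ tangentVectors S p) :
    fderiv ℝ f p v ∈ tangentVectors T (f p) := by
  obtain ⟨c, hc, hcS, rfl, rfl⟩ := hv
  refine ⟨f ∘ c, hf.comp 0 hc, hcS.mono fun t ht ↦ hST ht, rfl, ?_⟩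
  exact ((hf.differentiableAt (by simp)).hasFDerivAt.comp_hasDerivAt 0
    (hc.differentiableAt (by simp)).hasDerivAt).deriv

theorem fderiv_apply_eq_of_mem_tangentVectors {f g : W → W'} (hf : DifferentiableAt ℝ f p)
    (hg : DifferentiableAt ℝ g p) (hfg : ∀ᶠ q in 𝓝 p, q ∈ S → f q = g q) {v : W}
    (hv : v ∈ tangentVectors S p) : fderiv ℝ f p v = fderiv ℝ g p v := by
  obtain ⟨c, hc, hcS, rfl, rfl⟩ := hv
  have hc' := (hc.differentiableAt (by simp)).hasDerivAt
  refine (hf.hasFDerivAt.comp_hasDerivAt 0 hc').unique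
    ((hg.hasFDerivAt.comp_hasDerivAt 0 hc').congr_of_eventuallyEq ?_)
  filter_upwards [hc.continuousAt.eventually hfg, hcS] with t hfgt ht using hfgt ht

theorem inner_eq_zero_of_mem_tangentVectors_sphere {r : ℝ} {v : W}
    (hv : v ∈ tangentVectors {w : W | ‖w‖ = r} p) : inner ℝ p v = 0 := by
  obtain ⟨c, hc, hcS, rfl, rfl⟩ := hv
  have hsq := (hc.differentiableAt (by simp)).hasDerivAt.norm_sq
  have hconst : HasDerivAt (fun t ↦ ‖c t‖ ^ 2) 0 0 :=
    (hasDerivAt_const (0 : ℝ) (r ^ 2)).congr_of_eventuallyEq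
      (hcS.mono fun t (ht : ‖c t‖ = r) ↦ congrArg (· ^ 2) ht)
  simpa using hsq.unique hconst

/-- The determinant of the compression of `L` to the orthogonal complement of `n`: the Gaussian
curvature of a hypersurface whose unit normal field has value `n` and derivative `L`. -/
noncomputable def compressionDet (n : W) (L : W →L[ℝ] W) : ℝ :=
  LinearMap.det (((ℝ ∙ n)ᗮ.orthogonalProjectionOnto ∘L L ∘L (ℝ ∙ n)ᗮ.subtypeL :
      (ℝ ∙ n)ᗮ →L[ℝ] (ℝ ∙ n)ᗮ) : (ℝ ∙ n)ᗮ →ₗ[ℝ] (ℝ ∙ n)ᗮ)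

theorem compressionDet_congr {n : W} {L L' : W →L[ℝ] W} (h : ∀ v, inner ℝ n v = 0 → L v = L' v) :
    compressionDet n L = compressionDet n L' := by
  unfold compressionDet
  congr 1
  ext v
  simp [h v (Submodule.mem_orthogonal_singleton_iff_inner_right.1 v.2)]

theorem compressionDet_smul_id {n : W} (c : ℝ) :
    compressionDet n (c • ContinuousLinearMap.id ℝ W) = c ^ Module.finrank ℝ (ℝ ∙ n)ᗮ := by
  have hcompression : ((ℝ ∙ n)ᗮ.orthogonalProjectionOnto ∘L (c • ContinuousLinearMap.id ℝ W) ∘L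
      (ℝ ∙ n)ᗮ.subtypeL : (ℝ ∙ n)ᗮ →ₗ[ℝ] (ℝ ∙ n)ᗮ) = c • LinearMap.id := by
    ext v
    simp
  rw [compressionDet, hcompression, LinearMap.det_smul, LinearMap.det_id, mul_one]

theorem orthogonal_span_singleton_map (Φ : W ≃ₗᵢ[ℝ] W') (n : W) :
    (ℝ ∙ n)ᗮ.map (Φ.toLinearEquiv : W →ₗ[ℝ] W') = (ℝ ∙ Φ n)ᗮ := by
  ext w
  rw [Submodule.mem_map_equiv, Submodule.mem_orthogonal_singleton_iff_inner_right,
    Submodule.mem_orthogonal_singleton_iff_inner_right, ← Φ.inner_map_map]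
  simp

theorem compressionDet_conj (Φ : W ≃ₗᵢ[ℝ] W') (n : W) {L : W →L[ℝ] W} {L' : W' →L[ℝ] W'}
    (hL : ∀ v, L' (Φ v) = Φ (L v)) : compressionDet (Φ n) L' = compressionDet n L := by
  let ψ : (ℝ ∙ n)ᗮ ≃ₗ[ℝ] (ℝ ∙ Φ n)ᗮ :=
    Φ.toLinearEquiv.ofSubmodules _ _ (orthogonal_span_singleton_map Φ n)
  have hψ (v) : (ψ v : W') = Φ v := rfl
  have hinner (a b) : inner ℝ (ψ a) (ψ b) = inner ℝ a b := Φ.inner_map_map _ _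
  rw [compressionDet, compressionDet, ← LinearMap.det_conj _ ψ]
  congr 1
  refine LinearMap.ext fun w ↦ ext_inner_right ℝ fun z ↦ ?_
  obtain ⟨v, rfl⟩ := ψ.surjective w
  obtain ⟨y, rfl⟩ := ψ.surjective z
  simp only [LinearMap.comp_apply, LinearEquiv.coe_coe, LinearEquiv.symm_apply_apply, hinner,
    ContinuousLinearMap.coe_coe, ContinuousLinearMap.comp_apply, Submodule.subtypeL_apply]
  rw [Submodule.inner_orthogonalProjectionOnto_eq_of_mem_right (ψ y),
    Submodule.inner_orthogonalProjectionOnto_eq_of_mem_right y, hψ, hψ, hL, Φ.inner_map_map]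

theorem HasGaussianCurvatureAt.map {κ : ℝ} (h : HasGaussianCurvatureAt S p κ) (Φ : W ≃ₗᵢ[ℝ] W') :
    HasGaussianCurvatureAt (Φ.symm ⁻¹' S) (Φ p) κ := by
  obtain ⟨N, hN, hnormal, hpos, rfl⟩ := h
  have hp : Φ.symm (Φ p) = p := Φ.symm_apply_apply p
  have hΦ : HasFDerivAt Φ _ (N (Φ.symm (Φ p))) := Φ.toContinuousLinearEquiv.hasFDerivAt
  have hΦ' (q : W') : HasFDerivAt Φ.symm _ q := Φ.symm.toContinuousLinearEquiv.hasFDerivAt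
  have hΦ'smooth : ContDiff ℝ ∞ Φ.symm := Φ.symm.toContinuousLinearEquiv.contDiff
  refine ⟨fun q ↦ Φ (N (Φ.symm q)), ?_, ?_, by simpa [hp] using hpos, ?_⟩
  · exact Φ.toContinuousLinearEquiv.contDiff.contDiffAt.comp _
      (ContDiffAt.comp _ (by rwa [hp]) hΦ'smooth.contDiffAt)
  · filter_upwards [Φ.symm.continuous.continuousAt.eventually (hp ▸ hnormal)] with q hq hqS
    refine ⟨by simpa using (hq hqS).1, fun v hv ↦ ?_⟩
    have hv' : Φ.symm v ∈ tangentVectors S (Φ.symm q) := by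
      have hmaps : MapsTo Φ.symm (Φ.symm ⁻¹' S) S := fun w hw ↦ hw
      have hmem := fderiv_mem_tangentVectors hΦ'smooth.contDiffAt hmaps hv
      rw [(hΦ' q).fderiv] at hmem
      exact hmem
    rw [← (hq hqS).2 _ hv', ← Φ.inner_map_map, Φ.apply_symm_apply]
  · have hN' : HasFDerivAt N (fderiv ℝ N p) (Φ.symm (Φ p)) :=
      hp.symm ▸ (hN.differentiableAt (by simp)).hasFDerivAt
    change compressionDet (Φ (N (Φ.symm (Φ p)))) _ = compressionDet (N p) _
    rw [hp]
    refine compressionDet_conj Φ _ fun v ↦ ?_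
    have hderiv := (hΦ.comp (Φ p) (hN'.comp (Φ p) (hΦ' (Φ p)))).fderiv
    exact (DFunLike.congr_fun hderiv (Φ v)).trans (by simp)

theorem hasGaussianCurvatureAt_sphere {r : ℝ} (hr : 0 < r) (hp : ‖p‖ = r) {m : ℕ}
    (hm : Module.finrank ℝ W = m + 1) :
    HasGaussianCurvatureAt {w : W | ‖w‖ = r} p ((r⁻¹) ^ m) := by
  have hn : r⁻¹ • p ≠ 0 := smul_ne_zero (inv_ne_zero hr.ne') (norm_ne_zero_iff.1 (hp ▸ hr.ne'))
  have : Fact (Module.finrank ℝ W = m + 1) := ⟨hm⟩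
  refine ⟨fun q ↦ r⁻¹ • q, contDiffAt_id.const_smul _, .of_forall fun q hq ↦
    ⟨?_, fun v hv ↦ ?_⟩, ?_, ?_⟩
  · rw [norm_smul, norm_inv, Real.norm_of_nonneg hr.le, show ‖q‖ = r from hq,
      inv_mul_cancel₀ hr.ne']
  · rw [real_inner_smul_left, inner_eq_zero_of_mem_tangentVectors_sphere hv, mul_zero]
  · rw [real_inner_smul_left, real_inner_self_eq_norm_sq, hp]
    positivity
  · change compressionDet (r⁻¹ • p) (fderiv ℝ (fun q : W ↦ r⁻¹ • q) p) = _
    have hderiv : fderiv ℝ (fun q : W ↦ r⁻¹ • q) p = r⁻¹ • ContinuousLinearMap.id ℝ W :=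
      ((hasFDerivAt_id p).fun_const_smul r⁻¹).fderiv
    rw [hderiv, compressionDet_smul_id,
      Submodule.finrank_orthogonal_span_singleton (n := m) hn]

/-- A positive function, smooth away from the origin and positively homogeneous of degree one. Its
level set `{w ≠ 0 | ρ w = 1}` is a star-shaped hypersurface around the origin. The value `ρ 0` is
irrelevant. -/
structure IsRadialGauge (ρ : W → ℝ) : Prop where
  contDiffOn : ContDiffOn ℝ ∞ ρ {0}ᶜ
  pos : ∀ w, w ≠ 0 → 0 < ρ w
  smul : ∀ (t : ℝ) (w : W), 0 < t → w ≠ 0 → ρ (t • w) = t * ρ w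

namespace IsRadialGauge

variable {ρ : W → ℝ} (hρ : IsRadialGauge ρ) {q : W} (hq : q ≠ 0) (hρq : ρ q = 1)
include hρ hq hρq

theorem sub_mem_tangentVectors (v : W) :
    v - fderiv ℝ ρ q v • q ∈ tangentVectors {w | w ≠ 0 ∧ ρ w = 1} q := by
  have hsmooth : ContDiffAt ℝ ∞ ρ q := hρ.contDiffOn.contDiffAt (isOpen_ne.mem_nhds hq)
  have hline : ContDiff ℝ ∞ fun t : ℝ ↦ q + t • v :=
    contDiff_const.add (contDiff_id.smul contDiff_const)
  have hρline : ContDiffAt ℝ ∞ (fun t : ℝ ↦ ρ (q + t • v)) 0 :=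
    ContDiffAt.comp (g := ρ) 0 (by simpa using hsmooth) hline.contDiffAt
  have hline' : HasDerivAt (fun t : ℝ ↦ q + t • v) v 0 := by
    simpa using ((hasDerivAt_id' (0 : ℝ)).smul_const v).const_add q
  have hρline' : HasDerivAt (fun t : ℝ ↦ ρ (q + t • v)) (fderiv ℝ ρ q v) 0 :=
    HasFDerivAt.comp_hasDerivAt (l := ρ) (0 : ℝ)
      (by simpa using (hsmooth.differentiableAt (by simp)).hasFDerivAt) hline'
  refine ⟨fun t ↦ (ρ (q + t • v))⁻¹ • (q + t • v), ?_, ?_, by simp [hρq], ?_⟩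
  · exact (hρline.inv (by simp [hρq])).smul hline.contDiffAt
  · filter_upwards [hline.continuous.continuousAt.eventually_ne (by simpa using hq)] with t ht
    have hpos := hρ.pos _ ht
    exact ⟨smul_ne_zero (inv_ne_zero hpos.ne') ht,
      by rw [hρ.smul _ _ (inv_pos.2 hpos) ht, inv_mul_cancel₀ hpos.ne']⟩
  · exact ((hρline'.fun_inv (by simp [hρq])).smul hline').deriv.trans
      (by simp [hρq, sub_eq_add_neg])

theorem inner_normal_eq {n : W}
    (hn : ∀ v ∈ tangentVectors {w | w ≠ 0 ∧ ρ w = 1} q, inner ℝ n v = 0) (v : W) :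
    inner ℝ n v = fderiv ℝ ρ q v * inner ℝ n q := by
  have hv := hn _ (hρ.sub_mem_tangentVectors hq hρq v)
  rwa [inner_sub_right, inner_smul_right, sub_eq_zero] at hv

theorem unit_normal_unique {n₁ n₂ : W}
    (h₁ : ∀ v ∈ tangentVectors {w | w ≠ 0 ∧ ρ w = 1} q, inner ℝ n₁ v = 0)
    (h₂ : ∀ v ∈ tangentVectors {w | w ≠ 0 ∧ ρ w = 1} q, inner ℝ n₂ v = 0)
    (hpos₁ : 0 < inner ℝ n₁ q) (hpos₂ : 0 < inner ℝ n₂ q) (hnorm₁ : ‖n₁‖ = 1)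
    (hnorm₂ : ‖n₂‖ = 1) : n₁ = n₂ := by
  have hparallel : inner ℝ n₂ q • n₁ = inner ℝ n₁ q • n₂ := by
    refine ext_inner_right ℝ fun v ↦ ?_
    rw [real_inner_smul_left, real_inner_smul_left, hρ.inner_normal_eq hq hρq h₁ v,
      hρ.inner_normal_eq hq hρq h₂ v]
    ring
  have hnorm : inner ℝ n₂ q = inner ℝ n₁ q := by
    simpa [norm_smul, hnorm₁, hnorm₂, abs_of_pos hpos₁, abs_of_pos hpos₂] using
      congrArg norm hparallel
  exact smul_right_injective W hpos₁.ne' (hnorm ▸ hparallel)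

theorem gaussianCurvature_unique {κ₁ κ₂ : ℝ}
    (h₁ : HasGaussianCurvatureAt {w | w ≠ 0 ∧ ρ w = 1} q κ₁)
    (h₂ : HasGaussianCurvatureAt {w | w ≠ 0 ∧ ρ w = 1} q κ₂) : κ₁ = κ₂ := by
  obtain ⟨N₁, hN₁, hnormal₁, hpos₁, rfl⟩ := h₁
  obtain ⟨N₂, hN₂, hnormal₂, hpos₂, rfl⟩ := h₂
  have houtward {N : W → W} (hN : ContDiffAt ℝ ∞ N q) (hpos : 0 < inner ℝ (N q) q) :
      ∀ᶠ w in 𝓝 q, 0 < inner ℝ (N w) w :=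
    (hN.continuousAt.inner (𝕜 := ℝ) continuousAt_id).eventually (lt_mem_nhds hpos)
  have hEq : ∀ᶠ w in 𝓝 q, w ∈ {w | w ≠ 0 ∧ ρ w = 1} → N₁ w = N₂ w := by
    filter_upwards [hnormal₁, hnormal₂, houtward hN₁ hpos₁, houtward hN₂ hpos₂]
      with w hw₁ hw₂ hpos₁ hpos₂ hw
    exact hρ.unit_normal_unique hw.1 hw.2 (hw₁ hw).2 (hw₂ hw).2 hpos₁ hpos₂ (hw₁ hw).1 (hw₂ hw).1
  change compressionDet (N₁ q) (fderiv ℝ N₁ q) = compressionDet (N₂ q) (fderiv ℝ N₂ q)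
  rw [← hEq.self_of_nhds ⟨hq, hρq⟩]
  refine compressionDet_congr fun v hv ↦ ?_
  have hv₀ : fderiv ℝ ρ q v = 0 := by
    rw [hρ.inner_normal_eq hq hρq (hnormal₁.self_of_nhds ⟨hq, hρq⟩).2] at hv
    exact (mul_eq_zero.1 hv).resolve_right hpos₁.ne'
  refine fderiv_apply_eq_of_mem_tangentVectors (hN₁.differentiableAt (by simp))
    (hN₂.differentiableAt (by simp)) hEq ?_
  simpa [hv₀] using hρ.sub_mem_tangentVectors hq hρq v

end IsRadialGauge

end Euclidean

section RadialGraphs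

variable
  {EB : Type*} [NormedAddCommGroup EB] [NormedSpace ℝ EB]
  {H : Type*} [TopologicalSpace H] {I : ModelWithCorners ℝ EB H}
  {M : Type*} [TopologicalSpace M]
  {F : Type*} [NormedAddCommGroup F] [NormedSpace ℝ F]
  {V : M → Type*} [TopologicalSpace (TotalSpace F V)]
  [∀ x, NormedAddCommGroup (V x)] [∀ x, InnerProductSpace ℝ (V x)]
  [FiberBundle F V]

section Fibre

variable [VectorBundle ℝ F V]

variable (F V) in
/-- A local trivialization identifies the fibre over `x` linearly with the model fibre. -/
noncomputable def fibreEquiv (x : M) : V x ≃L[ℝ] F :=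
  (trivializationAt F V x).continuousLinearEquivAt ℝ x (mem_baseSet_trivializationAt F V x)

variable (F) in
theorem finiteDimensional_fibre [FiniteDimensional ℝ F] (x : M) : FiniteDimensional ℝ (V x) :=
  (fibreEquiv F V x).symm.toLinearEquiv.finiteDimensional

variable (F) in
theorem finrank_fibre (x : M) : Module.finrank ℝ (V x) = Module.finrank ℝ F :=
  (fibreEquiv F V x).toLinearEquiv.finrank_eq

variable (F) in
theorem nontrivial_fibre [Nontrivial F] (x : M) : Nontrivial (V x) :=
  (fibreEquiv F V x).toEquiv.nontrivial

variable [ChartedSpace H M] {n : ℕ∞ω} [ContMDiffVectorBundle n F V I]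

theorem contMDiff_fibre_inclusion (x : M) :
    ContMDiff 𝓘(ℝ, V x) (I.prod 𝓘(ℝ, F)) n (fun w : V x ↦ (⟨x, w⟩ : TotalSpace F V)) := by
  have hx := mem_baseSet_trivializationAt F V x
  rw [(trivializationAt F V x).contMDiff_iff fun w : V x ↦
    (trivializationAt F V x).mem_source.2 hx]
  exact ⟨contMDiff_const, (fibreEquiv F V x).contDiff.contMDiff⟩

end Fibre

variable [ChartedSpace H M] {u : TotalSpace F V → ℝ}

theorem mem_radialGraph_iff (hu : IsRadiallyConstantSmooth I u) (x : M) (w : V x) :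
    (⟨x, w⟩ : TotalSpace F V) ∈ radialGraph u ↔ w ≠ 0 ∧ ‖w‖ = Real.exp (u ⟨x, w⟩) := by
  constructor
  · rintro ⟨⟨y, v⟩, hv : ‖v‖ = 1, h⟩
    have hv0 : v ≠ 0 := norm_ne_zero_iff.1 (hv ▸ one_ne_zero)
    obtain ⟨rfl, h⟩ := TotalSpace.mk.inj h
    obtain rfl := eq_of_heq h
    refine ⟨smul_ne_zero (Real.exp_pos _).ne' hv0, ?_⟩
    rw [hu.radial y v _ hv0 (Real.exp_pos _), norm_smul, hv, mul_one,
      Real.norm_of_nonneg (Real.exp_pos _).le]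
  · rintro ⟨hw, h⟩
    have hpos : 0 < ‖w‖ := norm_pos_iff.2 hw
    refine ⟨⟨x, ‖w‖⁻¹ • w⟩, ?_, ?_⟩
    · change ‖‖w‖⁻¹ • w‖ = 1
      rw [norm_smul, norm_inv, norm_norm, inv_mul_cancel₀ hpos.ne']
    · simp only [hu.radial x w _ hw (inv_pos.2 hpos), ← h, smul_smul, mul_inv_cancel₀ hpos.ne',
        one_smul]

theorem fibre_radialGraph (hu : IsRadiallyConstantSmooth I u) (x : M) :
    {w : V x | (⟨x, w⟩ : TotalSpace F V) ∈ radialGraph u} =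
      {w | w ≠ 0 ∧ ‖w‖ * Real.exp (-u ⟨x, w⟩) = 1} := by
  ext w
  rw [mem_ofPred_eq, mem_radialGraph_iff hu, mem_ofPred_eq, Real.exp_neg,
    mul_inv_eq_one₀ (Real.exp_pos _).ne']

theorem smul_mem_radialGraph (hu : IsRadiallyConstantSmooth I u) {x : M} {v : V x} (hv : v ≠ 0) :
    (⟨x, (Real.exp (u ⟨x, v⟩) / ‖v‖) • v⟩ : TotalSpace F V) ∈ radialGraph u := by
  have hpos : 0 < Real.exp (u ⟨x, v⟩) / ‖v‖ := div_pos (Real.exp_pos _) (norm_pos_iff.2 hv)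
  refine (mem_radialGraph_iff hu _ _).2 ⟨smul_ne_zero hpos.ne' hv, ?_⟩
  rw [hu.radial _ _ _ hv hpos, norm_smul, Real.norm_of_nonneg hpos.le,
    div_mul_cancel₀ _ (norm_ne_zero_iff.2 hv)]

theorem IsRadiallyConstantSmooth.exp (hu : IsRadiallyConstantSmooth I u) :
    IsRadiallyConstantSmooth I fun η ↦ Real.exp (u η) where
  smooth := Real.contDiff_exp.contMDiff.comp_contMDiffOn hu.smooth
  radial x v t hv ht := by rw [hu.radial x v t hv ht]

variable [VectorBundle ℝ F V]

theorem hasVerticalGaussianCurvature_of_fibre_const [FiniteDimensional ℝ F] {m : ℕ}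
    (hF : Module.finrank ℝ F = m + 1) (hu : IsRadiallyConstantSmooth I u)
    (hu_fibre : ∀ (x : M) (v w : V x), v ≠ 0 → w ≠ 0 → u ⟨x, v⟩ = u ⟨x, w⟩) :
    HasVerticalGaussianCurvature (radialGraph u) fun η ↦ Real.exp (-u η) ^ m := by
  rintro ⟨x, p⟩ hη
  obtain ⟨hp, hnorm⟩ := (mem_radialGraph_iff hu x p).1 hη
  have hsphere : {w : V x | (⟨x, w⟩ : TotalSpace F V) ∈ radialGraph u} = {w | ‖w‖ = ‖p‖} := by
    ext w
    rw [mem_ofPred_eq, mem_radialGraph_iff hu, mem_ofPred_eq]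
    refine ⟨fun ⟨hw, h⟩ ↦ by rw [h, hnorm, hu_fibre x w p hw hp], fun h ↦ ?_⟩
    have hw : w ≠ 0 := norm_pos_iff.1 (h ▸ norm_pos_iff.2 hp)
    exact ⟨hw, by rw [h, hnorm, hu_fibre x w p hw hp]⟩
  have := finiteDimensional_fibre F (V := V) x
  change HasGaussianCurvatureAt {w : V x | (⟨x, w⟩ : TotalSpace F V) ∈ _} p
    (Real.exp (-u ⟨x, p⟩) ^ m)
  rw [hsphere, Real.exp_neg, ← hnorm]
  exact hasGaussianCurvatureAt_sphere (norm_pos_iff.2 hp) rfl ((finrank_fibre F x).trans hF)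

theorem hasVerticalGaussianCurvature_neg_log_div [FiniteDimensional ℝ F] {m : ℕ} (hm : 2 ≤ m)
    (hF : Module.finrank ℝ F = m) {K : TotalSpace F V → ℝ}
    (hu : IsRadiallyConstantSmooth I fun η ↦ -Real.log (K η) / ((m : ℝ) - 1))
    (hK_pos : ∀ η ∈ puncturedBundle F V, 0 < K η)
    (hK_fibre : ∀ (x : M) (v w : V x), v ≠ 0 → w ≠ 0 → K ⟨x, v⟩ = K ⟨x, w⟩) :
    HasVerticalGaussianCurvature (radialGraph fun η ↦ -Real.log (K η) / ((m : ℝ) - 1)) K := by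
  obtain ⟨k, rfl⟩ := Nat.exists_eq_add_of_le' (one_le_two.trans hm)
  intro η hη
  have hKη : 0 < K η := hK_pos η ((mem_radialGraph_iff hu η.1 η.2).1 hη).1
  have hk : (k : ℝ) ≠ 0 := Nat.cast_ne_zero.2 (by omega)
  have hcurv := hasVerticalGaussianCurvature_of_fibre_const hF hu
    (fun x v w hv hw ↦ by rw [hK_fibre x v w hv hw]) η hη
  have hpow : Real.exp (-(-Real.log (K η) / (((k + 1 : ℕ) : ℝ) - 1))) ^ k = K η := by
    rw [← Real.exp_nat_mul, Nat.cast_succ, add_sub_cancel_right, neg_div, neg_neg,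
      mul_div_cancel₀ _ hk, Real.exp_log hKη]
  simpa only [hpow] using hcurv

theorem isRadialGauge_fibre [ContMDiffVectorBundle ∞ F V I] (hu : IsRadiallyConstantSmooth I u)
    (x : M) :
    IsRadialGauge (fun w : V x ↦ ‖w‖ * Real.exp (-u ⟨x, w⟩)) where
  contDiffOn := by
    have hu' : ContDiffOn ℝ ∞ (fun w : V x ↦ u ⟨x, w⟩) {0}ᶜ :=
      (hu.smooth.comp (contMDiff_fibre_inclusion x).contMDiffOn fun w hw ↦ hw).contDiffOn
    have hnorm : ContDiffOn ℝ ∞ (fun w : V x ↦ ‖w‖) {0}ᶜ := fun w hw ↦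
      (contDiffAt_norm ℝ hw).contDiffWithinAt
    exact hnorm.mul hu'.neg.exp
  pos w hw := mul_pos (norm_pos_iff.2 hw) (Real.exp_pos _)
  smul t w ht hw := by
    rw [hu.radial x w t hw ht, norm_smul, Real.norm_of_nonneg ht.le, mul_assoc]

variable [IsContMDiffRiemannianBundle I ∞ F V]

theorem contMDiff_normSq :
    ContMDiff (I.prod 𝓘(ℝ, F)) 𝓘(ℝ, ℝ) ∞ (fun η : TotalSpace F V ↦ inner ℝ η.2 η.2) :=
  ContMDiff.inner_bundle (b := fun η : TotalSpace F V ↦ η.proj) contMDiff_id contMDiff_id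

variable (I) in
include I in
theorem isOpen_puncturedBundle : IsOpen (puncturedBundle F V) := by
  have : puncturedBundle F V = {η : TotalSpace F V | inner ℝ η.2 η.2 ≠ 0} := by
    ext η
    simp [puncturedBundle]
  rw [this]
  exact isOpen_ne.preimage (contMDiff_normSq (I := I)).continuous

theorem IsRadiallyConstantSmooth.contMDiffAt (hu : IsRadiallyConstantSmooth I u)
    {ξ : TotalSpace F V} (hξ : ξ.2 ≠ 0) : ContMDiffAt (I.prod 𝓘(ℝ, F)) 𝓘(ℝ, ℝ) ∞ u ξ :=
  hu.smooth.contMDiffAt ((isOpen_puncturedBundle I).mem_nhds hξ)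

theorem IsRadiallyConstantSmooth.mdifferentiableAt (hu : IsRadiallyConstantSmooth I u)
    {ξ : TotalSpace F V} (hξ : ξ.2 ≠ 0) : MDifferentiableAt (I.prod 𝓘(ℝ, F)) 𝓘(ℝ, ℝ) u ξ :=
  (hu.contMDiffAt hξ).mdifferentiableAt (by simp)

theorem isRadiallyConstantSmooth_neg_log_div {K : TotalSpace F V → ℝ}
    (hK_smooth : ContMDiffOn (I.prod 𝓘(ℝ, F)) 𝓘(ℝ, ℝ) ∞ K (puncturedBundle F V))
    (hK_pos : ∀ η ∈ puncturedBundle F V, 0 < K η)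
    (hK_fibre : ∀ (x : M) (v w : V x), v ≠ 0 → w ≠ 0 → K ⟨x, v⟩ = K ⟨x, w⟩) (a : ℝ) :
    IsRadiallyConstantSmooth I (fun η ↦ -Real.log (K η) / a) where
  smooth η hη := by
    have hKη := hK_smooth.contMDiffAt ((isOpen_puncturedBundle I).mem_nhds hη)
    have hlog : ContDiffAt ℝ ∞ (fun b : ℝ ↦ -Real.log b / a) (K η) :=
      (contDiffAt_id.log (hK_pos η hη).ne').neg.div_const _
    exact (ContMDiffAt.comp η hlog.contMDiffAt hKη).contMDiffWithinAt
  radial x v t hv ht := by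
    simp only [hK_fibre x (t • v) v (smul_ne_zero ht.ne' hv) hv]

end RadialGraphs

section Splitting

variable
  {EB : Type*} [NormedAddCommGroup EB] [NormedSpace ℝ EB]
  {H : Type*} [TopologicalSpace H] {I : ModelWithCorners ℝ EB H}
  {M : Type*} [TopologicalSpace M] [ChartedSpace H M]
  {F : Type*} [NormedAddCommGroup F] [NormedSpace ℝ F]
  {V : M → Type*} [TopologicalSpace (TotalSpace F V)]
  [∀ x, NormedAddCommGroup (V x)] [FiberBundle F V]

theorem horPart_velocity {c : ℝ → TotalSpace F V} {t : ℝ}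
    (hc : MDifferentiableAt 𝓘(ℝ, ℝ) (I.prod 𝓘(ℝ, F)) c t) :
    horPart (c t) (velocity I c t) = curveVelocity I (fun s ↦ (c s).proj) t :=
  (mfderiv_comp_apply (f := c) t (mdifferentiableAt_proj ..) hc _).symm

variable [∀ x, InnerProductSpace ℝ (V x)] [VectorBundle ℝ F V] (D : CovariantDerivative I F V)

theorem connector_eq_symmL_add (ξ : TotalSpace F V) (A : TangentSpace (I.prod 𝓘(ℝ, F)) ξ) :
    connector D ξ A = (trivializationAt F V ξ.proj).symmL ℝ ξ.proj (mvfderiv (I.prod 𝓘(ℝ, F))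
        (fun η : TotalSpace F V ↦ ((trivializationAt F V ξ.proj) η).2) ξ A) +
      D (fun y ↦ (trivializationAt F V ξ.proj).symm y ((trivializationAt F V ξ.proj) ξ).2) ξ.proj
        (horPart ξ A) := by
  rw [Trivialization.symmL_apply _ (mem_baseSet_trivializationAt F V ξ.proj)]
  rfl

/-- The map `A ↦ (π_* A, connector A)` from `T_ξ E` to `T_x M ⊕ E_x`. -/
noncomputable def splitTangent (ξ : TotalSpace F V) :
    TangentSpace (I.prod 𝓘(ℝ, F)) ξ →ₗ[ℝ] TangentSpace I ξ.proj × V ξ.proj where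
  toFun A := (horPart ξ A, connector D ξ A)
  map_add' A B := by
    simp only [horPart, connector_eq_symmL_add, map_add, Prod.mk_add_mk, add_add_add_comm]
  map_smul' a A := by
    simp only [horPart, connector_eq_symmL_add, map_smul, smul_add, RingHom.id_apply, Prod.smul_mk]

variable [ContMDiffVectorBundle 1 F V I] {x : M} {v w : V x} {c : ℝ → V x} {t : ℝ}

theorem mdifferentiableAt_vertical (hc : DifferentiableAt ℝ c t) :
    MDifferentiableAt 𝓘(ℝ, ℝ) (I.prod 𝓘(ℝ, F)) (fun s ↦ (⟨x, c s⟩ : TotalSpace F V)) t :=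
  ((contMDiff_fibre_inclusion x).mdifferentiable one_ne_zero _).comp t hc.mdifferentiableAt

theorem horPart_velocity_vertical (hc : DifferentiableAt ℝ c t) :
    horPart _ (velocity I (fun s ↦ (⟨x, c s⟩ : TotalSpace F V)) t) = 0 := by
  rw [horPart_velocity (mdifferentiableAt_vertical hc), curveVelocity, mfderiv_const]
  rfl

theorem covDerivAlong_vertical (hc : DifferentiableAt ℝ c t) :
    covDerivAlong D (fun s ↦ (⟨x, c s⟩ : TotalSpace F V)) t = deriv c t := by
  have hx := mem_baseSet_trivializationAt F V x
  have hcoord : mvfderiv (I.prod 𝓘(ℝ, F))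
      (fun η : TotalSpace F V ↦ (trivializationAt F V x η).2) ⟨x, c t⟩
        (velocity I (fun s ↦ (⟨x, c s⟩ : TotalSpace F V)) t) = fibreEquiv F V x (deriv c t) :=
    (hasDerivAt_comp_curve (mdifferentiableAt_trivialization_snd _ hx)
      (mdifferentiableAt_vertical hc)).unique
      ((fibreEquiv F V x).hasFDerivAt.comp_hasDerivAt t hc.hasDerivAt)
  change connector D _ (velocity I (fun s ↦ (⟨x, c s⟩ : TotalSpace F V)) t) = _
  rw [connector_eq_symmL_add, horPart_velocity_vertical hc, map_zero, add_zero]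
  refine (Trivialization.symmL_apply (R := ℝ) _ hx _).trans ?_
  exact (congrArg (fibreEquiv F V x).symm hcoord).trans ((fibreEquiv F V x).symm_apply_apply _)

theorem splitTangent_injective (ξ : TotalSpace F V) :
    Function.Injective (splitTangent D ξ) := by
  rw [injective_iff_map_eq_zero]
  intro A hA
  set e := trivializationAt F V ξ.proj
  have hξ : ξ.proj ∈ e.baseSet := mem_baseSet_trivializationAt F V ξ.proj
  have hhor : horPart ξ A = 0 := congrArg Prod.fst hA
  have hver : mvfderiv (I.prod 𝓘(ℝ, F)) (fun η : TotalSpace F V ↦ (e η).2) ξ A = 0 := by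
    have hc : connector D ξ A = 0 := congrArg Prod.snd hA
    rw [connector_eq_symmL_add, hhor, map_zero, add_zero] at hc
    exact (e.continuousLinearMapAt_symmL (R := ℝ) hξ _).symm.trans
      ((congrArg (e.continuousLinearMapAt ℝ ξ.proj) hc).trans (map_zero _))
  have he : (e : TotalSpace F V → M × F) =ᶠ[𝓝 ξ] fun η ↦ (η.proj, (e η).2) := by
    filter_upwards [e.open_source.mem_nhds (e.mem_source.2 hξ)] with η hη using
      Prod.ext (e.coe_fst hη) rfl
  have hderiv : mfderiv (I.prod 𝓘(ℝ, F)) (I.prod 𝓘(ℝ, F)) e ξ A = 0 := by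
    rw [he.mfderiv_eq, mfderiv_prodMk (mdifferentiableAt_proj ..)
      (mdifferentiableAt_trivialization_snd e hξ)]
    exact Prod.ext hhor hver
  exact (injective_iff_map_eq_zero _).1
    (e.mdifferentiable.mfderiv_injective (e.mem_source.2 hξ)) A hderiv

variable [FiniteDimensional ℝ EB] [FiniteDimensional ℝ F]

theorem splitTangent_bijective (ξ : TotalSpace F V) :
    Function.Bijective (splitTangent D ξ) := by
  have := finiteDimensional_fibre F (V := V) ξ.proj
  have : FiniteDimensional ℝ (TangentSpace I ξ.proj) := inferInstanceAs (FiniteDimensional ℝ EB)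
  have : FiniteDimensional ℝ (TangentSpace (I.prod 𝓘(ℝ, F)) ξ) :=
    inferInstanceAs (FiniteDimensional ℝ (EB × F))
  have hrank : Module.finrank ℝ (TangentSpace (I.prod 𝓘(ℝ, F)) ξ) =
      Module.finrank ℝ (TangentSpace I ξ.proj × V ξ.proj) := by
    rw [Module.finrank_prod, finrank_fibre F]
    exact Module.finrank_prod (R := ℝ) (M := EB) (M' := F)
  have hinj := splitTangent_injective D ξ
  exact ⟨hinj, (LinearMap.injective_iff_surjective_of_finrank_eq_finrank hrank).1 hinj⟩

/-- The splitting `T_ξ E ≅ T_x M ⊕ E_x` into horizontal and vertical part. -/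
noncomputable def splitTangentEquiv (ξ : TotalSpace F V) :
    TangentSpace (I.prod 𝓘(ℝ, F)) ξ ≃ₗ[ℝ] TangentSpace I ξ.proj × V ξ.proj :=
  LinearEquiv.ofBijective (splitTangent D ξ) (splitTangent_bijective D ξ)

/-- The horizontal lift to `ξ` of a tangent vector of the base. -/
noncomputable def horLift (ξ : TotalSpace F V) :
    TangentSpace I ξ.proj →ₗ[ℝ] TangentSpace (I.prod 𝓘(ℝ, F)) ξ :=
  (splitTangentEquiv D ξ).symm.toLinearMap ∘ₗ LinearMap.inl ℝ _ _

/-- The vertical lift to `ξ` of a vector of the fibre. -/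
noncomputable def verLift (ξ : TotalSpace F V) :
    V ξ.proj →ₗ[ℝ] TangentSpace (I.prod 𝓘(ℝ, F)) ξ :=
  (splitTangentEquiv D ξ).symm.toLinearMap ∘ₗ LinearMap.inr ℝ _ _

theorem horLift_add_verLift (ξ : TotalSpace F V) (A : TangentSpace (I.prod 𝓘(ℝ, F)) ξ) :
    horLift D ξ (horPart ξ A) + verLift D ξ (connector D ξ A) = A := by
  refine Eq.trans ?_ ((splitTangentEquiv D ξ).symm_apply_apply A)
  change (splitTangentEquiv D ξ).symm (horPart ξ A, 0) +
    (splitTangentEquiv D ξ).symm (0, connector D ξ A) = _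
  rw [← map_add, Prod.mk_add_mk, add_zero, zero_add]
  rfl

theorem splitTangent_horLift (ξ : TotalSpace F V) (h : TangentSpace I ξ.proj) :
    splitTangent D ξ (horLift D ξ h) = (h, 0) :=
  (splitTangentEquiv D ξ).apply_symm_apply (h, 0)

theorem splitTangent_verLift (ξ : TotalSpace F V) (w : V ξ.proj) :
    splitTangent D ξ (verLift D ξ w) = (0, w) :=
  (splitTangentEquiv D ξ).apply_symm_apply (0, w)

theorem velocity_eq_horLift {S : ℝ → TotalSpace F V}
    (hS : MDifferentiableAt 𝓘(ℝ, ℝ) (I.prod 𝓘(ℝ, F)) S t) (h : covDerivAlong D S t = 0) :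
    velocity I S t = horLift D (S t) (curveVelocity I (fun s ↦ (S s).proj) t) := by
  rw [← horLift_add_verLift D (S t) (velocity I S t), horPart_velocity hS,
    show connector D (S t) (velocity I S t) = 0 from h, map_zero, add_zero]

theorem velocity_vertical (hc : DifferentiableAt ℝ c t) :
    velocity I (fun s ↦ (⟨x, c s⟩ : TotalSpace F V)) t = verLift D ⟨x, c t⟩ (deriv c t) := by
  rw [← horLift_add_verLift D _ (velocity I _ t), horPart_velocity_vertical hc, map_zero, zero_add]
  exact congrArg _ (covDerivAlong_vertical D hc)

theorem hasDerivAt_vertical {f : TotalSpace F V → ℝ} (hc : HasDerivAt c w t) (hv : c t = v)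
    (hf : MDifferentiableAt (I.prod 𝓘(ℝ, F)) 𝓘(ℝ, ℝ) f ⟨x, v⟩) :
    HasDerivAt (fun s ↦ f ⟨x, c s⟩)
      (mvfderiv (I.prod 𝓘(ℝ, F)) f ⟨x, v⟩ (verLift D ⟨x, v⟩ w)) t := by
  subst hv
  rw [← hc.deriv, ← velocity_vertical D hc.differentiableAt]
  exact hasDerivAt_comp_curve hf (mdifferentiableAt_vertical hc.differentiableAt)

end Splitting

section TangentVector

variable
  {EB : Type*} [NormedAddCommGroup EB] [NormedSpace ℝ EB]
  {H : Type*} [TopologicalSpace H] {I : ModelWithCorners ℝ EB H}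
  {M : Type*} [TopologicalSpace M] [ChartedSpace H M]
  {F : Type*} [NormedAddCommGroup F] [NormedSpace ℝ F]
  {V : M → Type*} [TopologicalSpace (TotalSpace F V)]
  [∀ x, NormedAddCommGroup (V x)] [FiberBundle F V]
  {Y : Set (TotalSpace F V)}

theorem IsTangentVector.mvfderiv_eq_zero {p : TotalSpace F V}
    {A : TangentSpace (I.prod 𝓘(ℝ, F)) p} (hA : IsTangentVector I Y p A)
    {f : TotalSpace F V → ℝ} (hf : MDifferentiableAt (I.prod 𝓘(ℝ, F)) 𝓘(ℝ, ℝ) f p) {a : ℝ}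
    (hfY : ∀ η ∈ Y, f η = a) :
    mvfderiv (I.prod 𝓘(ℝ, F)) f p A = 0 := by
  obtain ⟨c, hc, hcA⟩ := hA
  obtain ⟨rfl, hvel⟩ := TotalSpace.mk.inj hcA
  obtain rfl := eq_of_heq hvel
  have hconst : (fun s ↦ f (c s)) =ᶠ[𝓝 0] fun _ ↦ a := hc.mem.mono fun s hs ↦ hfY _ hs
  exact (hasDerivAt_comp_curve hf (hc.smooth.mdifferentiableAt (by simp))).unique
    ((hasDerivAt_const _ a).congr_of_eventuallyEq hconst)

variable [∀ x, InnerProductSpace ℝ (V x)] [VectorBundle ℝ F V] [ContMDiffVectorBundle ∞ F V I]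
  [FiniteDimensional ℝ EB] [FiniteDimensional ℝ F] (D : CovariantDerivative I F V)

theorem isTangentVector_verLift {x : M} {c : ℝ → V x} {v w : V x} (hc : ContDiffAt ℝ ∞ c 0)
    (hv : c 0 = v) (hw : deriv c 0 = w) (hY : ∀ᶠ s in 𝓝 0, (⟨x, c s⟩ : TotalSpace F V) ∈ Y) :
    IsTangentVector I Y ⟨x, v⟩ (verLift D ⟨x, v⟩ w) := by
  subst hv hw
  rw [← velocity_vertical D (hc.differentiableAt (by simp))]
  exact ⟨_, ⟨(contMDiff_fibre_inclusion x _).comp 0 hc.contMDiffAt, hY⟩, rfl⟩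

theorem isTangentVector_horLift {γ : ℝ → M} {ε : ℝ} {P : ∀ s, V (γ 0) →ₗ[ℝ] V (γ s)}
    (hP : IsParallelTransport D γ ε P) {v : V (γ 0)}
    (hY : ∀ᶠ s in 𝓝 0, (⟨γ s, P s v⟩ : TotalSpace F V) ∈ Y) :
    IsTangentVector I Y ⟨γ 0, v⟩ (horLift D ⟨γ 0, v⟩ (curveVelocity I γ 0)) := by
  have hsmooth := (hP.contMDiffOn v).contMDiffAt (Ioo_mem_nhds hP.zero_mem.1 hP.zero_mem.2)
  have hvel := velocity_eq_horLift D (hP.mdifferentiableAt v hP.zero_mem)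
    (hP.covDerivAlong_eq_zero v 0 hP.zero_mem)
  have htransported (w : V (γ 0)) (hw : P 0 v = w) :
      IsTangentVector I Y ⟨γ 0, w⟩ (horLift D ⟨γ 0, w⟩ (curveVelocity I γ 0)) := by
    subst hw
    exact ⟨_, ⟨hsmooth, hY⟩, congrArg _ hvel⟩
  exact htransported v (hP.apply_zero v)

end TangentVector

section Normal

variable
  {EB : Type*} [NormedAddCommGroup EB] [NormedSpace ℝ EB]
  {H : Type*} [TopologicalSpace H] {I : ModelWithCorners ℝ EB H}
  {M : Type*} [TopologicalSpace M] [ChartedSpace H M]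
  [RiemannianBundle (fun x : M ↦ TangentSpace I x)]
  {F : Type*} [NormedAddCommGroup F] [NormedSpace ℝ F]
  {V : M → Type*} [TopologicalSpace (TotalSpace F V)]
  [∀ x, NormedAddCommGroup (V x)] [∀ x, InnerProductSpace ℝ (V x)]
  [FiberBundle F V] (D : CovariantDerivative I F V) {p : TotalSpace F V}

theorem sasakiMetric_comm (A B : TangentSpace (I.prod 𝓘(ℝ, F)) p) :
    sasakiMetric D p A B = sasakiMetric D p B A := by
  simp only [sasakiMetric, real_inner_comm]

variable [VectorBundle ℝ F V]

theorem sasakiMetric_smul_left (a : ℝ) (A B : TangentSpace (I.prod 𝓘(ℝ, F)) p) :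
    sasakiMetric D p (a • A) B = a * sasakiMetric D p A B := by
  obtain ⟨hhor, hver⟩ := Prod.mk.inj (map_smul (splitTangent D p) a A)
  rw [sasakiMetric, hhor, hver, real_inner_smul_left, real_inner_smul_left, ← mul_add]
  rfl

theorem exists_isOutwardUnitNormal_of_normal {Y : Set (TotalSpace F V)}
    {N : TangentSpace (I.prod 𝓘(ℝ, F)) p}
    (hnormal : ∀ A, IsTangentVector I Y p A → sasakiMetric D p N A = 0)
    (houtward : 0 < inner ℝ (connector D p N) p.2) :
    ∃ N, IsOutwardUnitNormal D Y p N := by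
  have hNN : 0 < sasakiMetric D p N N := by
    have hver : connector D p N ≠ 0 := fun h ↦ by simp [h] at houtward
    exact add_pos_of_nonneg_of_pos real_inner_self_nonneg (real_inner_self_pos.2 hver)
  have hver_smul (a : ℝ) : connector D p (a • N) = a • connector D p N :=
    congrArg Prod.snd (map_smul (splitTangent D p) a N)
  refine ⟨(√(sasakiMetric D p N N))⁻¹ • N, ?_, fun A hA ↦ ?_, ?_⟩
  · rw [sasakiMetric_smul_left, sasakiMetric_comm D N (_ • N), sasakiMetric_smul_left, ← mul_assoc,
      ← mul_inv, Real.mul_self_sqrt hNN.le, inv_mul_cancel₀ hNN.ne']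
  · rw [sasakiMetric_smul_left, hnormal A hA, mul_zero]
  · rw [hver_smul, real_inner_smul_left]
    positivity

variable [FiniteDimensional ℝ EB] [FiniteDimensional ℝ F] [ContMDiffVectorBundle 1 F V I]

theorem sasakiMetric_horLift (N : TangentSpace (I.prod 𝓘(ℝ, F)) p) (h : TangentSpace I p.proj) :
    sasakiMetric D p N (horLift D p h) = inner ℝ (horPart p N) h := by
  obtain ⟨hhor, hver⟩ := Prod.mk.inj (splitTangent_horLift D p h)
  rw [sasakiMetric, hhor, hver, inner_zero_right, add_zero]

theorem sasakiMetric_verLift (N : TangentSpace (I.prod 𝓘(ℝ, F)) p) (w : V p.proj) :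
    sasakiMetric D p N (verLift D p w) = inner ℝ (connector D p N) w := by
  obtain ⟨hhor, hver⟩ := Prod.mk.inj (splitTangent_verLift D p w)
  rw [sasakiMetric, hhor, hver, inner_zero_right, zero_add]

theorem exists_sasakiMetric_eq (ℓ : TangentSpace (I.prod 𝓘(ℝ, F)) p →ₗ[ℝ] ℝ) :
    ∃ N, ∀ A, sasakiMetric D p N A = ℓ A := by
  have := finiteDimensional_fibre F (V := V) p.proj
  have : FiniteDimensional ℝ (TangentSpace I p.proj) := inferInstanceAs (FiniteDimensional ℝ EB)
  set a := (InnerProductSpace.toDual ℝ _).symm (ℓ ∘ₗ horLift D p).toContinuousLinearMap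
  set b := (InnerProductSpace.toDual ℝ _).symm (ℓ ∘ₗ verLift D p).toContinuousLinearMap
  obtain ⟨N, hN⟩ := (splitTangentEquiv D p).surjective (a, b)
  obtain ⟨hhor, hver⟩ := Prod.mk.inj hN
  refine ⟨N, fun A ↦ ?_⟩
  rw [sasakiMetric, hhor, hver, InnerProductSpace.toDual_symm_apply,
    InnerProductSpace.toDual_symm_apply]
  exact (map_add ℓ _ _).symm.trans (congrArg ℓ (horLift_add_verLift D p A))

end Normal

section GaugeSq

variable
  {EB : Type*} [NormedAddCommGroup EB] [NormedSpace ℝ EB]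
  {H : Type*} [TopologicalSpace H] {I : ModelWithCorners ℝ EB H}
  {M : Type*} [TopologicalSpace M] [ChartedSpace H M]
  {F : Type*} [NormedAddCommGroup F] [NormedSpace ℝ F]
  {V : M → Type*} [TopologicalSpace (TotalSpace F V)]
  [∀ x, NormedAddCommGroup (V x)] [∀ x, InnerProductSpace ℝ (V x)]
  [FiberBundle F V] {u : TotalSpace F V → ℝ}

/-- The function `‖η‖² e^{-2u(η)}`, a defining function of the radial graph of `u`: it is equal
to `1` there. -/
noncomputable def gaugeSq (u : TotalSpace F V → ℝ) (η : TotalSpace F V) : ℝ :=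
  inner ℝ η.2 η.2 * Real.exp (-2 * u η)

theorem gaugeSq_eq_one (hu : IsRadiallyConstantSmooth I u) {η : TotalSpace F V}
    (hη : η ∈ radialGraph u) : gaugeSq u η = 1 := by
  rw [gaugeSq, real_inner_self_eq_norm_sq, ((mem_radialGraph_iff hu η.proj η.2).1 hη).2,
    ← Real.exp_nat_mul, ← Real.exp_add]
  simp

theorem gaugeSq_smul (hu : IsRadiallyConstantSmooth I u) {x : M} {v : V x} (hv : v ≠ 0) {t : ℝ}
    (ht : 0 < t) : gaugeSq u ⟨x, t • v⟩ = t ^ 2 * gaugeSq u ⟨x, v⟩ := by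
  rw [gaugeSq, gaugeSq, hu.radial x v t hv ht, real_inner_smul_left, real_inner_smul_right]
  ring

variable [VectorBundle ℝ F V] [IsContMDiffRiemannianBundle I ∞ F V]

theorem mdifferentiableAt_gaugeSq (hu : IsRadiallyConstantSmooth I u) {η : TotalSpace F V}
    (hη : η ∈ puncturedBundle F V) :
    MDifferentiableAt (I.prod 𝓘(ℝ, F)) 𝓘(ℝ, ℝ) (gaugeSq u) η := by
  have huη := hu.smooth.contMDiffAt ((isOpen_puncturedBundle I).mem_nhds hη)
  have hexp : ContDiff ℝ ∞ (fun a : ℝ ↦ Real.exp (-2 * a)) := by fun_prop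
  exact ((contMDiff_normSq (I := I) η).mul
    (hexp.contMDiff.contMDiffAt.comp η huη)).mdifferentiableAt (by simp)

variable [FiniteDimensional ℝ EB] [FiniteDimensional ℝ F] [ContMDiffVectorBundle 1 F V I]
  (D : CovariantDerivative I F V)

theorem mvfderiv_gaugeSq_verLift (hu : IsRadiallyConstantSmooth I u) {x : M} {v : V x}
    (hv : v ≠ 0) :
    mvfderiv (I.prod 𝓘(ℝ, F)) (gaugeSq u) ⟨x, v⟩ (verLift D ⟨x, v⟩ v) =
      2 * gaugeSq u ⟨x, v⟩ := by
  have hray : HasDerivAt (fun s : ℝ ↦ s • v) v 1 := by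
    simpa using (hasDerivAt_id' (1 : ℝ)).smul_const v
  have hsq : HasDerivAt (fun s : ℝ ↦ s ^ 2 * gaugeSq u ⟨x, v⟩) (2 * gaugeSq u ⟨x, v⟩) 1 := by
    simpa using (hasDerivAt_pow 2 (1 : ℝ)).mul_const (gaugeSq u ⟨x, v⟩)
  have hsmul : (fun s : ℝ ↦ gaugeSq u ⟨x, s • v⟩) =ᶠ[𝓝 1] fun s ↦ s ^ 2 * gaugeSq u ⟨x, v⟩ := by
    filter_upwards [Ioi_mem_nhds (zero_lt_one' ℝ)] with s hs using gaugeSq_smul hu hv hs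
  exact (hasDerivAt_vertical D hray (one_smul ℝ v) (mdifferentiableAt_gaugeSq hu hv)).unique
    (hsq.congr_of_eventuallyEq hsmul)

theorem exists_isOutwardUnitNormal [RiemannianBundle (fun x : M ↦ TangentSpace I x)]
    (hu : IsRadiallyConstantSmooth I u) {p : TotalSpace F V} (hp : p ∈ radialGraph u) :
    ∃ N, IsOutwardUnitNormal D (radialGraph u) p N := by
  have hp0 : p.2 ≠ 0 := ((mem_radialGraph_iff hu p.proj p.2).1 hp).1
  obtain ⟨N, hN⟩ :=
    exists_sasakiMetric_eq D (mvfderiv (I.prod 𝓘(ℝ, F)) (gaugeSq u) p).toLinearMap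
  refine exists_isOutwardUnitNormal_of_normal D (N := N) (fun A hA ↦ ?_) ?_
  · rw [hN]
    exact hA.mvfderiv_eq_zero (mdifferentiableAt_gaugeSq hu hp0) fun η hη ↦ gaugeSq_eq_one hu hη
  · rw [← sasakiMetric_verLift, hN]
    change 0 < mvfderiv (I.prod 𝓘(ℝ, F)) (gaugeSq u) p (verLift D p p.2)
    rw [mvfderiv_gaugeSq_verLift D hu hp0, gaugeSq_eq_one hu hp]
    norm_num

end GaugeSq

section Charts

variable
  {EB : Type*} [NormedAddCommGroup EB] [NormedSpace ℝ EB]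
  {H : Type*} [TopologicalSpace H] {I : ModelWithCorners ℝ EB H}
  {M : Type*} [TopologicalSpace M] [ChartedSpace H M] {x₀ : M}

theorem extChartAt_symm_mem_source {y : EB} (hy : y ∈ (extChartAt I x₀).target) :
    (extChartAt I x₀).symm y ∈ (chartAt H x₀).source := by
  rw [← extChartAt_source I]
  exact (extChartAt I x₀).map_target hy

variable [IsManifold I ∞ M]

theorem snd_trivializationAt_curveVelocity {γ : ℝ → M} {t : ℝ}
    (hγ : MDifferentiableAt 𝓘(ℝ, ℝ) I γ t) (ht : γ t ∈ (chartAt H x₀).source) :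
    (trivializationAt EB (TangentSpace I) x₀ (⟨γ t, curveVelocity I γ t⟩ : TangentBundle I M)).2 =
      deriv (fun s ↦ extChartAt I x₀ (γ s)) t := by
  have hb : γ t ∈ (trivializationAt EB (TangentSpace I (M := M)) x₀).baseSet := ht
  rw [(hasDerivAt_comp_curve (mdifferentiableAt_extChartAt (I := I) ht) hγ).deriv,
    ← Trivialization.continuousLinearMapAt_apply_of_mem (R := ℝ) _ hb]
  exact congrArg (fun T ↦ T (curveVelocity I γ t))
    (TangentBundle.continuousLinearMapAt_trivializationAt (I := I) ht)

theorem contMDiffOn_extChartAt_symm_comp {N : Type*} [NormedAddCommGroup N] [NormedSpace ℝ N]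
    {y : N → EB} {J : Set N} (hy : ContDiffOn ℝ ∞ y J)
    (hJ : MapsTo y J (extChartAt I x₀).target) :
    ContMDiffOn 𝓘(ℝ, N) I ∞ (fun t ↦ (extChartAt I x₀).symm (y t)) J :=
  (contMDiffOn_extChartAt_symm x₀).comp hy.contMDiffOn hJ

theorem snd_trivializationAt_curveVelocity_extChartAt_symm {y : ℝ → EB} {J : Set ℝ}
    (hJ : IsOpen J) (hy : ContDiffOn ℝ ∞ y J) (hmaps : MapsTo y J (extChartAt I x₀).target)
    {t : ℝ} (ht : t ∈ J) :
    (trivializationAt EB (TangentSpace I) x₀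
      (⟨_, curveVelocity I (fun s ↦ (extChartAt I x₀).symm (y s)) t⟩ : TangentBundle I M)).2 =
      deriv y t := by
  have hγ := (contMDiffOn_extChartAt_symm_comp hy hmaps).contMDiffAt (hJ.mem_nhds ht)
  rw [snd_trivializationAt_curveVelocity (hγ.mdifferentiableAt (by simp))
    (extChartAt_symm_mem_source (hmaps ht))]
  refine EventuallyEq.deriv_eq ?_
  filter_upwards [hJ.mem_nhds ht] with s hs using (extChartAt I x₀).right_inv (hmaps hs)

variable [I.Boundaryless]

theorem exists_curve_snd_trivializationAt_eq (p : TangentBundle I M) (a : EB) :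
    ∃ (γ : ℝ → M) (J : Set ℝ), IsOpen J ∧ 0 ∈ J ∧ ContMDiffOn 𝓘(ℝ, ℝ) I ∞ γ J ∧
      (⟨γ 0, curveVelocity I γ 0⟩ : TangentBundle I M) = p ∧
      ∀ t ∈ J, (trivializationAt EB (TangentSpace I) p.proj
        (⟨γ t, curveVelocity I γ t⟩ : TangentBundle I M)).2 =
          (trivializationAt EB (TangentSpace I) p.proj p).2 + t • a := by
  set φ := extChartAt I p.proj
  set e := trivializationAt EB (TangentSpace I (M := M)) p.proj
  set k : EB := (e p).2
  set y : ℝ → EB := fun t ↦ φ p.proj + t • k + (t ^ 2 / 2) • a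
  have hy : ContDiff ℝ ∞ y := by fun_prop
  have hy0 : y 0 = φ p.proj := by simp [y]
  have hy' (t) : HasDerivAt y (k + t • a) t := by
    have hlin : HasDerivAt (fun t : ℝ ↦ t • k) ((1 : ℝ) • k) t :=
      (hasDerivAt_id' t).smul_const k
    have hquad : HasDerivAt (fun t : ℝ ↦ (t ^ 2 / 2) • a) (t • a) t := by
      simpa using (((hasDerivAt_id' t).fun_pow 2).div_const 2).smul_const a
    simpa using (hlin.const_add (φ p.proj)).fun_add hquad
  have hJ : IsOpen (y ⁻¹' φ.target) := (isOpen_extChartAt_target p.proj).preimage hy.continuous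
  have h0 : (0 : ℝ) ∈ y ⁻¹' φ.target := by
    rw [mem_preimage, hy0]
    exact mem_extChartAt_target p.proj
  have hvel (t) (ht : t ∈ y ⁻¹' φ.target) :=
    (snd_trivializationAt_curveVelocity_extChartAt_symm hJ hy.contDiffOn (fun _ hs ↦ hs) ht).trans
      (hy' t).deriv
  refine ⟨fun t ↦ φ.symm (y t), _, hJ, h0,
    contMDiffOn_extChartAt_symm_comp hy.contDiffOn fun _ hs ↦ hs, ?_, hvel⟩
  have hγ0 : φ.symm (y 0) = p.proj := by rw [hy0, extChartAt_to_inv]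
  have hstart : (⟨_, curveVelocity I (fun t ↦ φ.symm (y t)) 0⟩ : TangentBundle I M) ∈ e.source :=
    e.mem_source.2 (extChartAt_symm_mem_source h0)
  have hp : p ∈ e.source :=
    e.mem_source.2 (mem_baseSet_trivializationAt EB (TangentSpace I) p.proj)
  refine e.injOn hstart hp (Prod.ext ?_ ?_)
  · exact (e.coe_fst hstart).trans (hγ0.trans (e.coe_fst hp).symm)
  · exact (hvel 0 h0).trans (by simp [k])

theorem exists_curve_covDerivAlong_eq_zero [FiniteDimensional ℝ EB]
    (LC : CovariantDerivative I EB (fun x : M ↦ TangentSpace I x)) (p : TangentBundle I M) :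
    ∃ (γ : ℝ → M) (J : Set ℝ), IsOpen J ∧ 0 ∈ J ∧ ContMDiffOn 𝓘(ℝ, ℝ) I ∞ γ J ∧
      (⟨γ 0, curveVelocity I γ 0⟩ : TangentBundle I M) = p ∧
      covDerivAlong LC (fun s ↦ (⟨γ s, curveVelocity I γ s⟩ : TangentBundle I M)) 0 = 0 := by
  set e := trivializationAt EB (TangentSpace I (M := M)) p.proj
  -- At `t = 0` the acceleration has coordinates `γ'' + Γ(γ', γ')`, so prescribe `γ'' = -Γ(p, p)`.
  set a : EB := -connForm e LC p.proj p.2 (e p).2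
  obtain ⟨γ, J, hJ, h0, hγ, hstart, hvel⟩ := exists_curve_snd_trivializationAt_eq p a
  refine ⟨γ, J, hJ, h0, hγ, hstart, ?_⟩
  have hγ0 : γ 0 ∈ e.baseSet := by
    rw [show γ 0 = p.proj from congrArg TotalSpace.proj hstart]
    exact mem_baseSet_trivializationAt EB (TangentSpace I) p.proj
  have hS := (contMDiffOn_curveVelocity (m := ∞) (n := ∞) (by simp) hJ hγ).contMDiffAt
    (hJ.mem_nhds h0)
  have haccel : deriv (fun s ↦ (e (⟨γ s, curveVelocity I γ s⟩ : TangentBundle I M)).2) 0 = a := by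
    rw [EventuallyEq.deriv_eq (f := fun s : ℝ ↦ (e p).2 + s • a)
      (by filter_upwards [hJ.mem_nhds h0] using hvel)]
    simpa using (((hasDerivAt_id' (0 : ℝ)).smul_const a).const_add (e p).2).deriv
  have hform : connForm e LC (γ 0) (curveVelocity I γ 0)
      (e (⟨γ 0, curveVelocity I γ 0⟩ : TangentBundle I M)).2 = -a :=
    (congrArg (fun q : TangentBundle I M ↦ connForm e LC q.proj q.2 (e q).2) hstart).trans
      (neg_neg _).symm
  refine (covDerivAlong_eq LC (e := e) hγ0 (hS.mdifferentiableAt (by simp))).trans ?_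
  change e.symm (γ 0) (deriv _ 0 + connForm e LC (γ 0) (curveVelocity I γ 0)
    (e (⟨γ 0, curveVelocity I γ 0⟩ : TangentBundle I M)).2) = 0
  rw [haccel, hform, add_neg_cancel, ← e.symmL_apply (R := ℝ) hγ0, map_zero]

end Charts

section ParallelInduction

variable
  {EB : Type*} [NormedAddCommGroup EB] [NormedSpace ℝ EB] [FiniteDimensional ℝ EB]
  {H : Type*} [TopologicalSpace H] {I : ModelWithCorners ℝ EB H} [I.Boundaryless]
  {M : Type*} [TopologicalSpace M] [ChartedSpace H M] [IsManifold I ∞ M] [T2Space M]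
  {F : Type*} [NormedAddCommGroup F] [NormedSpace ℝ F] [FiniteDimensional ℝ F]
  {V : M → Type*} [TopologicalSpace (TotalSpace F V)]
  [∀ x, NormedAddCommGroup (V x)] [∀ x, InnerProductSpace ℝ (V x)]
  [FiberBundle F V] [VectorBundle ℝ F V] [ContMDiffVectorBundle ∞ F V I]
  {D : CovariantDerivative I F V} (hD : D.ContMDiffCovariantDerivative ∞)
  {p : ∀ x : M, V x → TangentSpace I x → Prop}

include hD

theorem forall_of_isParallelTransport_of_covDerivAlong_eq_zero
    (LC : CovariantDerivative I EB (fun x : M ↦ TangentSpace I x))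
    (hp : ∀ γ ε P, IsParallelTransport D γ ε P →
      covDerivAlong LC (fun s ↦ (⟨γ s, curveVelocity I γ s⟩ : TangentBundle I M)) 0 = 0 →
      ∀ v, p (γ 0) v (curveVelocity I γ 0)) (x : M) (v : V x) (h : TangentSpace I x) :
    p x v h := by
  obtain ⟨γ, J, hJ, h0, hγ, hstart, hacc⟩ :=
    exists_curve_covDerivAlong_eq_zero LC (⟨x, h⟩ : TangentBundle I M)
  obtain ⟨ε, P, hP⟩ := exists_isParallelTransport hD hJ h0 hγ
  have hp' : ∀ w : V x, p x w h :=
    cast (congrArg (fun q : TangentBundle I M ↦ ∀ w, p q.proj w q.2) hstart) (hp γ ε P hP hacc)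
  exact hp' v

theorem forall_of_isParallelTransport
    (hp : ∀ γ ε P, IsParallelTransport D γ ε P → ∀ v, p (γ 0) v (curveVelocity I γ 0))
    (x : M) (v : V x) (h : TangentSpace I x) : p x v h := by
  obtain ⟨γ, J, hJ, h0, hγ, hstart, -⟩ :=
    exists_curve_snd_trivializationAt_eq (⟨x, h⟩ : TangentBundle I M) 0
  obtain ⟨ε, P, hP⟩ := exists_isParallelTransport hD hJ h0 hγ
  have hp' : ∀ w : V x, p x w h :=
    cast (congrArg (fun q : TangentBundle I M ↦ ∀ w, p q.proj w q.2) hstart) (hp γ ε P hP)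
  exact hp' v

end ParallelInduction

section SphereBundle

variable
  {EB : Type*} [NormedAddCommGroup EB] [NormedSpace ℝ EB] [FiniteDimensional ℝ EB]
  {H : Type*} [TopologicalSpace H] {I : ModelWithCorners ℝ EB H}
  {M : Type*} [TopologicalSpace M] [ChartedSpace H M]
  {F : Type*} [NormedAddCommGroup F] [NormedSpace ℝ F] [FiniteDimensional ℝ F]
  {V : M → Type*} [TopologicalSpace (TotalSpace F V)]
  [∀ x, NormedAddCommGroup (V x)] [∀ x, InnerProductSpace ℝ (V x)]
  [FiberBundle F V] [VectorBundle ℝ F V] [ContMDiffVectorBundle ∞ F V I]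
  {D : CovariantDerivative I F V} {Y : Set (TotalSpace F V)} {r : ℝ} {x : M} {v w : V x}

theorem isTangentVector_verLift_of_norm_eq (hY : ∀ (x : M) (w : V x), ‖w‖ = r → ⟨x, w⟩ ∈ Y)
    (hv : ‖v‖ = r) (hw : ‖w‖ = r) (hvw : inner ℝ v w = 0) :
    IsTangentVector I Y ⟨x, v⟩ (verLift D ⟨x, v⟩ w) := by
  have hc' := ((Real.hasDerivAt_cos 0).smul_const v).fun_add
    ((Real.hasDerivAt_sin 0).smul_const w)
  refine isTangentVector_verLift D (c := fun t ↦ Real.cos t • v + Real.sin t • w) ?_ (by simp)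
    (by simpa using hc'.deriv) (Eventually.of_forall fun t ↦ hY _ _ ?_)
  · exact ((Real.contDiff_cos.smul contDiff_const).add
      (Real.contDiff_sin.smul contDiff_const)).contDiffAt
  · rw [← sq_eq_sq₀ (norm_nonneg _) (hv ▸ norm_nonneg v), norm_add_sq_real, norm_smul, norm_smul,
      inner_smul_left, inner_smul_right, hvw, hv, hw, mul_pow, mul_pow, Real.norm_eq_abs,
      Real.norm_eq_abs, sq_abs, sq_abs]
    linear_combination r ^ 2 * Real.cos_sq_add_sin_sq t

variable [RiemannianBundle (fun x : M ↦ TangentSpace I x)]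
  {N : TangentSpace (I.prod 𝓘(ℝ, F)) (⟨x, v⟩ : TotalSpace F V)}

theorem connector_normal_mem_span (hY : ∀ (x : M) (w : V x), ‖w‖ = r → ⟨x, w⟩ ∈ Y)
    (hr : 0 < r) (hv : ‖v‖ = r)
    (hN : ∀ A, IsTangentVector I Y ⟨x, v⟩ A → sasakiMetric D ⟨x, v⟩ N A = 0) :
    connector D ⟨x, v⟩ N ∈ ℝ ∙ v := by
  rw [← (ℝ ∙ v).orthogonal_orthogonal, Submodule.mem_orthogonal']
  intro w hw
  rw [Submodule.mem_orthogonal_singleton_iff_inner_right] at hw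
  rcases eq_or_ne w 0 with rfl | hw0
  · exact inner_zero_right _
  have hnorm : ‖(r / ‖w‖) • w‖ = r := by
    rw [norm_smul, Real.norm_of_nonneg (by positivity), div_mul_cancel₀ _ (norm_ne_zero_iff.2 hw0)]
  have horth := hN _ (isTangentVector_verLift_of_norm_eq (D := D) hY hv hnorm
    (by rw [inner_smul_right, hw, mul_zero]))
  rw [sasakiMetric_verLift, inner_smul_right] at horth
  exact (mul_eq_zero.1 horth).resolve_left (div_ne_zero hr.ne' (norm_ne_zero_iff.2 hw0))

variable [I.Boundaryless] [IsManifold I ∞ M] [T2Space M] [IsContMDiffRiemannianBundle I ∞ F V]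

theorem horPart_normal_eq_zero (hD : D.ContMDiffCovariantDerivative ∞)
    (hDm : D.IsMetricCompatible) (hY : ∀ (x : M) (w : V x), ‖w‖ = r → ⟨x, w⟩ ∈ Y) (hv : ‖v‖ = r)
    (hN : ∀ A, IsTangentVector I Y ⟨x, v⟩ A → sasakiMetric D ⟨x, v⟩ N A = 0) :
    horPart (⟨x, v⟩ : TotalSpace F V) N = 0 := by
  have htangent (h : TangentSpace I x) : IsTangentVector I Y ⟨x, v⟩ (horLift D ⟨x, v⟩ h) := by
    refine forall_of_isParallelTransport hD (p := fun x v h ↦ ‖v‖ = r →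
      IsTangentVector I Y ⟨x, v⟩ (horLift D ⟨x, v⟩ h)) (fun γ ε P hP v hv ↦ ?_) x v h hv
    refine isTangentVector_horLift D hP ?_
    filter_upwards [Ioo_mem_nhds hP.zero_mem.1 hP.zero_mem.2] with t ht
    exact hY _ _ ((hP.norm_map hDm v ht).trans hv)
  have horth := hN _ (htangent (horPart (⟨x, v⟩ : TotalSpace F V) N))
  rw [sasakiMetric_horLift] at horth
  exact inner_self_eq_zero.1 horth

end SphereBundle

section ConstantNorm

variable
  {EB : Type*} [NormedAddCommGroup EB] [NormedSpace ℝ EB]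
  {H : Type*} [TopologicalSpace H] {I : ModelWithCorners ℝ EB H}
  {M : Type*} [TopologicalSpace M] [ChartedSpace H M]
  {F : Type*} [NormedAddCommGroup F] [NormedSpace ℝ F] [FiniteDimensional ℝ F]
  {V : M → Type*} [TopologicalSpace (TotalSpace F V)]
  [∀ x, NormedAddCommGroup (V x)] [∀ x, InnerProductSpace ℝ (V x)]
  [FiberBundle F V] [VectorBundle ℝ F V] [ContMDiffVectorBundle ∞ F V I]
  [IsContMDiffRiemannianBundle I ∞ F V]
  {D : CovariantDerivative I F V} {c : ℝ → TotalSpace F V} {r : ℝ}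

theorem inner_covDerivAlong_self_eq_zero (hDm : D.IsMetricCompatible) {t : ℝ}
    (hc : MDifferentiableAt 𝓘(ℝ, ℝ) (I.prod 𝓘(ℝ, F)) c t) (hr : ∀ᶠ s in 𝓝 t, ‖(c s).2‖ = r) :
    inner ℝ (covDerivAlong D c t) (c t).2 = 0 := by
  have hsq : (fun s ↦ inner ℝ (c s).2 (c s).2) =ᶠ[𝓝 t] fun _ ↦ r ^ 2 := by
    filter_upwards [hr] with s hs
    rw [real_inner_self_eq_norm_sq, hs]
  have hleibniz := (hasDerivAt_inner_along hDm (γ := fun s ↦ (c s).proj) (σ := fun s ↦ (c s).2)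
    (τ := fun s ↦ (c s).2) hc hc).unique ((hasDerivAt_const t _).congr_of_eventuallyEq hsq)
  rw [real_inner_comm (covDerivAlong D c t)] at hleibniz
  linarith

variable [FiniteDimensional ℝ EB] [IsManifold I ∞ M] [T2Space M]

theorem inner_covDerivAlong_covDerivAlong_self (hD : D.ContMDiffCovariantDerivative ∞)
    (hDm : D.IsMetricCompatible) {t : ℝ} (hc : ContMDiffAt 𝓘(ℝ, ℝ) (I.prod 𝓘(ℝ, F)) 2 c t)
    (hr : ∀ᶠ s in 𝓝 t, ‖(c s).2‖ = r) :
    inner ℝ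
      (covDerivAlong D (fun s ↦ (⟨(c s).proj, covDerivAlong D c s⟩ : TotalSpace F V)) t) (c t).2 =
      -inner ℝ (covDerivAlong D c t) (covDerivAlong D c t) := by
  have horth : (fun s ↦ inner ℝ (covDerivAlong D c s) (c s).2) =ᶠ[𝓝 t] fun _ ↦ (0 : ℝ) := by
    obtain ⟨J, hJ, hcJ⟩ := (contMDiffAt_iff_contMDiffOn_nhds (n := 2) (by simp)).1 hc
    filter_upwards [eventually_mem_nhds_iff.2 hJ, hr.eventually_nhds] with s hs hrs
    exact inner_covDerivAlong_self_eq_zero hDm ((hcJ.contMDiffAt hs).mdifferentiableAt (by simp))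
      hrs
  exact eq_neg_of_add_eq_zero_left <| (hasDerivAt_inner_along hDm (γ := fun s ↦ (c s).proj)
    (σ := covDerivAlong D c) (τ := fun s ↦ (c s).2)
    (mdifferentiableAt_covDerivAlong hD hc)
    (hc.mdifferentiableAt (by simp))).unique ((hasDerivAt_const t _).congr_of_eventuallyEq horth)

end ConstantNorm

section ConstantCurvature

variable
  {EB : Type*} [NormedAddCommGroup EB] [NormedSpace ℝ EB]
  {H : Type*} [TopologicalSpace H] {I : ModelWithCorners ℝ EB H}
  {M : Type*} [TopologicalSpace M] [ChartedSpace H M]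
  {F : Type*} [NormedAddCommGroup F] [NormedSpace ℝ F]
  {V : M → Type*} [TopologicalSpace (TotalSpace F V)]
  [∀ x, NormedAddCommGroup (V x)] [∀ x, InnerProductSpace ℝ (V x)] [FiberBundle F V]

theorem mem_radialGraph_iff_of_const {u : TotalSpace F V → ℝ} (hu : IsRadiallyConstantSmooth I u)
    {a : ℝ} (ha : ∀ η ∈ puncturedBundle F V, u η = a) {η : TotalSpace F V} :
    η ∈ radialGraph u ↔ ‖η.2‖ = Real.exp a := by
  refine (mem_radialGraph_iff hu η.proj η.2).trans ⟨fun ⟨hη, h⟩ ↦ by rw [h, ha _ hη], fun h ↦ ?_⟩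
  have hη : η.2 ≠ 0 := norm_pos_iff.1 (h ▸ Real.exp_pos a)
  exact ⟨hη, by rw [h, ha _ hη]⟩

variable [FiniteDimensional ℝ EB] [I.Boundaryless] [IsManifold I ∞ M] [T2Space M]
  [RiemannianBundle (fun x : M ↦ TangentSpace I x)] [FiniteDimensional ℝ F]
  [VectorBundle ℝ F V] [ContMDiffVectorBundle ∞ F V I] [IsContMDiffRiemannianBundle I ∞ F V]
  {D : CovariantDerivative I F V}

theorem isConvexHypersurface_of_const
    (LC : CovariantDerivative I EB (fun x : M ↦ TangentSpace I x))
    (hD : D.ContMDiffCovariantDerivative ∞) (hDm : D.IsMetricCompatible)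
    {u : TotalSpace F V → ℝ} (hu : IsRadiallyConstantSmooth I u) {a : ℝ}
    (ha : ∀ η ∈ puncturedBundle F V, u η = a) :
    IsConvexHypersurface LC D (radialGraph u) := by
  intro c hc N hN
  have hY (x : M) (w : V x) (hw : ‖w‖ = Real.exp a) : ⟨x, w⟩ ∈ radialGraph u :=
    (mem_radialGraph_iff_of_const hu ha).2 hw
  have hnorm : ∀ᶠ s in 𝓝 0, ‖(c s).2‖ = Real.exp a :=
    hc.mem.mono fun s hs ↦ (mem_radialGraph_iff_of_const hu ha).1 hs
  have hc0 := hnorm.self_of_nhds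
  have hhor : horPart (c 0) N = 0 := horPart_normal_eq_zero hD hDm hY hc0 hN.normal
  obtain ⟨l, hl⟩ := Submodule.mem_span_singleton.1
    (connector_normal_mem_span hY (Real.exp_pos a) hc0 hN.normal)
  have hl0 : 0 < l := by
    have houtward := hN.outward
    change 0 < inner ℝ (connector D ⟨(c 0).proj, (c 0).2⟩ N) _ at houtward
    rw [← hl, real_inner_smul_left] at houtward
    exact pos_of_mul_pos_left houtward real_inner_self_nonneg
  change 0 ≤ -(inner ℝ _ (horPart (c 0) N) + inner ℝ
    (covDerivAlong D (fun s ↦ (⟨(c s).proj, covDerivAlong D c s⟩ : TotalSpace F V)) 0)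
    (connector D ⟨(c 0).proj, (c 0).2⟩ N))
  rw [hhor, inner_zero_right, zero_add, ← hl, real_inner_smul_right]
  have hsecond := inner_covDerivAlong_covDerivAlong_self hD hDm (hc.smooth.of_le (by norm_cast))
    hnorm
  rw [hsecond, mul_neg, neg_neg]
  exact mul_nonneg hl0.le real_inner_self_nonneg

end ConstantCurvature

section HorizontalDerivative

variable
  {EB : Type*} [NormedAddCommGroup EB] [NormedSpace ℝ EB] [FiniteDimensional ℝ EB]
  {H : Type*} [TopologicalSpace H] {I : ModelWithCorners ℝ EB H}
  {M : Type*} [TopologicalSpace M] [ChartedSpace H M]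
  {F : Type*} [NormedAddCommGroup F] [NormedSpace ℝ F] [FiniteDimensional ℝ F]
  {V : M → Type*} [TopologicalSpace (TotalSpace F V)]
  [∀ x, NormedAddCommGroup (V x)] [∀ x, InnerProductSpace ℝ (V x)]
  [FiberBundle F V] [VectorBundle ℝ F V] [ContMDiffVectorBundle 1 F V I]

/-- The derivative of a function on `E` along the horizontal lift of a tangent vector of `M`. -/
noncomputable def horDeriv (D : CovariantDerivative I F V) (f : TotalSpace F V → ℝ)
    (ξ : TotalSpace F V) : TangentSpace I ξ.proj →ₗ[ℝ] ℝ :=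
  (mvfderiv (I.prod 𝓘(ℝ, F)) f ξ).toLinearMap ∘ₗ horLift D ξ

variable {D : CovariantDerivative I F V} {f : TotalSpace F V → ℝ}

theorem IsParallelTransport.hasDerivAt_comp {γ : ℝ → M} {ε : ℝ} {P : ∀ t, V (γ 0) →ₗ[ℝ] V (γ t)}
    (hP : IsParallelTransport D γ ε P) (v : V (γ 0)) {t : ℝ} (ht : t ∈ Ioo (-ε) ε)
    (hf : MDifferentiableAt (I.prod 𝓘(ℝ, F)) 𝓘(ℝ, ℝ) f ⟨γ t, P t v⟩) :
    HasDerivAt (fun s ↦ f ⟨γ s, P s v⟩) (horDeriv D f ⟨γ t, P t v⟩ (curveVelocity I γ t)) t := by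
  have hderiv := hasDerivAt_comp_curve hf (hP.mdifferentiableAt v ht)
  have hlift := velocity_eq_horLift D (hP.mdifferentiableAt v ht) (hP.covDerivAlong_eq_zero v t ht)
  exact hderiv.congr_deriv (congrArg (mvfderiv (I.prod 𝓘(ℝ, F)) f ⟨γ t, P t v⟩) hlift)

theorem IsParallelTransport.hasDerivAt_comp_zero {γ : ℝ → M} {ε : ℝ}
    {P : ∀ t, V (γ 0) →ₗ[ℝ] V (γ t)} (hP : IsParallelTransport D γ ε P) (v : V (γ 0))
    (hf : MDifferentiableAt (I.prod 𝓘(ℝ, F)) 𝓘(ℝ, ℝ) f ⟨γ 0, v⟩) :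
    HasDerivAt (fun s ↦ f ⟨γ s, P s v⟩) (horDeriv D f ⟨γ 0, v⟩ (curveVelocity I γ 0)) 0 := by
  have h := hP.hasDerivAt_comp (f := f) v hP.zero_mem
  rw [hP.apply_zero] at h
  exact h hf

end HorizontalDerivative

section BundleChart

variable
  {EB : Type*} [NormedAddCommGroup EB] [NormedSpace ℝ EB]
  {H : Type*} [TopologicalSpace H] {I : ModelWithCorners ℝ EB H}
  {M : Type*} [TopologicalSpace M] [ChartedSpace H M]
  {F : Type*} [NormedAddCommGroup F]
  {V : M → Type*} [TopologicalSpace (TotalSpace F V)] {x₀ : M}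
  {e : Trivialization F (TotalSpace.proj : TotalSpace F V → M)}

variable (I) in
/-- The domain in the base coordinates on which `bundleChartSymm` is the inverse of a chart. -/
def bundleChartTarget (x₀ : M) (e : Trivialization F (TotalSpace.proj : TotalSpace F V → M)) :
    Set EB :=
  (extChartAt I x₀).target ∩ (extChartAt I x₀).symm ⁻¹' e.baseSet

theorem isOpen_bundleChartTarget [I.Boundaryless] : IsOpen (bundleChartTarget I x₀ e) :=
  (continuousOn_extChartAt_symm x₀).isOpen_inter_preimage (isOpen_extChartAt_target x₀)
    e.open_baseSet

variable [∀ x, AddCommGroup (V x)]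

variable (I) in
/-- The inverse of the chart of `E` built from the chart of `M` at `x₀` and the trivialization
`e`. -/
noncomputable def bundleChartSymm (x₀ : M)
    (e : Trivialization F (TotalSpace.proj : TotalSpace F V → M)) (p : EB × F) : TotalSpace F V :=
  ⟨(extChartAt I x₀).symm p.1, e.symm _ p.2⟩

variable [IsManifold I ∞ M]

theorem symmL_trivializationAt_extChartAt_symm [I.Boundaryless] {y : EB}
    (hy : y ∈ (extChartAt I x₀).target) (k : EB) :
    (trivializationAt EB (TangentSpace I) x₀).symmL ℝ ((extChartAt I x₀).symm y) k =
      mfderiv 𝓘(ℝ, EB) I (extChartAt I x₀).symm y k := by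
  rw [TangentBundle.symmL_trivializationAt (extChartAt_symm_mem_source hy), I.range_eq_univ,
    mfderivWithin_univ]
  exact congrArg (fun z ↦ (mfderiv 𝓘(ℝ, EB) I (extChartAt I x₀).symm z : EB →L[ℝ] EB) k)
    ((extChartAt I x₀).right_inv hy)

variable [NormedSpace ℝ F] [∀ x, Module ℝ (V x)] [∀ x, TopologicalSpace (V x)]
  [FiberBundle F V] [VectorBundle ℝ F V] [ContMDiffVectorBundle ∞ F V I] [MemTrivializationAtlas e]

theorem contMDiffOn_bundleChartSymm :
    ContMDiffOn 𝓘(ℝ, EB × F) (I.prod 𝓘(ℝ, F)) ∞ (bundleChartSymm I x₀ e)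
      (bundleChartTarget I x₀ e ×ˢ univ) := by
  rw [e.contMDiffOn_iff fun p hp ↦ e.mem_source.2 hp.1.2]
  refine ⟨contMDiffOn_extChartAt_symm_comp contDiffOn_fst fun p hp ↦ hp.1.1, ?_⟩
  exact contDiffOn_snd.contMDiffOn.congr fun p hp ↦ by rw [bundleChartSymm, e.apply_mk_symm hp.1.2]

variable [I.Boundaryless] {p : EB × F}

theorem mdifferentiableAt_bundleChartSymm (hp : p.1 ∈ bundleChartTarget I x₀ e) :
    MDifferentiableAt 𝓘(ℝ, EB × F) (I.prod 𝓘(ℝ, F)) (bundleChartSymm I x₀ e) p :=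
  (contMDiffOn_bundleChartSymm.contMDiffAt ((isOpen_bundleChartTarget.prod isOpen_univ).mem_nhds
    ⟨hp, mem_univ _⟩)).mdifferentiableAt (by simp)

end BundleChart

section HorizontalLiftInCharts

variable
  {EB : Type*} [NormedAddCommGroup EB] [NormedSpace ℝ EB]
  {H : Type*} [TopologicalSpace H] {I : ModelWithCorners ℝ EB H} [I.Boundaryless]
  {M : Type*} [TopologicalSpace M] [ChartedSpace H M] [IsManifold I ∞ M]
  {F : Type*} [NormedAddCommGroup F] [NormedSpace ℝ F]
  {V : M → Type*} [TopologicalSpace (TotalSpace F V)]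
  [∀ x, NormedAddCommGroup (V x)] [∀ x, InnerProductSpace ℝ (V x)]
  [FiberBundle F V] [VectorBundle ℝ F V] [ContMDiffVectorBundle ∞ F V I]
  {x₀ : M} {e : Trivialization F (TotalSpace.proj : TotalSpace F V → M)}
  [MemTrivializationAtlas e] {p : EB × F}

theorem horPart_mfderiv_bundleChartSymm (hp : p.1 ∈ bundleChartTarget I x₀ e) (A : EB × F) :
    horPart (bundleChartSymm I x₀ e p)
        (mfderiv 𝓘(ℝ, EB × F) (I.prod 𝓘(ℝ, F)) (bundleChartSymm I x₀ e) p A) =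
      (trivializationAt EB (TangentSpace I) x₀).symmL ℝ ((extChartAt I x₀).symm p.1) A.1 := by
  have hφ : MDifferentiableAt 𝓘(ℝ, EB) I (extChartAt I x₀).symm p.1 :=
    ((contMDiffOn_extChartAt_symm x₀).contMDiffAt
      ((isOpen_extChartAt_target x₀).mem_nhds hp.1)).mdifferentiableAt (n := ∞) (by simp)
  have hfst : MDifferentiableAt 𝓘(ℝ, EB × F) 𝓘(ℝ, EB) Prod.fst p :=
    differentiableAt_fst.mdifferentiableAt
  rw [symmL_trivializationAt_extChartAt_symm hp.1]
  refine (mfderiv_comp_apply p (mdifferentiableAt_proj ..)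
    (mdifferentiableAt_bundleChartSymm hp) A).symm.trans
    ((mfderiv_comp_apply p hφ hfst A).trans ?_)
  rw [mfderiv_eq_fderiv, fderiv_fst]
  rfl

theorem mvfderiv_trivialization_snd_mfderiv_bundleChartSymm
    (hp : p.1 ∈ bundleChartTarget I x₀ e) (A : EB × F) :
    mvfderiv (I.prod 𝓘(ℝ, F)) (fun η : TotalSpace F V ↦ (e η).2) (bundleChartSymm I x₀ e p)
        (mfderiv 𝓘(ℝ, EB × F) (I.prod 𝓘(ℝ, F)) (bundleChartSymm I x₀ e) p A) = A.2 := by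
  have hsnd : (fun q ↦ (e (bundleChartSymm I x₀ e q)).2) =ᶠ[𝓝 p] Prod.snd := by
    filter_upwards [(isOpen_bundleChartTarget.preimage continuous_fst).mem_nhds hp] with q hq
    rw [bundleChartSymm, e.apply_mk_symm hq.2]
  refine (mfderiv_comp_apply p
    (mdifferentiableAt_trivialization_snd e (ξ := bundleChartSymm I x₀ e p) hp.2)
    (mdifferentiableAt_bundleChartSymm hp) A).symm.trans ?_
  rw [mfderiv_eq_fderiv]
  exact congrArg (fun L : EB × F →L[ℝ] F ↦ L A) (hsnd.fderiv_eq.trans fderiv_snd)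

variable [FiniteDimensional ℝ F] (D : CovariantDerivative I F V)

theorem connector_mfderiv_bundleChartSymm (hp : p.1 ∈ bundleChartTarget I x₀ e) (A : EB × F) :
    connector D (bundleChartSymm I x₀ e p)
        (mfderiv 𝓘(ℝ, EB × F) (I.prod 𝓘(ℝ, F)) (bundleChartSymm I x₀ e) p A) =
      e.symm ((extChartAt I x₀).symm p.1) (A.2 + connForm e D _
        ((trivializationAt EB (TangentSpace I) x₀).symmL ℝ ((extChartAt I x₀).symm p.1) A.1)
        p.2) := by
  have hsnd : (e (bundleChartSymm I x₀ e p)).2 = p.2 := by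
    rw [bundleChartSymm, e.apply_mk_symm hp.2]
  refine (connector_eq D hp.2 _).trans ?_
  rw [mvfderiv_trivialization_snd_mfderiv_bundleChartSymm hp, hsnd]
  exact congrArg (fun h ↦ e.symm ((extChartAt I x₀).symm p.1) (A.2 + connForm e D _ h p.2))
    (horPart_mfderiv_bundleChartSymm hp A)

variable [FiniteDimensional ℝ EB]

theorem horLift_bundleChartSymm (hp : p.1 ∈ bundleChartTarget I x₀ e) (k : EB) :
    horLift D (bundleChartSymm I x₀ e p)
        ((trivializationAt EB (TangentSpace I) x₀).symmL ℝ ((extChartAt I x₀).symm p.1) k) =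
      mfderiv 𝓘(ℝ, EB × F) (I.prod 𝓘(ℝ, F)) (bundleChartSymm I x₀ e) p
        (k, -connForm e D _ ((trivializationAt EB (TangentSpace I) x₀).symmL ℝ
          ((extChartAt I x₀).symm p.1) k) p.2) := by
  set A : EB × F := (k, -connForm e D _ ((trivializationAt EB (TangentSpace I) x₀).symmL ℝ
    ((extChartAt I x₀).symm p.1) k) p.2)
  set B := mfderiv 𝓘(ℝ, EB × F) (I.prod 𝓘(ℝ, F)) (bundleChartSymm I x₀ e) p A
  have hconn : connector D (bundleChartSymm I x₀ e p) B = 0 := by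
    refine (connector_mfderiv_bundleChartSymm D hp A).trans ?_
    rw [neg_add_cancel, ← e.symmL_apply (R := ℝ) hp.2, map_zero]
    rfl
  have hsplit := horLift_add_verLift D (bundleChartSymm I x₀ e p) B
  rw [hconn, map_zero, add_zero] at hsplit
  exact (congrArg (horLift D (bundleChartSymm I x₀ e p))
    (horPart_mfderiv_bundleChartSymm hp A).symm).trans hsplit

theorem horDeriv_bundleChartSymm {f : TotalSpace F V → ℝ}
    (hp : p.1 ∈ bundleChartTarget I x₀ e)
    (hf : MDifferentiableAt (I.prod 𝓘(ℝ, F)) 𝓘(ℝ, ℝ) f (bundleChartSymm I x₀ e p)) (k : EB) :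
    horDeriv D f (bundleChartSymm I x₀ e p)
        ((trivializationAt EB (TangentSpace I) x₀).symmL ℝ ((extChartAt I x₀).symm p.1) k) =
      fderiv ℝ (f ∘ bundleChartSymm I x₀ e) p
        (k, -connForm e D _ ((trivializationAt EB (TangentSpace I) x₀).symmL ℝ
          ((extChartAt I x₀).symm p.1) k) p.2) := by
  refine (congrArg (mvfderiv (I.prod 𝓘(ℝ, F)) f (bundleChartSymm I x₀ e p))
    (horLift_bundleChartSymm D hp k)).trans ?_
  have h := mfderiv_comp_apply p hf (mdifferentiableAt_bundleChartSymm hp)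
  rw [mfderiv_eq_fderiv] at h
  exact (h _).symm

end HorizontalLiftInCharts

section RescalingInvariance

variable
  {B : Type*} [TopologicalSpace B]
  {F : Type*} [NormedAddCommGroup F] [NormedSpace ℝ F]
  {V : B → Type*} [TopologicalSpace (TotalSpace F V)]
  [∀ x, AddCommGroup (V x)] [∀ x, Module ℝ (V x)] [∀ x, TopologicalSpace (V x)]
  [FiberBundle F V] [VectorBundle ℝ F V]
  {F' : Type*} [NormedAddCommGroup F'] [NormedSpace ℝ F']
  {V' : B → Type*} [TopologicalSpace (TotalSpace F' V')]
  [∀ x, AddCommGroup (V' x)] [∀ x, Module ℝ (V' x)] [∀ x, TopologicalSpace (V' x)]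
  [FiberBundle F' V'] [VectorBundle ℝ F' V']
  {e : Trivialization F (TotalSpace.proj : TotalSpace F V → B)} [MemTrivializationAtlas e]
  {e' : Trivialization F' (TotalSpace.proj : TotalSpace F' V' → B)} [MemTrivializationAtlas e']
  {q : ∀ x, V x → V' x → ℝ}

variable (e) in
theorem trivialization_symm_ne_zero {x : B} (hx : x ∈ e.baseSet) {w : F} (hw : w ≠ 0) :
    e.symm x w ≠ 0 :=
  (map_ne_zero_iff _ (e.continuousLinearEquivAt ℝ x hx).symm.injective).2 hw

variable (e) in
theorem exists_unit_smul_trivialization_symm_eq {x : B} (hx : x ∈ e.baseSet) {v : V x}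
    (hv : v ≠ 0) : ∃ a > (0 : ℝ), ∃ w ∈ Metric.sphere (0 : F) 1, a • e.symm x w = v := by
  obtain ⟨w, rfl⟩ := (e.continuousLinearEquivAt ℝ x hx).symm.surjective v
  have hw : ‖w‖ ≠ 0 := norm_ne_zero_iff.2 ((map_ne_zero_iff _ (LinearEquiv.injective _)).1 hv)
  refine ⟨‖w‖, (norm_nonneg w).lt_of_ne' hw, ‖w‖⁻¹ • w, by simp [norm_smul, hw], ?_⟩
  exact (map_smul (e.continuousLinearEquivAt ℝ x hx).symm _ _).symm.trans
    (congrArg _ (smul_inv_smul₀ hw w))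

variable [FiniteDimensional ℝ F] [Nontrivial F] [FiniteDimensional ℝ F'] [Nontrivial F']

theorem exists_forall_le_of_smul_invariant_of_isCompact {s : Set B} (hs : IsCompact s)
    (hs_nonempty : s.Nonempty) (hse : s ⊆ e.baseSet ∩ e'.baseSet)
    (hq : ∀ x v v' (a b : ℝ), v ≠ 0 → v' ≠ 0 → 0 < a → 0 < b → q x (a • v) (b • v') = q x v v')
    (hcont : ContinuousOn (fun p : B × F × F' ↦ q p.1 (e.symm p.1 p.2.1) (e'.symm p.1 p.2.2))
      ((e.baseSet ∩ e'.baseSet) ×ˢ {0}ᶜ ×ˢ {0}ᶜ)) :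
    ∃ x v v', v ≠ 0 ∧ v' ≠ 0 ∧ ∀ y ∈ s, ∀ w w', w ≠ 0 → w' ≠ 0 → q x v v' ≤ q y w w' := by
  have hsub : s ×ˢ Metric.sphere (0 : F) 1 ×ˢ Metric.sphere (0 : F') 1 ⊆
      (e.baseSet ∩ e'.baseSet) ×ˢ {0}ᶜ ×ˢ {0}ᶜ := fun p hp ↦
    ⟨hse hp.1, ne_zero_of_mem_unit_sphere ⟨_, hp.2.1⟩, ne_zero_of_mem_unit_sphere ⟨_, hp.2.2⟩⟩
  have hsphere : (Metric.sphere (0 : F) 1 ×ˢ Metric.sphere (0 : F') 1).Nonempty :=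
    (NormedSpace.sphere_nonempty.2 zero_le_one).prod (NormedSpace.sphere_nonempty.2 zero_le_one)
  obtain ⟨p, hp, hmin⟩ := (hs.prod ((isCompact_sphere (0 : F) 1).prod
    (isCompact_sphere (0 : F') 1))).exists_isMinOn (hs_nonempty.prod hsphere) (hcont.mono hsub)
  refine ⟨p.1, e.symm p.1 p.2.1, e'.symm p.1 p.2.2,
    trivialization_symm_ne_zero e (hsub hp).1.1 (hsub hp).2.1,
    trivialization_symm_ne_zero e' (hsub hp).1.2 (hsub hp).2.2, fun y hy v v' hv hv' ↦ ?_⟩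
  obtain ⟨a, ha, w, hw, rfl⟩ := exists_unit_smul_trivialization_symm_eq e (hse hy).1 hv
  obtain ⟨b, hb, w', hw', rfl⟩ := exists_unit_smul_trivialization_symm_eq e' (hse hy).2 hv'
  rw [hq _ _ _ _ _ (right_ne_zero_of_smul hv) (right_ne_zero_of_smul hv') ha hb]
  exact hmin (mk_mem_prod hy (mk_mem_prod hw hw'))

theorem exists_forall_le_of_smul_invariant [CompactSpace B] [LocallyCompactSpace B] [Nonempty B]
    (hq : ∀ x v v' (a b : ℝ), v ≠ 0 → v' ≠ 0 → 0 < a → 0 < b → q x (a • v) (b • v') = q x v v')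
    (hcont : ∀ x₀, ContinuousOn
      (fun p : B × F × F' ↦ q p.1 ((trivializationAt F V x₀).symm p.1 p.2.1)
        ((trivializationAt F' V' x₀).symm p.1 p.2.2))
      (((trivializationAt F V x₀).baseSet ∩ (trivializationAt F' V' x₀).baseSet) ×ˢ
        {0}ᶜ ×ˢ {0}ᶜ)) :
    ∃ x v v', v ≠ 0 ∧ v' ≠ 0 ∧ ∀ y w w', w ≠ 0 → w' ≠ 0 → q x v v' ≤ q y w w' := by
  have hnhds (x₀ : B) : (trivializationAt F V x₀).baseSet ∩ (trivializationAt F' V' x₀).baseSet ∈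
      𝓝 x₀ := inter_mem
    ((trivializationAt F V x₀).open_baseSet.mem_nhds (mem_baseSet_trivializationAt F V x₀))
    ((trivializationAt F' V' x₀).open_baseSet.mem_nhds (mem_baseSet_trivializationAt F' V' x₀))
  choose s hs_nhds hsub hs using fun x₀ ↦ local_compact_nhds (hnhds x₀)
  choose x v v' hv hv' hle using fun x₀ ↦ exists_forall_le_of_smul_invariant_of_isCompact (hs x₀)
    ⟨x₀, mem_of_mem_nhds (hs_nhds x₀)⟩ (hsub x₀) hq (hcont x₀)
  obtain ⟨t, ht⟩ := CompactSpace.elim_nhds_subcover s hs_nhds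
  have hcover (y : B) : ∃ z ∈ t, y ∈ s z := by
    simpa only [mem_iUnion, exists_prop] using ht.ge (mem_univ y)
  obtain ⟨z, _, hzmin⟩ := t.exists_min_image (fun z ↦ q (x z) (v z) (v' z))
    ((hcover (Classical.arbitrary B)).imp fun _ h ↦ h.1)
  refine ⟨x z, v z, v' z, hv z, hv' z, fun y w w' hw hw' ↦ ?_⟩
  obtain ⟨z', hz', hy⟩ := hcover y
  exact (hzmin z' hz').trans (hle z' y hy w w' hw hw')

end RescalingInvariance

section HorizontalSlope

variable
  {EB : Type*} [NormedAddCommGroup EB] [NormedSpace ℝ EB]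
  {H : Type*} [TopologicalSpace H] {I : ModelWithCorners ℝ EB H}
  {M : Type*} [TopologicalSpace M] [ChartedSpace H M] [IsManifold I ∞ M]
  {F : Type*} [NormedAddCommGroup F] [NormedSpace ℝ F]
  {V : M → Type*} [TopologicalSpace (TotalSpace F V)]
  [∀ x, NormedAddCommGroup (V x)] [∀ x, InnerProductSpace ℝ (V x)]
  [FiberBundle F V] [VectorBundle ℝ F V] [ContMDiffVectorBundle ∞ F V I]
  {f : TotalSpace F V → ℝ} {x₀ : M}
  {e : Trivialization F (TotalSpace.proj : TotalSpace F V → M)} [MemTrivializationAtlas e]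

theorem contDiffOn_comp_bundleChartSymm
    (hf : ContMDiffOn (I.prod 𝓘(ℝ, F)) 𝓘(ℝ, ℝ) ∞ f (puncturedBundle F V)) :
    ContDiffOn ℝ ∞ (f ∘ bundleChartSymm I x₀ e) (bundleChartTarget I x₀ e ×ˢ {0}ᶜ) :=
  (hf.comp (contMDiffOn_bundleChartSymm.mono (prod_mono_right (subset_univ _)))
    fun _ hp ↦ trivialization_symm_ne_zero e hp.1.2 hp.2).contDiffOn

variable [FiniteDimensional ℝ EB] [I.Boundaryless] [T2Space M] [FiniteDimensional ℝ F]
  {D : CovariantDerivative I F V}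

theorem contDiffOn_connForm_extChartAt_symm (hD : D.ContMDiffCovariantDerivative ∞) :
    ContDiffOn ℝ ∞ (fun p : EB × EB ↦ connForm e D ((extChartAt I x₀).symm p.1)
      ((trivializationAt EB (TangentSpace I) x₀).symmL ℝ _ p.2))
      (bundleChartTarget I x₀ e ×ˢ univ) := by
  refine contDiffOn_connForm (n := ⊤) e hD (isOpen_bundleChartTarget.prod isOpen_univ)
    (fun p hp ↦ hp.1.2) ?_
  refine ((contMDiffOn_bundleChartSymm (e := trivializationAt EB (TangentSpace I) x₀)
    (I := I) (x₀ := x₀)).mono (prod_mono_left ?_)).congr fun p hp ↦ ?_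
  · exact fun y hy ↦ ⟨hy.1, extChartAt_symm_mem_source hy.1⟩
  · rw [Trivialization.symmL_apply (R := ℝ) _ (extChartAt_symm_mem_source hp.1.1)]
    rfl

variable [IsContMDiffRiemannianBundle I ∞ F V]

theorem continuousOn_horDeriv_bundleChartSymm (hD : D.ContMDiffCovariantDerivative ∞)
    (hf : ContMDiffOn (I.prod 𝓘(ℝ, F)) 𝓘(ℝ, ℝ) ∞ f (puncturedBundle F V)) :
    ContinuousOn (fun p : EB × F × EB ↦ horDeriv D f (bundleChartSymm I x₀ e (p.1, p.2.1))
        ((trivializationAt EB (TangentSpace I) x₀).symmL ℝ ((extChartAt I x₀).symm p.1) p.2.2))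
      (bundleChartTarget I x₀ e ×ˢ {0}ᶜ ×ˢ univ) := by
  have hsmooth := contDiffOn_comp_bundleChartSymm (x₀ := x₀) (e := e) hf
  have hderiv := hsmooth.continuousOn_fderiv_of_isOpen
    (isOpen_bundleChartTarget.prod isOpen_compl_singleton) (by simp)
  have hform := (contDiffOn_connForm_extChartAt_symm (x₀ := x₀) (e := e) hD).continuousOn
  have hw : ContinuousOn (fun p : EB × F × EB ↦ p.2.1)
    (bundleChartTarget I x₀ e ×ˢ {0}ᶜ ×ˢ univ) := by fun_prop
  have hk : ContinuousOn (fun p : EB × F × EB ↦ p.2.2)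
    (bundleChartTarget I x₀ e ×ˢ {0}ᶜ ×ˢ univ) := by fun_prop
  have hyw := hderiv.comp (continuousOn_fst.prodMk hw) fun p hp ↦ ⟨hp.1, hp.2.1⟩
  have hyk := hform.comp (continuousOn_fst.prodMk hk) fun p hp ↦ ⟨hp.1, mem_univ _⟩
  refine (hyw.clm_apply (hk.prodMk (hyk.clm_apply hw).neg)).congr fun p hp ↦ ?_
  refine horDeriv_bundleChartSymm D (p := (p.1, p.2.1)) hp.1 ?_ p.2.2
  exact (hf.contMDiffAt ((isOpen_puncturedBundle I).mem_nhds
    (trivialization_symm_ne_zero e hp.1.2 hp.2.1))).mdifferentiableAt (by simp)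

theorem continuousOn_horDeriv_trivialization_symm (hD : D.ContMDiffCovariantDerivative ∞)
    (hf : ContMDiffOn (I.prod 𝓘(ℝ, F)) 𝓘(ℝ, ℝ) ∞ f (puncturedBundle F V)) :
    ContinuousOn (fun p : M × F × EB ↦ horDeriv D f ⟨p.1, e.symm p.1 p.2.1⟩
        ((trivializationAt EB (TangentSpace I) x₀).symm p.1 p.2.2))
      ((e.baseSet ∩ (chartAt H x₀).source) ×ˢ {0}ᶜ ×ˢ univ) := by
  have hφ : ContinuousOn (fun p : M × F × EB ↦ (extChartAt I x₀ p.1, p.2))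
      ((e.baseSet ∩ (chartAt H x₀).source) ×ˢ {0}ᶜ ×ˢ univ) :=
    ((continuousOn_extChartAt x₀).comp continuousOn_fst fun p hp ↦ by
      rw [extChartAt_source]; exact hp.1.2).prodMk continuousOn_snd
  have hleft (p : M × F × EB) (hp : p.1 ∈ (chartAt H x₀).source) :
      (extChartAt I x₀).symm (extChartAt I x₀ p.1) = p.1 :=
    (extChartAt I x₀).left_inv (by rwa [extChartAt_source])
  refine ((continuousOn_horDeriv_bundleChartSymm (x₀ := x₀) (e := e) hD hf).comp hφ
    fun p hp ↦ ⟨⟨?_, ?_⟩, hp.2⟩).congr fun p hp ↦ ?_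
  · exact (extChartAt I x₀).map_source (by rw [extChartAt_source]; exact hp.1.2)
  · rw [mem_preimage, hleft p hp.1.2]
    exact hp.1.1
  · rw [← Trivialization.symmL_apply (R := ℝ) (trivializationAt EB (TangentSpace I) x₀) hp.1.2]
    exact congrArg (fun x ↦ horDeriv D f ⟨x, e.symm x p.2.1⟩
      ((trivializationAt EB (TangentSpace I) x₀).symmL ℝ x p.2.2)) (hleft p hp.1.2).symm

theorem horDeriv_smul (hD : D.ContMDiffCovariantDerivative ∞) (hDm : D.IsMetricCompatible)
    (hf : IsRadiallyConstantSmooth I f) {a : ℝ} (ha : 0 < a) {x : M} {v : V x} (hv : v ≠ 0)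
    (h : TangentSpace I x) : horDeriv D f ⟨x, a • v⟩ h = horDeriv D f ⟨x, v⟩ h := by
  refine forall_of_isParallelTransport hD (p := fun x v h ↦ v ≠ 0 →
    horDeriv D f ⟨x, a • v⟩ h = horDeriv D f ⟨x, v⟩ h) (fun γ ε P hP v hv ↦ ?_) x v h hv
  have hderiv (w : V (γ 0)) (hw : w ≠ 0) := hP.hasDerivAt_comp_zero w
    (hf.mdifferentiableAt (ξ := ⟨γ 0, w⟩) hw)
  refine (hderiv (a • v) (smul_ne_zero ha.ne' hv)).unique
    ((hderiv v hv).congr_of_eventuallyEq ?_)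
  filter_upwards [Ioo_mem_nhds hP.zero_mem.1 hP.zero_mem.2] with t ht
  rw [map_smul]
  exact hf.radial _ _ _ (hP.map_ne_zero hDm hv ht) ha

variable [RiemannianBundle (fun x : M ↦ TangentSpace I x)]

/-- The horizontal derivative of `f` per unit length, plus a multiple of `f`. -/
noncomputable def horSlope (D : CovariantDerivative I F V) (f : TotalSpace F V → ℝ) (δ : ℝ) (x : M)
    (v : V x) (h : TangentSpace I x) : ℝ :=
  horDeriv D f ⟨x, v⟩ h / ‖h‖ + δ * f ⟨x, v⟩

theorem horSlope_smul_smul (hD : D.ContMDiffCovariantDerivative ∞) (hDm : D.IsMetricCompatible)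
    (hf : IsRadiallyConstantSmooth I f) (δ : ℝ) {a b : ℝ} (ha : 0 < a) (hb : 0 < b) {x : M}
    {v : V x} (hv : v ≠ 0) (h : TangentSpace I x) :
    horSlope D f δ x (a • v) (b • h) = horSlope D f δ x v h := by
  rw [horSlope, horSlope, hf.radial x v a hv ha, horDeriv_smul hD hDm hf ha hv, norm_smul,
    Real.norm_of_nonneg hb.le, map_smul, smul_eq_mul, mul_div_mul_left _ _ hb.ne']

variable [IsContinuousRiemannianBundle EB (fun x : M ↦ TangentSpace I x)]

theorem continuousOn_horSlope_trivialization_symm (hD : D.ContMDiffCovariantDerivative ∞)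
    (hf : ContMDiffOn (I.prod 𝓘(ℝ, F)) 𝓘(ℝ, ℝ) ∞ f (puncturedBundle F V)) (δ : ℝ) :
    ContinuousOn (fun p : M × F × EB ↦ horSlope D f δ p.1 (e.symm p.1 p.2.1)
        ((trivializationAt EB (TangentSpace I) x₀).symm p.1 p.2.2))
      ((e.baseSet ∩ (chartAt H x₀).source) ×ˢ {0}ᶜ ×ˢ {0}ᶜ) := by
  have hderiv := (continuousOn_horDeriv_trivialization_symm (x₀ := x₀) (e := e) hD hf).mono
    (prod_mono_right (prod_mono_right (subset_univ {0}ᶜ)))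
  have hx : ContinuousOn (fun p : M × F × EB ↦ p.1)
    ((e.baseSet ∩ (chartAt H x₀).source) ×ˢ {0}ᶜ ×ˢ {0}ᶜ) := by fun_prop
  have hw : ContinuousOn (fun p : M × F × EB ↦ p.2.1)
    ((e.baseSet ∩ (chartAt H x₀).source) ×ˢ {0}ᶜ ×ˢ {0}ᶜ) := by fun_prop
  have hk : ContinuousOn (fun p : M × F × EB ↦ p.2.2)
    ((e.baseSet ∩ (chartAt H x₀).source) ×ˢ {0}ᶜ ×ˢ {0}ᶜ) := by fun_prop
  have htangent := (trivializationAt EB (TangentSpace I) x₀).continuousOn_symm.comp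
    (hx.prodMk hk) fun p hp ↦ ⟨hp.1.2, mem_univ _⟩
  have hfibre := hf.continuousOn.comp (e.continuousOn_symm.comp (hx.prodMk hw)
    fun p hp ↦ ⟨hp.1.1, mem_univ _⟩) fun p hp ↦ trivialization_symm_ne_zero e hp.1.1 hp.2.1
  have hnorm : ContinuousOn (fun p : M × F × EB ↦
      ‖(trivializationAt EB (TangentSpace I) x₀).symm p.1 p.2.2‖)
      ((e.baseSet ∩ (chartAt H x₀).source) ×ˢ {0}ᶜ ×ˢ {0}ᶜ) :=
    (ContinuousOn.inner_bundle htangent htangent).sqrt.congr fun p _ ↦ norm_eq_sqrt_real_inner _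
  exact (hderiv.div hnorm fun p hp ↦ norm_ne_zero_iff.2
    (trivialization_symm_ne_zero _ hp.1.2 hp.2.2)).add (continuousOn_const.mul hfibre)

theorem exists_forall_horSlope_le [CompactSpace M] [Nonempty M] [Nontrivial EB] [Nontrivial F]
    (hD : D.ContMDiffCovariantDerivative ∞) (hDm : D.IsMetricCompatible)
    (hf : IsRadiallyConstantSmooth I f) (δ : ℝ) :
    ∃ (x : M) (v : V x) (h : TangentSpace I x), v ≠ 0 ∧ h ≠ 0 ∧
      ∀ (y : M) (w : V y) (k : TangentSpace I y), w ≠ 0 → k ≠ 0 →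
        horSlope D f δ x v h ≤ horSlope D f δ y w k :=
  exists_forall_le_of_smul_invariant
    (fun _ _ h _ _ hv _ ha hb ↦ horSlope_smul_smul hD hDm hf δ ha hb hv h)
    fun _ ↦ continuousOn_horSlope_trivialization_symm hD hf.smooth δ

end HorizontalSlope

section RadiusConcavity

variable
  {EB : Type*} [NormedAddCommGroup EB] [NormedSpace ℝ EB]
  {H : Type*} [TopologicalSpace H] {I : ModelWithCorners ℝ EB H}
  {M : Type*} [TopologicalSpace M] [ChartedSpace H M]
  {F : Type*} [NormedAddCommGroup F] [NormedSpace ℝ F]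
  {V : M → Type*} [TopologicalSpace (TotalSpace F V)]
  [∀ x, NormedAddCommGroup (V x)] [∀ x, InnerProductSpace ℝ (V x)]
  [FiberBundle F V] [VectorBundle ℝ F V] [ContMDiffVectorBundle ∞ F V I]
  {D : CovariantDerivative I F V} {γ : ℝ → M} {ε : ℝ} {P : ∀ t, V (γ 0) →ₗ[ℝ] V (γ t)}

theorem contMDiffAt_smul_along {σ : ∀ s, V (γ s)} {g : ℝ → ℝ} {t : ℝ}
    (hσ : ContMDiffAt 𝓘(ℝ, ℝ) (I.prod 𝓘(ℝ, F)) ∞ (fun s ↦ (⟨γ s, σ s⟩ : TotalSpace F V)) t)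
    (hg : ContDiffAt ℝ ∞ g t) :
    ContMDiffAt 𝓘(ℝ, ℝ) (I.prod 𝓘(ℝ, F)) ∞ (fun s ↦ (⟨γ s, g s • σ s⟩ : TotalSpace F V)) t := by
  set e := trivializationAt F V (γ t)
  have ht : γ t ∈ e.baseSet := mem_baseSet_trivializationAt F V (γ t)
  obtain ⟨hγ, hσe⟩ := (e.contMDiffAt_iff (f := fun s ↦ (⟨γ s, σ s⟩ : TotalSpace F V))
    (e.mem_source.2 ht)).1 hσ
  refine (e.contMDiffAt_iff (f := fun s ↦ (⟨γ s, g s • σ s⟩ : TotalSpace F V))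
    (e.mem_source.2 ht)).2 ⟨hγ, ?_⟩
  refine (hg.smul hσe.contDiffAt).contMDiffAt.congr_of_eventuallyEq ?_
  filter_upwards [hγ.continuousAt.preimage_mem_nhds (e.open_baseSet.mem_nhds ht)] with s hs
  exact (e.linear ℝ hs).map_smul _ _

namespace IsParallelTransport

variable (hP : IsParallelTransport D γ ε P) (v : V (γ 0)) {g : ℝ → ℝ}
  (hg : ContDiffOn ℝ ∞ g (Ioo (-ε) ε)) {t : ℝ} (ht : t ∈ Ioo (-ε) ε)
include hP hg ht

theorem contMDiffAt_smul_apply :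
    ContMDiffAt 𝓘(ℝ, ℝ) (I.prod 𝓘(ℝ, F)) ∞
      (fun s ↦ (⟨γ s, g s • P s v⟩ : TotalSpace F V)) t :=
  contMDiffAt_smul_along ((hP.contMDiffOn v).contMDiffAt (isOpen_Ioo.mem_nhds ht))
    (hg.contDiffAt (isOpen_Ioo.mem_nhds ht))

theorem covDerivAlong_horPart_velocity_smul_apply [FiniteDimensional ℝ EB] [IsManifold I ∞ M]
    (LC : CovariantDerivative I EB (fun x : M ↦ TangentSpace I x)) :
    covDerivAlong LC (fun s ↦ (⟨γ s, horPart _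
      (velocity I (fun s ↦ (⟨γ s, g s • P s v⟩ : TotalSpace F V)) s)⟩ : TangentBundle I M)) t =
      covDerivAlong LC (fun s ↦ (⟨γ s, curveVelocity I γ s⟩ : TangentBundle I M)) t := by
  refine (covDerivAlong_congr LC (τ := fun s ↦ horPart _ (velocity I
    (fun s ↦ (⟨γ s, g s • P s v⟩ : TotalSpace F V)) s))
    (hP.mdifferentiableAt_curveVelocity ht) ?_).symm
  filter_upwards [isOpen_Ioo.mem_nhds ht] with s hs
  exact (horPart_velocity ((hP.contMDiffAt_smul_apply v hg hs).mdifferentiableAt (by simp))).symm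

variable [FiniteDimensional ℝ F]

theorem covDerivAlong_smul_apply :
    covDerivAlong D (fun s ↦ (⟨γ s, g s • P s v⟩ : TotalSpace F V)) t = deriv g t • P t v := by
  have hgt := (hg.contDiffAt (isOpen_Ioo.mem_nhds ht)).differentiableAt (by simp)
  rw [covDerivAlong_smul D (hP.mdifferentiableAt v ht) hgt, hP.covDerivAlong_eq_zero v t ht,
    smul_zero, add_zero]

theorem covDerivAlong_covDerivAlong_smul_apply :
    covDerivAlong D (fun s ↦ (⟨γ s,
      covDerivAlong D (fun s ↦ (⟨γ s, g s • P s v⟩ : TotalSpace F V)) s⟩ : TotalSpace F V)) t =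
      deriv (deriv g) t • P t v := by
  have hg' : ContDiffOn ℝ ∞ (deriv g) (Ioo (-ε) ε) := hg.deriv_of_isOpen isOpen_Ioo (by simp)
  have hmdiff := (hP.contMDiffAt_smul_apply v hg' ht).mdifferentiableAt (by simp)
  rw [← hP.covDerivAlong_smul_apply v hg' ht]
  refine (covDerivAlong_congr D hmdiff ?_).symm
  filter_upwards [isOpen_Ioo.mem_nhds ht] with s hs using (hP.covDerivAlong_smul_apply v hg hs).symm

end IsParallelTransport

variable [FiniteDimensional ℝ F] [IsContMDiffRiemannianBundle I ∞ F V]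

theorem IsParallelTransport.contDiffOn_comp (hP : IsParallelTransport D γ ε P)
    (hDm : D.IsMetricCompatible) {f : TotalSpace F V → ℝ} (hf : IsRadiallyConstantSmooth I f)
    {v : V (γ 0)} (hv : v ≠ 0) :
    ContDiffOn ℝ ∞ (fun t ↦ f ⟨γ t, P t v⟩) (Ioo (-ε) ε) :=
  (hf.smooth.comp (hP.contMDiffOn v) fun _ ht ↦ hP.map_ne_zero hDm hv ht).contDiffOn

variable [FiniteDimensional ℝ EB] [IsManifold I ∞ M]
  [RiemannianBundle (fun x : M ↦ TangentSpace I x)]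
  {LC : CovariantDerivative I EB (fun x : M ↦ TangentSpace I x)} {u : TotalSpace F V → ℝ}

theorem deriv_deriv_nonpos_of_smul_apply_mem_radialGraph (hu : IsRadiallyConstantSmooth I u)
    (hconv : IsConvexHypersurface LC D (radialGraph u)) (hP : IsParallelTransport D γ ε P)
    (hacc : covDerivAlong LC (fun s ↦ (⟨γ s, curveVelocity I γ s⟩ : TangentBundle I M)) 0 = 0)
    (v : V (γ 0)) {g : ℝ → ℝ} (hg : ContDiffOn ℝ ∞ g (Ioo (-ε) ε)) (hg0 : 0 < g 0)
    (hmem : ∀ t ∈ Ioo (-ε) ε, (⟨γ t, g t • P t v⟩ : TotalSpace F V) ∈ radialGraph u) :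
    deriv (deriv g) 0 ≤ 0 := by
  set c : ℝ → TotalSpace F V := fun t ↦ ⟨γ t, g t • P t v⟩
  have hc : IsCurveIn I (radialGraph u) c := by
    refine ⟨hP.contMDiffAt_smul_apply v hg hP.zero_mem, ?_⟩
    filter_upwards [isOpen_Ioo.mem_nhds hP.zero_mem] with t ht using hmem t ht
  obtain ⟨N, hN⟩ := exists_isOutwardUnitNormal D hu hc.mem.self_of_nhds
  have hII : 0 ≤ -(inner ℝ (covDerivAlong LC
      (fun s ↦ (⟨γ s, horPart (c s) (velocity I c s)⟩ : TangentBundle I M)) 0) (horPart (c 0) N) +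
    inner ℝ (covDerivAlong D (fun s ↦ (⟨γ s, covDerivAlong D c s⟩ : TotalSpace F V)) 0)
      (connector D (c 0) N)) := hconv c hc N hN
  rw [hP.covDerivAlong_horPart_velocity_smul_apply v hg hP.zero_mem LC, hacc,
    hP.covDerivAlong_covDerivAlong_smul_apply v hg hP.zero_mem, inner_zero_left, zero_add,
    real_inner_smul_left] at hII
  have hout : 0 < inner ℝ (connector D (c 0) N) (g 0 • P 0 v) := hN.outward
  rw [real_inner_smul_right, real_inner_comm] at hout
  exact nonpos_of_mul_nonpos_left (neg_nonneg.1 hII) ((mul_pos_iff_of_pos_left hg0).1 hout)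

theorem deriv_deriv_exp_comp_nonpos (hu : IsRadiallyConstantSmooth I u)
    (hconv : IsConvexHypersurface LC D (radialGraph u)) (hDm : D.IsMetricCompatible)
    (hP : IsParallelTransport D γ ε P)
    (hacc : covDerivAlong LC (fun s ↦ (⟨γ s, curveVelocity I γ s⟩ : TangentBundle I M)) 0 = 0)
    {v : V (γ 0)} (hv : v ≠ 0) : deriv (deriv fun t ↦ Real.exp (u ⟨γ t, P t v⟩)) 0 ≤ 0 := by
  have hpos : 0 < ‖v‖ := norm_pos_iff.2 hv
  have hradius := deriv_deriv_nonpos_of_smul_apply_mem_radialGraph hu hconv hP hacc v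
    (g := fun t ↦ Real.exp (u ⟨γ t, P t v⟩) / ‖v‖)
    ((hP.contDiffOn_comp hDm hu.exp hv).div_const _) (div_pos (Real.exp_pos _) hpos) fun t ht ↦ by
      rw [← hP.norm_map hDm v ht]
      exact smul_mem_radialGraph hu (hP.map_ne_zero hDm hv ht)
  have hderiv : (deriv fun t ↦ Real.exp (u ⟨γ t, P t v⟩) / ‖v‖) =
      fun t ↦ deriv (fun t ↦ Real.exp (u ⟨γ t, P t v⟩)) t / ‖v‖ :=
    funext fun _ ↦ deriv_div_const _
  rw [hderiv, deriv_div_const] at hradius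
  simpa only [div_mul_cancel₀ _ hpos.ne', zero_mul] using
    mul_le_mul_of_nonneg_right hradius hpos.le

end RadiusConcavity

section LocallyConstant

variable
  {EB : Type*} [NormedAddCommGroup EB] [NormedSpace ℝ EB]
  {H : Type*} [TopologicalSpace H] {I : ModelWithCorners ℝ EB H}
  {M : Type*} [TopologicalSpace M] [ChartedSpace H M] {α : Type*} {κ : M → α}
  (hκ : ∀ (γ : ℝ → M) (J : Set ℝ), IsOpen J → 0 ∈ J → ContMDiffOn 𝓘(ℝ, ℝ) I ∞ γ J →
    ∀ᶠ t in 𝓝 0, κ (γ t) = κ (γ 0))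
include hκ

theorem comp_curve_eq_of_eventually_eq {γ : ℝ → M} {J : Set ℝ} (hJ : IsOpen J)
    (hJc : IsPreconnected J) (hγ : ContMDiffOn 𝓘(ℝ, ℝ) I ∞ γ J) {s t : ℝ} (hs : s ∈ J)
    (ht : t ∈ J) : κ (γ s) = κ (γ t) := by
  have hloc : IsLocallyConstant fun s : J ↦ κ (γ s) := by
    refine (IsLocallyConstant.iff_eventually_eq _).2 fun a ↦ ?_
    have hshift : ContDiff ℝ ∞ fun s : ℝ ↦ a + s := by fun_prop
    have hnear := hκ (fun s ↦ γ (a + s)) ((fun s : ℝ ↦ a + s) ⁻¹' J)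
      (hJ.preimage hshift.continuous) (by simp)
      (hγ.comp hshift.contMDiff.contMDiffOn fun _ hs ↦ hs)
    have hsub : Tendsto (fun s : J ↦ (s : ℝ) - a) (𝓝 a) (𝓝 0) :=
      Continuous.tendsto' (by fun_prop) _ _ (sub_self _)
    filter_upwards [hsub.eventually hnear] with s hs
    simpa only [add_sub_cancel, add_zero] using hs
  have : PreconnectedSpace J := isPreconnected_iff_preconnectedSpace.1 hJc
  exact hloc.apply_eq_of_preconnectedSpace ⟨s, hs⟩ ⟨t, ht⟩

theorem isLocallyConstant_of_eventually_eq_along_curve [IsManifold I ∞ M] [I.Boundaryless] :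
    IsLocallyConstant κ := by
  refine (IsLocallyConstant.iff_eventually_eq _).2 fun x₀ ↦ ?_
  set φ := extChartAt I x₀
  obtain ⟨ρ, hρ, hρφ⟩ := Metric.mem_nhds_iff.1 (extChartAt_target_mem_nhds (I := I) x₀)
  filter_upwards [extChartAt_source_mem_nhds (I := I) x₀,
    (continuousAt_extChartAt (I := I) x₀).preimage_mem_nhds (Metric.ball_mem_nhds _ hρ)]
    with x hx hxρ
  let y : ℝ →ᵃ[ℝ] EB := AffineMap.lineMap (φ x₀) (φ x)
  have hy : ContDiff ℝ ∞ y := by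
    simp only [y, AffineMap.coe_lineMap, vsub_eq_sub, vadd_eq_add]
    fun_prop
  have h := comp_curve_eq_of_eventually_eq hκ (s := 1) (t := 0)
    (Metric.isOpen_ball.preimage hy.continuous)
    ((convex_ball (φ x₀) ρ).affine_preimage y).isPreconnected
    (contMDiffOn_extChartAt_symm_comp (x₀ := x₀) hy.contDiffOn fun _ ht ↦ hρφ ht)
    (by rwa [mem_preimage, AffineMap.lineMap_apply_one])
    (by simpa only [mem_preimage, y, AffineMap.lineMap_apply_zero] using Metric.mem_ball_self hρ)
  simp only [y, AffineMap.lineMap_apply_one, AffineMap.lineMap_apply_zero] at h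
  rwa [φ.left_inv hx, extChartAt_to_inv x₀] at h

end LocallyConstant

section MinimalSlope

theorem deriv_nonneg_of_isLocalMin_deriv_div_add {r n : ℝ → ℝ} {δ t : ℝ}
    (hr : DifferentiableAt ℝ r t) (hr' : DifferentiableAt ℝ (deriv r) t)
    (hr'' : deriv (deriv r) t ≤ 0) (hn : HasDerivAt n 0 t) (hpos : 0 < n t) (hδ : 0 < δ)
    (hmin : IsLocalMin (fun s ↦ deriv r s / n s + δ * r s) t) : 0 ≤ deriv r t := by
  have hcrit := hmin.hasDerivAt_eq_zero
    ((hr'.hasDerivAt.fun_div hn hpos.ne').fun_add (hr.hasDerivAt.const_mul δ))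
  have hconcave : (deriv (deriv r) t * n t - deriv r t * 0) / n t ^ 2 ≤ 0 := by
    rw [mul_zero, sub_zero]
    exact div_nonpos_of_nonpos_of_nonneg (mul_nonpos_of_nonpos_of_nonneg hr'' hpos.le)
      (sq_nonneg _)
  exact nonneg_of_mul_nonneg_right (by linarith) hδ

variable
  {EB : Type*} [NormedAddCommGroup EB] [NormedSpace ℝ EB] [FiniteDimensional ℝ EB]
  {H : Type*} [TopologicalSpace H] {I : ModelWithCorners ℝ EB H}
  {M : Type*} [TopologicalSpace M] [ChartedSpace H M] [IsManifold I ∞ M]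
  [RiemannianBundle (fun x : M ↦ TangentSpace I x)]
  [IsContMDiffRiemannianBundle I 1 EB (fun x : M ↦ TangentSpace I x)]
  {LC : CovariantDerivative I EB (fun x : M ↦ TangentSpace I x)}

theorem hasDerivAt_norm_curveVelocity
    (hLC : CovariantDerivative.IsMetricCompatible (V := fun x : M ↦ TangentSpace I x) LC)
    {γ : ℝ → M} {t : ℝ}
    (hvel : MDifferentiableAt 𝓘(ℝ, ℝ) (I.prod 𝓘(ℝ, EB))
      (fun s ↦ (⟨γ s, curveVelocity I γ s⟩ : TangentBundle I M)) t)
    (hacc : covDerivAlong LC (fun s ↦ (⟨γ s, curveVelocity I γ s⟩ : TangentBundle I M)) t = 0)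
    (hne : curveVelocity I γ t ≠ 0) : HasDerivAt (fun s ↦ ‖curveVelocity I γ s‖) 0 t := by
  have hsq := hasDerivAt_inner_along hLC hvel hvel
  rw [hacc, inner_zero_left, inner_zero_right, add_zero] at hsq
  have hsqrt := hsq.sqrt (inner_self_ne_zero.2 hne)
  rw [zero_div] at hsqrt
  exact hsqrt.congr_of_eventuallyEq (.of_forall fun _ ↦ norm_eq_sqrt_real_inner _)

end MinimalSlope

section ContinuousMetric

variable {EB : Type*} [NormedAddCommGroup EB] [NormedSpace ℝ EB]
  {H : Type*} [TopologicalSpace H] (I : ModelWithCorners ℝ EB H)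
  {M : Type*} [TopologicalSpace M] [ChartedSpace H M]
  (F : Type*) [NormedAddCommGroup F] [NormedSpace ℝ F]
  (V : M → Type*) [TopologicalSpace (TotalSpace F V)]
  [∀ x, NormedAddCommGroup (V x)] [∀ x, InnerProductSpace ℝ (V x)]
  [FiberBundle F V] [VectorBundle ℝ F V] {n : ℕ∞ω} [IsContMDiffRiemannianBundle I n F V]

include I n in
theorem isContinuousRiemannianBundle_of_isContMDiffRiemannianBundle :
    IsContinuousRiemannianBundle F V := by
  obtain ⟨g, hg, hinner⟩ := IsContMDiffRiemannianBundle.exists_contMDiff (IB := I) (n := n)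
    (F := F) (E := V)
  exact ⟨g, hg.continuous, hinner⟩

end ContinuousMetric

section HorizontallyConstantRadius

variable
  {EB : Type*} [NormedAddCommGroup EB] [NormedSpace ℝ EB] [FiniteDimensional ℝ EB]
  {H : Type*} [TopologicalSpace H] {I : ModelWithCorners ℝ EB H} [I.Boundaryless]
  {M : Type*} [TopologicalSpace M] [ChartedSpace H M] [IsManifold I ∞ M] [T2Space M]
  [RiemannianBundle (fun x : M ↦ TangentSpace I x)]
  [IsContMDiffRiemannianBundle I ∞ EB (fun x : M ↦ TangentSpace I x)]
  {F : Type*} [NormedAddCommGroup F] [NormedSpace ℝ F] [FiniteDimensional ℝ F]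
  {V : M → Type*} [TopologicalSpace (TotalSpace F V)]
  [∀ x, NormedAddCommGroup (V x)] [∀ x, InnerProductSpace ℝ (V x)]
  [FiberBundle F V] [VectorBundle ℝ F V] [ContMDiffVectorBundle ∞ F V I]
  [IsContMDiffRiemannianBundle I ∞ F V]
  {LC : CovariantDerivative I EB (fun x : M ↦ TangentSpace I x)}
  (hLC : CovariantDerivative.IsMetricCompatible (V := fun x : M ↦ TangentSpace I x) LC)
  {D : CovariantDerivative I F V} (hD : D.ContMDiffCovariantDerivative ∞)
  (hDm : D.IsMetricCompatible) {u : TotalSpace F V → ℝ} (hu : IsRadiallyConstantSmooth I u)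
  (hconv : IsConvexHypersurface LC D (radialGraph u))
include hLC hD hDm hu hconv

theorem horDeriv_nonneg_of_forall_horSlope_le {δ : ℝ} (hδ : 0 < δ) {x : M} {v : V x}
    {h : TangentSpace I x} (hv : v ≠ 0) (hh : h ≠ 0)
    (hmin : ∀ (y : M) (w : V y) (k : TangentSpace I y), w ≠ 0 → k ≠ 0 →
      horSlope D (fun η ↦ Real.exp (u η)) δ x v h ≤
        horSlope D (fun η ↦ Real.exp (u η)) δ y w k) :
    0 ≤ horDeriv D (fun η ↦ Real.exp (u η)) ⟨x, v⟩ h := by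
  refine forall_of_isParallelTransport_of_covDerivAlong_eq_zero hD LC
    (p := fun x v h ↦ v ≠ 0 → h ≠ 0 → (∀ (y : M) (w : V y) (k : TangentSpace I y),
      w ≠ 0 → k ≠ 0 → horSlope D (fun η ↦ Real.exp (u η)) δ x v h ≤
        horSlope D (fun η ↦ Real.exp (u η)) δ y w k) →
      0 ≤ horDeriv D (fun η ↦ Real.exp (u η)) ⟨x, v⟩ h) ?_ x v h hv hh hmin
  intro γ ε P hP hacc v hv hh hmin
  have hnear : Ioo (-ε) ε ∈ 𝓝 0 := isOpen_Ioo.mem_nhds hP.zero_mem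
  set r : ℝ → ℝ := fun t ↦ Real.exp (u ⟨γ t, P t v⟩)
  have hr : ContDiffOn ℝ ∞ r (Ioo (-ε) ε) := hP.contDiffOn_comp hDm hu.exp hv
  have hr' : ContDiffOn ℝ ∞ (deriv r) (Ioo (-ε) ε) := hr.deriv_of_isOpen isOpen_Ioo (by simp)
  have hderiv (t) (ht : t ∈ Ioo (-ε) ε) : deriv r t =
      horDeriv D (fun η ↦ Real.exp (u η)) ⟨γ t, P t v⟩ (curveVelocity I γ t) :=
    (hP.hasDerivAt_comp v ht (hu.exp.mdifferentiableAt (hP.map_ne_zero hDm hv ht))).deriv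
  have hspeed := hasDerivAt_norm_curveVelocity hLC
    (hP.mdifferentiableAt_curveVelocity hP.zero_mem) hacc hh
  have hspeed_pos : 0 < ‖curveVelocity I γ 0‖ := norm_pos_iff.2 hh
  have hlocal : IsLocalMin (fun t ↦ deriv r t / ‖curveVelocity I γ t‖ + δ * r t) 0 := by
    filter_upwards [hnear, hspeed.continuousAt.eventually_ne hspeed_pos.ne'] with t ht hne
    rw [hderiv t ht, hderiv 0 hP.zero_mem]
    change horSlope D (fun η ↦ Real.exp (u η)) δ (γ 0) (P 0 v) _ ≤ _
    rw [hP.apply_zero]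
    exact hmin _ _ _ (hP.map_ne_zero hDm hv ht) (norm_ne_zero_iff.1 hne)
  have hnonneg := deriv_nonneg_of_isLocalMin_deriv_div_add
    ((hr.contDiffAt hnear).differentiableAt (by simp))
    ((hr'.contDiffAt hnear).differentiableAt (by simp))
    (deriv_deriv_exp_comp_nonpos hu hconv hDm hP hacc hv) hspeed hspeed_pos hδ hlocal
  rwa [hderiv 0 hP.zero_mem, hP.apply_zero] at hnonneg

variable [CompactSpace M]

theorem horDeriv_nonneg_of_convex {x : M} {v : V x} (hv : v ≠ 0) (h : TangentSpace I x) :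
    0 ≤ horDeriv D (fun η ↦ Real.exp (u η)) ⟨x, v⟩ h := by
  by_contra! hneg
  have hh : h ≠ 0 := by
    rintro rfl
    exact hneg.ne (map_zero _)
  have : Nonempty M := ⟨x⟩
  have : Nontrivial EB := ⟨h, 0, hh⟩
  have : Nontrivial (V x) := ⟨v, 0, hv⟩
  have : Nontrivial F := (fibreEquiv F V x).injective.nontrivial
  have := isContinuousRiemannianBundle_of_isContMDiffRiemannianBundle (n := ∞) I EB
    (fun x : M ↦ TangentSpace I x)
  set f : TotalSpace F V → ℝ := fun η ↦ Real.exp (u η)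
  have hfpos (η) : 0 < f η := Real.exp_pos _
  set s := horDeriv D f ⟨x, v⟩ h / ‖h‖
  have hs : s < 0 := div_neg_of_neg_of_pos hneg (norm_pos_iff.2 hh)
  -- With this `δ` the slope at `(x, v, h)`, hence its minimum, is still negative.
  set δ := -s / (2 * f ⟨x, v⟩)
  have hδ : 0 < δ := div_pos (neg_pos.2 hs) (mul_pos two_pos (hfpos _))
  obtain ⟨y, w, k, hw, hk, hmin⟩ := exists_forall_horSlope_le hD hDm hu.exp δ
  have hslope : horSlope D f δ y w k < 0 := by
    refine (hmin x v h hv hh).trans_lt ?_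
    have hδf : δ * f ⟨x, v⟩ = -s / 2 := by
      have := (hfpos ⟨x, v⟩).ne'
      simp only [δ]
      field_simp
    change s + δ * f ⟨x, v⟩ < 0
    linarith
  have hnonneg : 0 ≤ horDeriv D f ⟨y, w⟩ k :=
    horDeriv_nonneg_of_forall_horSlope_le hLC hD hDm hu hconv hδ hw hk hmin
  exact hslope.not_ge
    (add_nonneg (div_nonneg hnonneg (norm_nonneg _)) (mul_pos hδ (hfpos _)).le)

theorem horDeriv_eq_zero_of_convex {x : M} {v : V x} (hv : v ≠ 0) (h : TangentSpace I x) :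
    horDeriv D (fun η ↦ Real.exp (u η)) ⟨x, v⟩ h = 0 := by
  have hneg := horDeriv_nonneg_of_convex hLC hD hDm hu hconv hv (-h)
  rw [map_neg, neg_nonneg] at hneg
  exact hneg.antisymm (horDeriv_nonneg_of_convex hLC hD hDm hu hconv hv h)

end HorizontallyConstantRadius

section CurvatureTransport

variable
  {EB : Type*} [NormedAddCommGroup EB] [NormedSpace ℝ EB] [FiniteDimensional ℝ EB]
  {H : Type*} [TopologicalSpace H] {I : ModelWithCorners ℝ EB H}
  {M : Type*} [TopologicalSpace M] [ChartedSpace H M]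
  {F : Type*} [NormedAddCommGroup F] [NormedSpace ℝ F] [FiniteDimensional ℝ F]
  {V : M → Type*} [TopologicalSpace (TotalSpace F V)]
  [∀ x, NormedAddCommGroup (V x)] [∀ x, InnerProductSpace ℝ (V x)]
  [FiberBundle F V] [VectorBundle ℝ F V] [ContMDiffVectorBundle ∞ F V I]
  [IsContMDiffRiemannianBundle I ∞ F V]
  {D : CovariantDerivative I F V} (hDm : D.IsMetricCompatible)
  {u K : TotalSpace F V → ℝ} (hu : IsRadiallyConstantSmooth I u)
  (hzero : ∀ (x : M) (v : V x) (h : TangentSpace I x), v ≠ 0 →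
    horDeriv D (fun η ↦ Real.exp (u η)) ⟨x, v⟩ h = 0)
  {γ : ℝ → M} {ε : ℝ} {P : ∀ t, V (γ 0) →ₗ[ℝ] V (γ t)} (hP : IsParallelTransport D γ ε P)
  {v : V (γ 0)} (hv : v ≠ 0) {t : ℝ} (ht : t ∈ Ioo (-ε) ε)
include hDm hu hzero hP hv ht

theorem IsParallelTransport.apply_eq_of_horDeriv_eq_zero : u ⟨γ t, P t v⟩ = u ⟨γ 0, v⟩ := by
  have hderiv (s) (hs : s ∈ Ioo (-ε) ε) :
      HasDerivAt (fun s ↦ Real.exp (u ⟨γ s, P s v⟩)) 0 s := by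
    have hne := hP.map_ne_zero hDm hv hs
    exact (hP.hasDerivAt_comp v hs (hu.exp.mdifferentiableAt hne)).congr_deriv
      (hzero _ _ _ hne)
  have hconst := isOpen_Ioo.is_const_of_deriv_eq_zero isPreconnected_Ioo
    (fun s hs ↦ (hderiv s hs).differentiableAt.differentiableWithinAt)
    (fun s hs ↦ (hderiv s hs).deriv) ht hP.zero_mem
  rw [hP.apply_zero] at hconst
  exact Real.exp_injective hconst

theorem IsParallelTransport.curvature_eq_of_horDeriv_eq_zero
    (hK : HasVerticalGaussianCurvature (radialGraph u) K)
    (hK_fibre : ∀ (x : M) (v w : V x), v ≠ 0 → w ≠ 0 → K ⟨x, v⟩ = K ⟨x, w⟩) :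
    K ⟨γ t, P t v⟩ = K ⟨γ 0, v⟩ := by
  have := finiteDimensional_fibre F (V := V) (γ 0)
  have := finiteDimensional_fibre F (V := V) (γ t)
  let Φ : V (γ 0) ≃ₗᵢ[ℝ] V (γ t) :=
    LinearIsometry.toLinearIsometryEquiv ⟨P t, fun v ↦ hP.norm_map hDm v ht⟩
      ((finrank_fibre F (γ 0)).trans (finrank_fibre F (γ t)).symm)
  have hmem (w : V (γ 0)) : (⟨γ t, Φ w⟩ : TotalSpace F V) ∈ radialGraph u ↔
      (⟨γ 0, w⟩ : TotalSpace F V) ∈ radialGraph u := by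
    rw [mem_radialGraph_iff hu, mem_radialGraph_iff hu, Φ.norm_map, map_ne_zero_iff _ Φ.injective]
    refine and_congr_right fun hw ↦ ?_
    rw [← hP.apply_eq_of_horDeriv_eq_zero hDm hu hzero hw ht]
    rfl
  have hfibre : Φ.symm ⁻¹' {w | (⟨γ 0, w⟩ : TotalSpace F V) ∈ radialGraph u} =
      {w | (⟨γ t, w⟩ : TotalSpace F V) ∈ radialGraph u} := by
    ext w
    have h := hmem (Φ.symm w)
    rw [Φ.apply_symm_apply] at h
    exact h.symm
  set p : V (γ 0) := (Real.exp (u ⟨γ 0, v⟩) / ‖v‖) • v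
  have hp : (⟨γ 0, p⟩ : TotalSpace F V) ∈ radialGraph u := smul_mem_radialGraph hu hv
  have hp0 : p ≠ 0 := ((mem_radialGraph_iff hu _ _).1 hp).1
  have hΦp := (hmem p).2 hp
  obtain ⟨hΦp0, hgauge⟩ : Φ p ∈ {w : V (γ t) | w ≠ 0 ∧ ‖w‖ * Real.exp (-u ⟨γ t, w⟩) = 1} := by
    rw [← fibre_radialGraph hu]
    exact hΦp
  have htransported := (hK _ hp).map Φ
  have hcurv := hK _ hΦp
  change HasGaussianCurvatureAt _ (Φ p) _ at htransported
  change HasGaussianCurvatureAt _ (Φ p) _ at hcurv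
  rw [hfibre, fibre_radialGraph hu] at htransported
  rw [fibre_radialGraph hu] at hcurv
  rw [hK_fibre _ v p hv hp0, hK_fibre _ (P t v) (Φ p) (hP.map_ne_zero hDm hv ht) hΦp0]
  exact (isRadialGauge_fibre hu (γ t)).gaussianCurvature_unique hΦp0 hgauge hcurv htransported

end CurvatureTransport

theorem IsLeviCivita.isMetricCompatible
    {EB : Type*} [NormedAddCommGroup EB] [NormedSpace ℝ EB] [FiniteDimensional ℝ EB]
    [CompleteSpace EB] {H : Type*} [TopologicalSpace H] {I : ModelWithCorners ℝ EB H}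
    {M : Type*} [TopologicalSpace M] [ChartedSpace H M] [IsManifold I ∞ M]
    [RiemannianBundle (fun x : M ↦ TangentSpace I x)]
    [IsContMDiffRiemannianBundle I ∞ EB (fun x : M ↦ TangentSpace I x)]
    {LC : CovariantDerivative I EB (fun x : M ↦ TangentSpace I x)} (hLC : IsLeviCivita LC) :
    CovariantDerivative.IsMetricCompatible (V := fun x : M ↦ TangentSpace I x) LC := by
  have : IsManifold I 1 M := .of_le (n := ∞) (by simp)
  rw [CovariantDerivative.isMetricCompatible_iff (V := fun x : M ↦ TangentSpace I x)]
  intro x X σ τ _ hσ hτ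
  rw [mvfderiv]
  exact hLC.metric x (X x) σ τ hσ hτ

section Main

variable
  {EB : Type*} [NormedAddCommGroup EB] [NormedSpace ℝ EB] [FiniteDimensional ℝ EB]
  {H : Type*} [TopologicalSpace H] {I : ModelWithCorners ℝ EB H} [I.Boundaryless]
  {M : Type*} [TopologicalSpace M] [ChartedSpace H M] [IsManifold I ∞ M] [T2Space M]
  [CompactSpace M] [ConnectedSpace M]
  [RiemannianBundle (fun x : M ↦ TangentSpace I x)]
  [IsContMDiffRiemannianBundle I ∞ EB (fun x : M ↦ TangentSpace I x)]
  {F : Type*} [NormedAddCommGroup F] [NormedSpace ℝ F] [FiniteDimensional ℝ F]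
  {V : M → Type*} [TopologicalSpace (TotalSpace F V)]
  [∀ x, NormedAddCommGroup (V x)] [∀ x, InnerProductSpace ℝ (V x)]
  [FiberBundle F V] [VectorBundle ℝ F V] [ContMDiffVectorBundle ∞ F V I]
  [IsContMDiffRiemannianBundle I ∞ F V]

theorem curvature_const_of_convex [Nontrivial F]
    {LC : CovariantDerivative I EB (fun x : M ↦ TangentSpace I x)}
    (hLC : CovariantDerivative.IsMetricCompatible (V := fun x : M ↦ TangentSpace I x) LC)
    {D : CovariantDerivative I F V} (hD : D.ContMDiffCovariantDerivative ∞)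
    (hDm : D.IsMetricCompatible) {u : TotalSpace F V → ℝ} (hu : IsRadiallyConstantSmooth I u)
    (hconv : IsConvexHypersurface LC D (radialGraph u))
    {K : TotalSpace F V → ℝ} (hK : HasVerticalGaussianCurvature (radialGraph u) K)
    (hK_fibre : ∀ (x : M) (v w : V x), v ≠ 0 → w ≠ 0 → K ⟨x, v⟩ = K ⟨x, w⟩) :
    ∃ a : ℝ, ∀ η ∈ puncturedBundle F V, K η = a := by
  have hnontrivial (x : M) : ∃ v : V x, v ≠ 0 :=
    have := nontrivial_fibre F (V := V) x
    exists_ne 0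
  choose ν hν using hnontrivial
  have hloc : IsLocallyConstant fun x ↦ K ⟨x, ν x⟩ := by
    refine isLocallyConstant_of_eventually_eq_along_curve (I := I) fun γ J hJ h0 hγ ↦ ?_
    obtain ⟨ε, P, hP⟩ := exists_isParallelTransport hD hJ h0 hγ
    filter_upwards [isOpen_Ioo.mem_nhds hP.zero_mem] with t ht
    rw [hK_fibre _ _ (P t (ν (γ 0))) (hν _) (hP.map_ne_zero hDm (hν _) ht)]
    exact hP.curvature_eq_of_horDeriv_eq_zero hDm hu
      (fun _ _ h hv ↦ horDeriv_eq_zero_of_convex hLC hD hDm hu hconv hv h) (hν _) ht hK hK_fibre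
  obtain ⟨x₁⟩ : Nonempty M := inferInstance
  refine ⟨K ⟨x₁, ν x₁⟩, fun ⟨x, v⟩ hv ↦ ?_⟩
  rw [hK_fibre x v (ν x) hv (hν x)]
  exact hloc.apply_eq_of_preconnectedSpace x x₁

theorem theorem1_general {m : ℕ} (hm : 2 ≤ m) (hF : Module.finrank ℝ F = m)
    (LC : CovariantDerivative I EB (fun x : M ↦ TangentSpace I x))
    (hLC : CovariantDerivative.IsMetricCompatible (V := fun x : M ↦ TangentSpace I x) LC)
    (D : CovariantDerivative I F V) (hD : D.ContMDiffCovariantDerivative ∞)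
    (hDm : D.IsMetricCompatible) (K : TotalSpace F V → ℝ)
    (hK_smooth : ContMDiffOn (I.prod 𝓘(ℝ, F)) 𝓘(ℝ, ℝ) ∞ K (puncturedBundle F V))
    (hK_pos : ∀ η ∈ puncturedBundle F V, 0 < K η)
    (hK_fibre : ∀ (x : M) (v w : V x), v ≠ 0 → w ≠ 0 → K ⟨x, v⟩ = K ⟨x, w⟩) :
    (IsRadiallyConstantSmooth I (fun η ↦ -Real.log (K η) / ((m : ℝ) - 1)) ∧
      HasVerticalGaussianCurvature
        (radialGraph (fun η ↦ -Real.log (K η) / ((m : ℝ) - 1))) K) ∧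
    ((∃ a : ℝ, ∀ η ∈ puncturedBundle F V, K η = a) →
      IsConvexHypersurface LC D (radialGraph (fun η ↦ -Real.log (K η) / ((m : ℝ) - 1)))) ∧
    ((¬ ∃ a : ℝ, ∀ η ∈ puncturedBundle F V, K η = a) →
      ∀ u : TotalSpace F V → ℝ, IsRadiallyConstantSmooth I u →
        HasVerticalGaussianCurvature (radialGraph u) K →
        ¬ IsConvexHypersurface LC D (radialGraph u)) := by
  have hu := isRadiallyConstantSmooth_neg_log_div hK_smooth hK_pos hK_fibre ((m : ℝ) - 1)
  have : Nontrivial F := Module.nontrivial_of_finrank_pos (R := ℝ) (by omega)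
  refine ⟨⟨hu, hasVerticalGaussianCurvature_neg_log_div hm hF hu hK_pos hK_fibre⟩, ?_, ?_⟩
  · rintro ⟨a, ha⟩
    exact isConvexHypersurface_of_const LC hD hDm hu (a := -Real.log a / ((m : ℝ) - 1))
      fun η hη ↦ by rw [ha η hη]
  · exact fun hne u hu hK hconv ↦
      hne (curvature_const_of_convex hLC hD hDm hu hconv hK hK_fibre)

end Main

theorem theorem1 {n m : ℕ} (hm : 2 ≤ m)
    {M : Type*} [TopologicalSpace M] [ChartedSpace (EuclideanSpace ℝ (Fin n)) M]
    [IsManifold (𝓡 n) ∞ M] [T2Space M] [CompactSpace M] [ConnectedSpace M]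
    [RiemannianBundle (fun x : M ↦ TangentSpace (𝓡 n) x)]
    [IsContMDiffRiemannianBundle (𝓡 n) ∞ (EuclideanSpace ℝ (Fin n))
      (fun x : M ↦ TangentSpace (𝓡 n) x)]
    {V : M → Type*} [TopologicalSpace (TotalSpace (EuclideanSpace ℝ (Fin m)) V)]
    [∀ x, NormedAddCommGroup (V x)] [∀ x, InnerProductSpace ℝ (V x)]
    [FiberBundle (EuclideanSpace ℝ (Fin m)) V] [VectorBundle ℝ (EuclideanSpace ℝ (Fin m)) V]
    [ContMDiffVectorBundle ∞ (EuclideanSpace ℝ (Fin m)) V (𝓡 n)]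
    [IsContMDiffRiemannianBundle (𝓡 n) ∞ (EuclideanSpace ℝ (Fin m)) V]
    (LC : CovariantDerivative (𝓡 n) (EuclideanSpace ℝ (Fin n))
      (fun x : M ↦ TangentSpace (𝓡 n) x)) (hLC : IsLeviCivita LC)
    (D : CovariantDerivative (𝓡 n) (EuclideanSpace ℝ (Fin m)) V)
    (hD_smooth : CovariantDerivative.ContMDiffCovariantDerivative D ∞)
    (hD_metric : D.IsMetricCompatible)
    (K : TotalSpace (EuclideanSpace ℝ (Fin m)) V → ℝ)
    (hK_smooth : ContMDiffOn ((𝓡 n).prod 𝓘(ℝ, EuclideanSpace ℝ (Fin m))) 𝓘(ℝ, ℝ) ∞ K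
      (puncturedBundle (EuclideanSpace ℝ (Fin m)) V))
    (hK_pos : ∀ η ∈ puncturedBundle (EuclideanSpace ℝ (Fin m)) V, 0 < K η)
    (hK_fibre : ∀ (x : M) (v w : V x), v ≠ 0 → w ≠ 0 → K ⟨x, v⟩ = K ⟨x, w⟩) :
    (IsRadiallyConstantSmooth (𝓡 n) (fun η ↦ -Real.log (K η) / ((m : ℝ) - 1)) ∧
      HasVerticalGaussianCurvature
        (radialGraph (fun η ↦ -Real.log (K η) / ((m : ℝ) - 1))) K) ∧
    ((∃ a : ℝ, ∀ η ∈ puncturedBundle (EuclideanSpace ℝ (Fin m)) V, K η = a) →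
      IsConvexHypersurface LC D (radialGraph (fun η ↦ -Real.log (K η) / ((m : ℝ) - 1)))) ∧
    ((¬ ∃ a : ℝ, ∀ η ∈ puncturedBundle (EuclideanSpace ℝ (Fin m)) V, K η = a) →
      ∀ u : TotalSpace (EuclideanSpace ℝ (Fin m)) V → ℝ,
        IsRadiallyConstantSmooth (𝓡 n) u →
        HasVerticalGaussianCurvature (radialGraph u) K →
        ¬ IsConvexHypersurface LC D (radialGraph u)) := by
  exact theorem1_general hm finrank_euclideanSpace_fin LC hLC.isMetricCompatible D hD_smooth
    hD_metric K hK_smooth hK_pos hK_fibre
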